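/- Let $Y$ be a smooth $7$-manifold with a torsion-free $G_2$ structure: a smooth $3$-form $\varphi$, at each point equivalent under a linear isomorphism $T_pY\cong\mathbb{R}^7$ to the standard $G_2$ form, with $d\varphi=0$ and $d{*}\varphi=0$, where $*$ is the Hodge operator of the Riemannian metric $k$ and the orientation determined by $\varphi$. Let $V$ be a nowhere vanishing smooth vector field on $Y$ that preserves the $G_2$ structure, $\mathcal{L}_V\varphi=0$, and let $\pi:Y\to N$ be a surjective submersion onto a smooth $6$-manifold with $d\pi(V)=0$, so that $N$ is a quotient of $Y$ along the orbits of $V$. Let $t=k(V,V)^{-1/2}$ and $\eta=k(\cdot,t^2V)$, and let $t$ (regarded as a function on $N$), the $2$-form $\sigma$, the Riemannian metric $h$ and the field $J$ of endomorphisms of $TN$ be the objects induced on $N$, that is, \[ \pi^*\sigma=\iota_V\varphi,\qquad k=t\,\pi^*h+t^{-2}\,\eta\otimes\eta,\qquad h(J\,\cdot\,,\,\cdot\,)=\sigma(\,\cdot\,,\,\cdot\,). \] (This $(h,\sigma,J)$ is the induced almost-Kähler structure of $N$.) If the almost-complex structure $J$ is integrable, i.e. its Nijenhuis tensor vanishes,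 then the Ricci form $\kappa=\mathrm{Ric}_h(J\,\cdot\,,\,\cdot\,)$ of the Kähler manifold $(N,h,J)$ is \[ \kappa=\tfrac12\,d\,d^c\log t, \qquad\text{where } d^cf=J\,df=-df\circ J. \] -/

import Mathlib

open scoped Manifold ContDiff

noncomputable section

namespace G2Quotient

/-! ### Tensor calculus on smooth manifolds without boundary -/

section Manifold

variable (n : ℕ) (M : Type*) [TopologicalSpace M] [ChartedSpace (EuclideanSpace ℝ (Fin n)) M]

/-- Vector fields on an `n`-manifold (no smoothness required). -/
abbrev VField : Type _ := (p : M) → TangentSpace (𝓡 n) p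

/-- Fields of endomorphisms of the tangent bundle (no smoothness required). -/
abbrev EndField : Type _ := (p : M) → TangentSpace (𝓡 n) p →L[ℝ] TangentSpace (𝓡 n) p

/-- Fields of alternating `k`-linear forms on the tangent spaces (no smoothness required). -/
abbrev DForm (k : ℕ) : Type _ := (p : M) → TangentSpace (𝓡 n) p [⋀^Fin k]→L[ℝ] ℝ

/-- Smooth Riemannian metrics. -/
abbrev SmoothMetric [IsManifold (𝓡 n) ∞ M] : Type _ :=
  Bundle.ContMDiffRiemannianMetric (IB := 𝓡 n) (n := ∞) (F := EuclideanSpace ℝ (Fin n))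
    (E := (TangentSpace (𝓡 n) : M → Type _))

variable {n M}

/-- A vector field is smooth near the point `p`. -/
def SmoothFieldAt [IsManifold (𝓡 n) ∞ M] (X : VField n M) (p : M) : Prop :=
  ContMDiffAt (𝓡 n) (𝓡 n).tangent ∞ (fun q => (⟨q, X q⟩ : TangentBundle (𝓡 n) M)) p

/-- The inverse `e.symm : ℝⁿ → M` of the preferred chart `e` at `x₀`, differentiated at `y`. -/
def chartInvDeriv (x₀ : M) (y : EuclideanSpace ℝ (Fin n)) :
    EuclideanSpace ℝ (Fin n) →L[ℝ] TangentSpace (𝓡 n) ((extChartAt (𝓡 n) x₀).symm y) :=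
  mfderiv (𝓡 n) (𝓡 n) (extChartAt (𝓡 n) x₀).symm y

/-- The differential at `x` of the preferred chart at `x`. -/
def chartDeriv (x : M) : TangentSpace (𝓡 n) x →L[ℝ] EuclideanSpace ℝ (Fin n) :=
  mfderiv (𝓡 n) (𝓡 n) (extChartAt (𝓡 n) x) x

/-- The pullback of a form on `M` to `ℝⁿ` by the inverse of the preferred chart at `x₀`. -/
def DForm.inChart {k : ℕ} (α : DForm n M k) (x₀ : M) (y : EuclideanSpace ℝ (Fin n)) :
    EuclideanSpace ℝ (Fin n) [⋀^Fin k]→L[ℝ] ℝ :=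
  (α ((extChartAt (𝓡 n) x₀).symm y)).compContinuousLinearMap (chartInvDeriv x₀ y)

/-- A differential form is smooth if it is smooth in every preferred chart. -/
def DForm.Smooth {k : ℕ} (α : DForm n M k) : Prop :=
  ∀ x₀ : M, ContDiffOn ℝ ∞ (α.inChart x₀) (extChartAt (𝓡 n) x₀).target

/-- The exterior derivative, computed at `x` in the preferred chart at `x`; normalized by
`dα(X, Y) = X (α Y) - Y (α X) - α [X, Y]` on 1-forms. -/
def DForm.d {k : ℕ} (α : DForm n M k) : DForm n M (k + 1) := fun x =>
  (extDeriv (α.inChart x) (extChartAt (𝓡 n) x x)).compContinuousLinearMap (chartDeriv x)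

/-- `ℒ_V α = 0`, where `(ℒ_V α)(X₁, …, X_k) = V (α(X₁, …, X_k)) - ∑ᵢ α(X₁, …, [V, Xᵢ], …, X_k)`
for local smooth vector fields `X₁, …, X_k`. -/
def DForm.IsInvariant [IsManifold (𝓡 n) ∞ M] {k : ℕ} (α : DForm n M k) (V : VField n M) : Prop :=
  ∀ (p : M) (X : Fin k → VField n M), (∀ i, SmoothFieldAt (X i) p) →
    mfderiv (𝓡 n) 𝓘(ℝ, ℝ) (fun q => α q (fun i => X i q)) p (V p) =
      ∑ i, α p (Function.update (fun j => X j p) i (VectorField.mlieBracket (𝓡 n) V (X i) p))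

/-- Vanishing of the Nijenhuis tensor
`[J X, J Y] - J [J X, Y] - J [X, J Y] - [X, Y]` of an almost-complex structure `J`. -/
def IsIntegrable [IsManifold (𝓡 n) ∞ M] (J : EndField n M) : Prop :=
  ∀ (p : M) (X Y : VField n M), SmoothFieldAt X p → SmoothFieldAt Y p →
    VectorField.mlieBracket (𝓡 n) (fun q => J q (X q)) (fun q => J q (Y q)) p
      - J p (VectorField.mlieBracket (𝓡 n) (fun q => J q (X q)) Y p)
      - J p (VectorField.mlieBracket (𝓡 n) X (fun q => J q (Y q)) p)
      - VectorField.mlieBracket (𝓡 n) X Y p = 0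

/-- `d^c f = J df`, where `J` acts on 1-forms by `(J γ)(v) = - γ (J v)`. -/
def dc (J : EndField n M) (f : M → ℝ) : DForm n M 1 := fun x =>
  ContinuousAlternatingMap.ofSubsingleton ℝ (TangentSpace (𝓡 n) x) ℝ (0 : Fin 1)
    (-((mfderiv (𝓡 n) 𝓘(ℝ, ℝ) f x : TangentSpace (𝓡 n) x →L[ℝ] ℝ).comp (J x)))

/-! ### The Ricci tensor of the Levi-Civita connection -/

/-- The partial derivative `∂ᵢ f` on `ℝⁿ`. -/
def pderiv (i : Fin n) (f : EuclideanSpace ℝ (Fin n) → ℝ) (y : EuclideanSpace ℝ (Fin n)) :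
    ℝ :=
  fderiv ℝ f y (EuclideanSpace.single i 1)

variable [IsManifold (𝓡 n) ∞ M]

/-- The coefficients `gᵢⱼ` of a metric in the preferred chart at `x₀`. -/
def metricCoeff (g : SmoothMetric n M) (x₀ : M) (i j : Fin n) (y : EuclideanSpace ℝ (Fin n)) :
    ℝ :=
  g.inner ((extChartAt (𝓡 n) x₀).symm y)
    (chartInvDeriv x₀ y (EuclideanSpace.single i 1))
    (chartInvDeriv x₀ y (EuclideanSpace.single j 1))

/-- The coefficients `gⁱʲ` of the inverse matrix. -/
def invMetricCoeff (g : SmoothMetric n M) (x₀ : M) (i j : Fin n) (y : EuclideanSpace ℝ (Fin n)) :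
    ℝ :=
  (Matrix.of fun a b => metricCoeff g x₀ a b y)⁻¹ i j

/-- The Christoffel symbols
`Γˡᵢⱼ = ½ ∑ₘ gˡᵐ (∂ᵢ gⱼₘ + ∂ⱼ gᵢₘ - ∂ₘ gᵢⱼ)` of the Levi-Civita connection. -/
def christoffel (g : SmoothMetric n M) (x₀ : M) (l i j : Fin n) (y : EuclideanSpace ℝ (Fin n)) :
    ℝ :=
  (1 / 2) * ∑ m, invMetricCoeff g x₀ l m y *
    (pderiv i (metricCoeff g x₀ j m) y + pderiv j (metricCoeff g x₀ i m) y
      - pderiv m (metricCoeff g x₀ i j) y)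

/-- The Ricci coefficients
`Rᵢⱼ = ∑ₗ (∂ₗ Γˡᵢⱼ - ∂ⱼ Γˡᵢₗ) + ∑ₗₘ (Γˡₗₘ Γᵐᵢⱼ - Γˡⱼₘ Γᵐᵢₗ)` (positive on round spheres). -/
def ricciCoeff (g : SmoothMetric n M) (x₀ : M) (i j : Fin n) (y : EuclideanSpace ℝ (Fin n)) :
    ℝ :=
  ∑ l, (pderiv l (christoffel g x₀ l i j) y - pderiv j (christoffel g x₀ l i l) y) +
    ∑ l, ∑ m, (christoffel g x₀ l l m y * christoffel g x₀ m i j y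
      - christoffel g x₀ l j m y * christoffel g x₀ m i l y)

/-- The Ricci tensor, computed at `x` in the preferred chart at `x`. -/
def ricci (g : SmoothMetric n M) (x : M) (u v : TangentSpace (𝓡 n) x) : ℝ :=
  ∑ i, ∑ j, ricciCoeff g x i j (extChartAt (𝓡 n) x x) * chartDeriv x u i * chartDeriv x v j

/-- The Ricci form `κ(u, v) = Ric(J u, v)` of a Kähler manifold, the fundamental 2-form being
`g(J u, v)`. -/
def ricciForm (g : SmoothMetric n M) (J : EndField n M) (x : M)
    (u v : TangentSpace (𝓡 n) x) : ℝ :=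
  ricci g x (J x u) v

end Manifold

/-! ### `G₂` structures -/

/-- The constant form `e^{I 0} ∧ ⋯ ∧ e^{I (k-1)}` on `ℝⁿ`, sending `v₀, …, v_{k-1}` to the
determinant of the matrix `(vₐ)_{I b}`. -/
def coordForm {n k : ℕ} (I : Fin k → Fin n) : EuclideanSpace ℝ (Fin n) [⋀^Fin k]→L[ℝ] ℝ :=
  { (Matrix.detRowAlternating (R := ℝ) (n := Fin k)).compLinearMap
      (LinearMap.pi fun b =>
        (EuclideanSpace.proj (I b) : EuclideanSpace ℝ (Fin n) →L[ℝ] ℝ).toLinearMap) with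
    cont := by
      change Continuous fun v : Fin k → EuclideanSpace ℝ (Fin n) => Matrix.det (fun a b => v a (I b))
      exact Continuous.matrix_det (by fun_prop) }

/-- The model `G₂` form on `ℝ⁷` (with the coordinates numbered from `0` to `6`):
`e⁰¹² + e⁰³⁴ + e⁰⁵⁶ + e¹³⁵ - e¹⁴⁶ - e²³⁶ - e²⁴⁵`. -/
def phi0 : EuclideanSpace ℝ (Fin 7) [⋀^Fin 3]→L[ℝ] ℝ :=
  coordForm ![0, 1, 2] + coordForm ![0, 3, 4] + coordForm ![0, 5, 6] + coordForm ![1, 3, 5]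
    - coordForm ![1, 4, 6] - coordForm ![2, 3, 6] - coordForm ![2, 4, 5]

/-- The Hodge dual of `phi0` for the Euclidean metric and the orientation `e⁰¹²³⁴⁵⁶`:
`e³⁴⁵⁶ + e¹²⁵⁶ + e¹²³⁴ + e⁰²⁴⁶ - e⁰²³⁵ - e⁰¹⁴⁵ - e⁰¹³⁶`. -/
def starPhi0 : EuclideanSpace ℝ (Fin 7) [⋀^Fin 4]→L[ℝ] ℝ :=
  coordForm ![3, 4, 5, 6] + coordForm ![1, 2, 5, 6] + coordForm ![1, 2, 3, 4]
    + coordForm ![0, 2, 4, 6] - coordForm ![0, 2, 3, 5] - coordForm ![0, 1, 4, 5]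
    - coordForm ![0, 1, 3, 6]

section G2

variable {Y : Type*} [TopologicalSpace Y] [ChartedSpace (EuclideanSpace ℝ (Fin 7)) Y]

/-- A 3-form on a 7-manifold is admissible if at each point it is identified with the model form
by some linear isomorphism of the tangent space with `ℝ⁷`. -/
def IsAdmissible (φ : DForm 7 Y 3) : Prop :=
  ∀ p, ∃ e : TangentSpace (𝓡 7) p ≃L[ℝ] EuclideanSpace ℝ (Fin 7),
    φ p = phi0.compContinuousLinearMap (e : TangentSpace (𝓡 7) p →L[ℝ] EuclideanSpace ℝ (Fin 7))

variable {φ : DForm 7 Y 3}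

/-- A linear isomorphism of the tangent space with `ℝ⁷` that identifies `φ` with the model form.
It is unique up to an element of `G₂ ⊂ SO(7)`. -/
def g2Frame (hφ : IsAdmissible φ) (p : Y) :
    TangentSpace (𝓡 7) p ≃L[ℝ] EuclideanSpace ℝ (Fin 7) :=
  Classical.choose (hφ p)

/-- The Riemannian metric `k` determined by `φ`. -/
def g2Metric (hφ : IsAdmissible φ) (p : Y) (u v : TangentSpace (𝓡 7) p) : ℝ :=
  inner ℝ (g2Frame hφ p u) (g2Frame hφ p v)

/-- The 4-form `*φ`, for the metric and the orientation determined by `φ`. -/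
def starPhi (hφ : IsAdmissible φ) : DForm 7 Y 4 := fun p =>
  starPhi0.compContinuousLinearMap
    (g2Frame hφ p : TangentSpace (𝓡 7) p →L[ℝ] EuclideanSpace ℝ (Fin 7))

/-- A torsion-free `G₂` structure: `dφ = 0` and `d*φ = 0`. -/
def IsTorsionFree (hφ : IsAdmissible φ) : Prop :=
  φ.d = 0 ∧ (starPhi hφ).d = 0

/-- An infinitesimal isometry of the `G₂` structure that has no zeros. -/
structure IsNonvanishingSymmetry [IsManifold (𝓡 7) ∞ Y] (φ : DForm 7 Y 3) (V : VField 7 Y) :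
    Prop where
  smooth : ∀ p, SmoothFieldAt V p
  ne_zero : ∀ p, V p ≠ 0
  invariant : φ.IsInvariant V

variable {N : Type*} [TopologicalSpace N] [ChartedSpace (EuclideanSpace ℝ (Fin 6)) N]

/-- `π : Y → N` realizes the 6-manifold `N` as a quotient of `Y` along the orbits of `V`: a
surjective submersion that is constant along `V`. When `V` has no zeros, the kernel of `dπ` is
spanned by `V`, so the fibres are 1-dimensional and consist of orbits of `V`; the projection of a
principal circle bundle and the local orbit spaces of `V` are examples. -/
structure IsQuotientMap (V : VField 7 Y) (π : Y → N) : Prop where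
  smooth : ContMDiff (𝓡 7) (𝓡 6) ∞ π
  surjective : Function.Surjective π
  submersion : ∀ p, Function.Surjective (mfderiv (𝓡 7) (𝓡 6) π p)
  vertical : ∀ p, mfderiv (𝓡 7) (𝓡 6) π p (V p) = 0

variable [IsManifold (𝓡 6) ∞ N]

/-- `t`, `σ`, `h`, `J` are the function, the 2-form, the Riemannian metric and the field of
endomorphisms that the `G₂` structure `φ` and the field `V` induce on the quotient `N`. As `π` is
a surjective submersion, each of them is determined by the equation below. -/
structure IsInduced (hφ : IsAdmissible φ) (V : VField 7 Y) (π : Y → N)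
    (t : N → ℝ) (σ : DForm 6 N 2) (h : SmoothMetric 6 N) (J : EndField 6 N) : Prop where
  /-- `t = k(V, V)^{-1/2}` -/
  t_eq : ∀ p, t (π p) = (Real.sqrt (g2Metric hφ p (V p) (V p)))⁻¹
  /-- `π^* σ = ι_V φ` -/
  sigma_eq : ∀ (p : Y) (u v : TangentSpace (𝓡 7) p),
    σ (π p) ![mfderiv (𝓡 7) (𝓡 6) π p u, mfderiv (𝓡 7) (𝓡 6) π p v] = φ p ![V p, u, v]
  /-- `k = t π^* h + t⁻² η ⊗ η` with `η = k(·, t² V)`; thus `t h` is the quotient metric -/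
  metric_eq : ∀ (p : Y) (u v : TangentSpace (𝓡 7) p),
    g2Metric hφ p u v =
      t (π p) * h.inner (π p) (mfderiv (𝓡 7) (𝓡 6) π p u) (mfderiv (𝓡 7) (𝓡 6) π p v)
        + ((t (π p)) ^ 2)⁻¹ * (g2Metric hφ p u ((t (π p)) ^ 2 • V p)
          * g2Metric hφ p v ((t (π p)) ^ 2 • V p))
  /-- `h(J ·, ·) = σ` -/
  J_eq : ∀ (x : N) (u v : TangentSpace (𝓡 6) x), h.inner x (J x u) v = σ x ![u, v]

end G2

end G2Quotient

end

/-!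
Locally the quotient `N` is an open subset of `ℝ⁶` with a local section `f` of `π`, and the forms
`ι_V φ` and `ι_V *φ` are pulled back along `f`. The field `V` preserves `φ`, hence also `*φ`, which
is a smooth function of `φ` (`exists_smooth_star`, `LieDerivEqZero.star`). By Cartan's formula
`ι_V φ` and `ι_V *φ` are then closed (`extDeriv_curryLeft_eq_zero`). The first of them restricts to
`σ`. The restriction `β` of the second is, for the metric `h` and the almost-complex structure `J`,
the real part of a form of type `(3, 0)`, of squared norm `t` relative to the real part of a unit
complex volume form; this is the algebra of the cross product `⟪u × v, w⟫ = φ(u, v, w)` of `ℝ⁷`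
(`isSU3_of_section`). Only the values of `β` along the section are used, so it does not matter that
another section may give a different form.

Thus `N` carries locally an almost-Kähler metric and a closed form `β` (`IsKahlerSU3`). As `J` is
integrable and `σ` is closed, `J` is parallel (`IsKahlerSU3.fderiv_J`), and `∇ β` is again of type
`(3, 0) + (0, 3)`, so that `∇ β = p ⊗ β + q ⊗ β(J ·, ·, ·)` for two 1-forms `p` and `q`. The
squared norm `t` of `β` determines `p = ½ d log t`, and `dβ = 0` then forces `q = ½ dᶜ log t`
(`IsKahlerSU3.nabla_β`). Differentiating once more, the curvature acts on `β` through
`½ d dᶜ log t` (`IsKahlerSU3.curvatureMap_β`). On the canonical line, on the other hand, it acts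
through the complex trace of the curvature operators, which is the Ricci form by the Bianchi
identity (`trace_J_comp_curvature`). Comparing the two gives `IsKahlerSU3.trace_curvatureMap`.

The frames `g2Frame` are chosen point by point, without continuity. The smoothness of `*φ`, of `t`
and of `β` therefore rests on formulas for the metric and the Hodge dual in terms of the
coefficients of `φ` (`gramOfForm`, `starCoeff`), and the smoothness of `J` on that of `σ` and `h`.
-/

set_option maxSynthPendingDepth 3

noncomputable section

namespace G2Quotient

/-! ### `SU(3)` structures on a vector space -/

section PointwiseSU3

variable {E : Type*} [NormedAddCommGroup E] [NormedSpace ℝ E]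

/-- The vectors `e₀, e₁, e₂` form a unitary basis of a 3-dimensional complex vector space whose
complex structure is `J` and whose Hermitian metric has real part `g`: the six vectors
`e₀, e₁, e₂, J e₀, J e₁, J e₂` are `g`-orthonormal (for a `g`-orthogonal `J`). -/
structure IsUnitaryFrame (g : E →L[ℝ] E →L[ℝ] ℝ) (J : E →L[ℝ] E) (e : Fin 3 → E) : Prop where
  inner_eq : ∀ i j, g (e i) (e j) = if i = j then 1 else 0
  inner_J_eq : ∀ i j, g (J (e i)) (e j) = 0

/-- A metric `g` and an orthogonal complex structure `J` on the same vector space. -/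
structure IsHermitian (g : E →L[ℝ] E →L[ℝ] ℝ) (J : E →L[ℝ] E) : Prop where
  symm : ∀ a b, g a b = g b a
  pos : ∀ a, a ≠ 0 → 0 < g a a
  J_sq : ∀ a, J (J a) = -a
  skew : ∀ a b, g (J a) b = -g a (J b)

/-- The real trilinear form `γ` is the real part of a complex 3-form of type `(3, 0)`. -/
structure IsRePart30 (J : E →L[ℝ] E) (γ : E →L[ℝ] E →L[ℝ] E →L[ℝ] ℝ) : Prop where
  swap₁₂ : ∀ a b c, γ a b c = -γ b a c
  swap₂₃ : ∀ a b c, γ a b c = -γ a c b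
  type : ∀ a b c, γ (J a) b c = γ a (J b) c

/-- `g`, `J` and the form `β` of type `(3, 0) + (0, 3)` make up an `SU(3)` structure in which `β`
has the norm `√τ` times that of the real part of a unit complex volume form. The norm is recorded
as a Hadamard inequality together with the existence of unitary frames, starting from any unit
vector, for which it is an equality. -/
structure IsSU3 (g : E →L[ℝ] E →L[ℝ] ℝ) (J : E →L[ℝ] E) (β : E →L[ℝ] E →L[ℝ] E →L[ℝ] ℝ)
    (τ : ℝ) : Prop extends IsHermitian g J, IsRePart30 J β where
  norm_pos : 0 < τ
  hadamard : ∀ a b c, β a b c ^ 2 + β (J a) b c ^ 2 ≤ τ * (g a a * g b b * g c c)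
  exists_frame : ∀ a, g a a = 1 → ∃ e : Fin 3 → E, e 0 = a ∧ IsUnitaryFrame g J e ∧
    β (e 0) (e 1) (e 2) ^ 2 + β (J (e 0)) (e 1) (e 2) ^ 2 = τ

variable {g : E →L[ℝ] E →L[ℝ] ℝ} {J : E →L[ℝ] E} {e : Fin 3 → E}

namespace IsHermitian

variable (hH : IsHermitian g J)
include hH

theorem inner_J_J (a b : E) : g (J a) (J b) = g a b := by
  rw [hH.skew, hH.J_sq]; simp

theorem eq_of_inner_eq {a b : E} (h : ∀ c, g a c = g b c) : a = b := by
  by_contra hab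
  have := hH.pos (a - b) (sub_ne_zero.mpr hab)
  simp [h] at this

end IsHermitian

namespace IsUnitaryFrame

variable (he : IsUnitaryFrame g J e)

/-- The real basis `e₀, e₁, e₂, J e₀, J e₁, J e₂` attached to a unitary frame. -/
def vec (J : E →L[ℝ] E) (e : Fin 3 → E) : Fin 3 ⊕ Fin 3 → E := Sum.elim e fun i => J (e i)

include he

theorem inner_vec (hH : IsHermitian g J) (i j : Fin 3 ⊕ Fin 3) :
    g (vec J e i) (vec J e j) = if i = j then 1 else 0 := by
  rcases i with i | i <;> rcases j with j | j
  · simp [vec, he.inner_eq]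
  · simp [vec, hH.symm (e i), he.inner_J_eq]
  · simp [vec, he.inner_J_eq]
  · simp [vec, hH.inner_J_J, he.inner_eq]

theorem linearIndependent_vec (hH : IsHermitian g J) : LinearIndependent ℝ (vec J e) := by
  rw [Fintype.linearIndependent_iff]
  intro c hc i
  have h : g (∑ j, c j • vec J e j) (vec J e i) = 0 := by simp [hc]
  simpa [-Fintype.sum_sum_type, he.inner_vec hH] using h

variable (hE : Module.finrank ℝ E = 6)

/-- The real basis `e₀, e₁, e₂, J e₀, J e₁, J e₂` as a `Module.Basis`. -/
def basis (hH : IsHermitian g J) : Module.Basis (Fin 3 ⊕ Fin 3) ℝ E :=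
  basisOfLinearIndependentOfCardEqFinrank (he.linearIndependent_vec hH) (by simp [hE])

theorem basis_apply (hH : IsHermitian g J) (i : Fin 3 ⊕ Fin 3) :
    he.basis hE hH i = vec J e i := by
  simp [basis]

theorem basis_repr (hH : IsHermitian g J) (x : E) (i : Fin 3 ⊕ Fin 3) :
    (he.basis hE hH).repr x i = g x (vec J e i) := by
  conv_rhs => rw [← (he.basis hE hH).sum_repr x]
  simp [-Fintype.sum_sum_type, he.basis_apply hE hH, he.inner_vec hH]

include hE in
theorem trace_eq (hH : IsHermitian g J) (A : E →L[ℝ] E) :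
    LinearMap.trace ℝ E A = ∑ i, g (A (e i)) (e i) + ∑ i, g (A (J (e i))) (J (e i)) := by
  rw [LinearMap.trace_eq_matrix_trace ℝ (he.basis hE hH)]
  simp [Matrix.trace, LinearMap.toMatrix_apply, he.basis_repr hE hH, he.basis_apply hE hH, vec]

include hE in
theorem expand (hH : IsHermitian g J) (x : E) :
    x = (g x (e 0) • e 0 + g x (e 1) • e 1 + g x (e 2) • e 2) +
      (g x (J (e 0)) • J (e 0) + g x (J (e 1)) • J (e 1) + g x (J (e 2)) • J (e 2)) := by
  conv_lhs => rw [← (he.basis hE hH).sum_repr x]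
  simp [he.basis_apply hE hH, he.basis_repr hE hH, vec, Fin.sum_univ_three]

end IsUnitaryFrame

namespace IsRePart30

variable {γ δ : E →L[ℝ] E →L[ℝ] E →L[ℝ] ℝ} (hγ : IsRePart30 J γ)
include hγ

theorem swap₁₃ (a b c : E) : γ a b c = -γ c b a := by
  rw [hγ.swap₁₂ a, hγ.swap₂₃ b, hγ.swap₁₂ b]; ring

theorem self₁₂ (a b : E) : γ a a b = 0 := by linarith [hγ.swap₁₂ a a b]

theorem self₂₃ (a b : E) : γ a b b = 0 := by linarith [hγ.swap₂₃ a b b]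

theorem self₁₃ (a b : E) : γ a b a = 0 := by linarith [hγ.swap₁₃ a b a]

theorem type₂ (a b c : E) : γ a (J b) c = γ (J a) b c := (hγ.type a b c).symm

theorem type₃ (a b c : E) : γ a b (J c) = γ (J a) b c := by
  rw [hγ.swap₂₃ a b, ← hγ.type, ← hγ.swap₂₃]

theorem J_self₁₂ (a b : E) : γ (J a) a b = 0 := by
  linarith [hγ.type a a b, hγ.swap₁₂ (J a) a b]

theorem J_self₁₃ (a b : E) : γ (J a) b a = 0 := by
  rw [hγ.swap₂₃, hγ.J_self₁₂, neg_zero]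

/-- The form `γ(J ·, ·, ·)`, again of type `(3, 0) + (0, 3)`. -/
theorem comp_J : IsRePart30 J (γ.comp J) where
  swap₁₂ a b c := by
    simp only [ContinuousLinearMap.comp_apply]
    rw [hγ.type, hγ.swap₁₂]
  swap₂₃ a b c := by
    simp only [ContinuousLinearMap.comp_apply]
    rw [hγ.swap₂₃]
  type a b c := by
    simp only [ContinuousLinearMap.comp_apply]
    rw [hγ.type]

/-- An endomorphism `A` that commutes with `J` acts on the complex line of `(3, 0)`-forms by its
complex trace, whose real and imaginary parts are `½ tr A` and `-½ tr (J A)`. -/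
theorem derivation_apply (hE : Module.finrank ℝ E = 6)
    (hH : IsHermitian g J) (he : IsUnitaryFrame g J e) {A : E →L[ℝ] E}
    (hA : ∀ a, A (J a) = J (A a)) :
    γ (A (e 0)) (e 1) (e 2) + γ (e 0) (A (e 1)) (e 2) + γ (e 0) (e 1) (A (e 2)) =
      1 / 2 * LinearMap.trace ℝ E A * γ (e 0) (e 1) (e 2)
        - 1 / 2 * LinearMap.trace ℝ E (J.comp A) * γ (J (e 0)) (e 1) (e 2) := by
  have h0 : γ (A (e 0)) (e 1) (e 2) = g (A (e 0)) (e 0) * γ (e 0) (e 1) (e 2)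
      + g (A (e 0)) (J (e 0)) * γ (J (e 0)) (e 1) (e 2) := by
    conv_lhs => rw [he.expand hE hH (A (e 0))]
    simp [hγ.self₁₂, hγ.self₁₃, hγ.J_self₁₂, hγ.J_self₁₃]
  have h1 : γ (e 0) (A (e 1)) (e 2) = g (A (e 1)) (e 1) * γ (e 0) (e 1) (e 2)
      + g (A (e 1)) (J (e 1)) * γ (J (e 0)) (e 1) (e 2) := by
    conv_lhs => rw [he.expand hE hH (A (e 1))]
    simp [hγ.self₁₂, hγ.self₂₃, hγ.J_self₁₂, hγ.type₂]
  have h2 : γ (e 0) (e 1) (A (e 2)) = g (A (e 2)) (e 2) * γ (e 0) (e 1) (e 2)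
      + g (A (e 2)) (J (e 2)) * γ (J (e 0)) (e 1) (e 2) := by
    conv_lhs => rw [he.expand hE hH (A (e 2))]
    simp [hγ.self₂₃, hγ.self₁₃, hγ.J_self₁₃, hγ.type₃]
  rw [h0, h1, h2, he.trace_eq hE hH, he.trace_eq hE hH]
  simp only [Fin.sum_univ_three, ContinuousLinearMap.comp_apply, hA, hH.inner_J_J, hH.skew]
  ring

theorem eq_zero_on_frame (h : γ (e 0) (e 1) (e 2) = 0) (i j k : Fin 3) :
    γ (e i) (e j) (e k) = 0 := by
  have h1 : γ (e 1) (e 0) (e 2) = 0 := by rw [hγ.swap₁₂, h, neg_zero]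
  have h2 : γ (e 0) (e 2) (e 1) = 0 := by rw [hγ.swap₂₃, h, neg_zero]
  have h3 : γ (e 2) (e 1) (e 0) = 0 := by rw [hγ.swap₁₃, h, neg_zero]
  have h4 : γ (e 1) (e 2) (e 0) = 0 := by rw [hγ.swap₂₃, h1, neg_zero]
  have h5 : γ (e 2) (e 0) (e 1) = 0 := by rw [hγ.swap₂₃, h3, neg_zero]
  fin_cases i <;> fin_cases j <;> fin_cases k <;>
    simp [hγ.self₁₂, hγ.self₂₃, hγ.self₁₃, h, h1, h2, h3, h4, h5]

/-- A form of type `(3, 0) + (0, 3)` is determined by its two values at a unitary frame. -/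
theorem eq_zero_of_frame (hE : Module.finrank ℝ E = 6) (hH : IsHermitian g J)
    (he : IsUnitaryFrame g J e) (h : γ (e 0) (e 1) (e 2) = 0)
    (hJ : γ (J (e 0)) (e 1) (e 2) = 0) : γ = 0 := by
  have h1 := hγ.eq_zero_on_frame h
  have h2 : ∀ i j k, γ (J (e i)) (e j) (e k) = 0 := hγ.comp_J.eq_zero_on_frame hJ
  have h3 : ∀ b (j k : Fin 3), γ (e j) (e k) b = 0 ∧ γ (J (e j)) (e k) b = 0 := by
    intro b j k
    rw [he.expand hE hH b]
    simp [h1, h2, hγ.type₃, hH.J_sq]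
  have h4 : ∀ a b (j : Fin 3), γ (e j) a b = 0 ∧ γ (J (e j)) a b = 0 := by
    intro a b j
    rw [he.expand hE hH a]
    simp [h3, hγ.type₂, hH.J_sq]
  ext a b c
  rw [he.expand hE hH a]
  simp [h4]

/-- The real parts of `(3, 0)`-forms are a complex line, spanned over `ℝ` by `γ` and
`γ(J ·, ·, ·)` as soon as `γ` is not zero. -/
theorem exists_combination (hE : Module.finrank ℝ E = 6) (hH : IsHermitian g J)
    (he : IsUnitaryFrame g J e) (hδ : IsRePart30 J δ)
    (h : 0 < γ (e 0) (e 1) (e 2) ^ 2 + γ (J (e 0)) (e 1) (e 2) ^ 2) :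
    ∃ p q : ℝ, ∀ a b c, δ a b c = p * γ a b c + q * γ (J a) b c := by
  set u := γ (e 0) (e 1) (e 2) with hu
  set v := γ (J (e 0)) (e 1) (e 2) with hv
  set x := δ (e 0) (e 1) (e 2) with hx
  set y := δ (J (e 0)) (e 1) (e 2) with hy
  -- the complex quotient `(x - i y) / (u - i v)`
  refine ⟨(x * u + y * v) / (u ^ 2 + v ^ 2), (x * v - y * u) / (u ^ 2 + v ^ 2), ?_⟩
  set p := (x * u + y * v) / (u ^ 2 + v ^ 2) with hp
  set q := (x * v - y * u) / (u ^ 2 + v ^ 2) with hq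
  set γJ : E →L[ℝ] E →L[ℝ] E →L[ℝ] ℝ := γ.comp J with hγJ_def
  have hγJ_apply : ∀ a, γJ a = γ (J a) := fun a => rfl
  have hγJ : IsRePart30 J γJ := hγ.comp_J
  have hz : IsRePart30 J (δ - p • γ - q • γJ) := by
    constructor
    · intro a b c
      simp only [sub_apply, smul_apply, smul_eq_mul]
      rw [hδ.swap₁₂, hγ.swap₁₂, hγJ.swap₁₂]; ring
    · intro a b c
      simp only [sub_apply, smul_apply, smul_eq_mul]
      rw [hδ.swap₂₃, hγ.swap₂₃, hγJ.swap₂₃]; ring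
    · intro a b c
      simp only [sub_apply, smul_apply, smul_eq_mul]
      rw [hδ.type, hγ.type, hγJ.type]
  have h0 := hz.eq_zero_of_frame hE hH he
    (by
      simp only [sub_apply, smul_apply, smul_eq_mul,
        hγJ_apply, ← hu, ← hv, ← hx, hp, hq]
      field_simp; ring)
    (by
      simp only [sub_apply, smul_apply, smul_eq_mul,
        hγJ_apply, hH.J_sq, map_neg, neg_apply,
        ← hu, ← hv, ← hy, hp, hq]
      field_simp; ring)
  intro a b c
  have := congrArg (fun f : E →L[ℝ] E →L[ℝ] E →L[ℝ] ℝ => f a b c) h0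
  simp only [sub_apply, smul_apply, smul_eq_mul, hγJ_apply, zero_apply] at this
  linarith

end IsRePart30

/-- For a curvature tensor `R` of Kähler type, `tr (J R(a, b)) = 2 Ric(J a, b)`, where `Ric(u, v)` is
the trace of `c ↦ R(c, v) u`. -/
theorem trace_J_comp_curvature (hE : Module.finrank ℝ E = 6) (hH : IsHermitian g J)
    (he : IsUnitaryFrame g J e) {R : E →L[ℝ] E →L[ℝ] E →L[ℝ] E}
    (h_antisymm : ∀ a b, R a b = -R b a)
    (h_bianchi : ∀ a b c, R a b c + R b c a + R c a b = 0)
    (h_skew : ∀ a b c d, g (R a b c) d = -g c (R a b d))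
    (h_comm : ∀ a b c, R a b (J c) = J (R a b c)) (a b : E) :
    LinearMap.trace ℝ E (J.comp (R a b)) =
      2 * LinearMap.trace ℝ E ((R.flip b).flip (J a)) := by
  set ric : E → E → ℝ := fun a b => LinearMap.trace ℝ E ((R.flip a).flip b) with hric
  have h_tr : ∀ a b, LinearMap.trace ℝ E (R a b) = 0 := by
    intro a b
    have h0 : ∀ c, g (R a b c) c = 0 := fun c => by
      have := h_skew a b c c
      rw [hH.symm c] at this
      linarith
    rw [he.trace_eq hE hH]
    simp [h0]
  have h_cyc : ∀ A : E →L[ℝ] E, LinearMap.trace ℝ E (A.comp J) = LinearMap.trace ℝ E (J.comp A) :=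
    fun A => LinearMap.trace_mul_comm ℝ (A : E →ₗ[ℝ] E) (J : E →ₗ[ℝ] E)
  have h_flip : ∀ a b c, ((R.flip a).flip b) c = R c a b := fun a b c => rfl
  -- the pair symmetry of the curvature tensor
  have h_pair : ∀ a b c d, g (R a b c) d = g (R c d a) b := by
    intro a b c d
    have B : ∀ a b c d, g (R a b c) d + g (R b c a) d + g (R c a b) d = 0 := fun a b c d => by
      have := congrArg (fun x => g x d) (h_bianchi a b c)
      simpa using this
    have S : ∀ a b c d, g (R a b c) d = -g (R b a c) d := fun a b c d => by
      rw [h_antisymm a b]; simp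
    have T : ∀ a b c d, g (R a b c) d = -g (R a b d) c := fun a b c d => by
      rw [h_skew, hH.symm c]
    linarith [B a b c d, B b c d a, B c d a b, B d a b c, S a b c d, S b c a d, S c a b d,
      S b c d a, S c d b a, S d b c a, S c d a b, S d a c b, S a c d b, S d a b c, S a b d c,
      S b d a c, T a b c d, T b c a d, T c a b d, T b c d a, T c d b a, T d b c a, T c d a b,
      T d a c b, T a c d b, T d a b c, T a b d c, T b d a c]
  have h_JJ : ∀ a b, R (J a) (J b) = R a b := by
    intro a b
    ext c
    refine hH.eq_of_inner_eq fun d => ?_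
    rw [h_pair, h_pair a b, h_comm, hH.inner_J_J]
  have h_symm : ∀ a b, ric a b = ric b a := by
    intro a b
    have h : (R.flip a).flip b - (R.flip b).flip a = -R a b := by
      ext c
      have h1 := h_bianchi a b c
      simp only [sub_apply, h_flip, neg_apply]
      rw [h_antisymm b c] at h1
      simp only [neg_apply] at h1
      rw [← sub_eq_zero, ← h1]
      abel
    have h2 := congrArg (fun A : E →L[ℝ] E => LinearMap.trace ℝ E A) h
    simp only [ContinuousLinearMap.toLinearMap_sub, map_sub, ContinuousLinearMap.toLinearMap_neg,
      map_neg, h_tr, neg_zero] at h2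
    exact sub_eq_zero.mp h2
  have h_ricJ : ∀ a b, ric (J a) (J b) = ric a b := by
    intro a b
    have h : ((R.flip (J a)).flip (J b)).comp J = J.comp ((R.flip a).flip b) := by
      ext c
      simp [h_comm, h_JJ]
    have h2 := congrArg (fun A : E →L[ℝ] E => LinearMap.trace ℝ E A) h
    have h3 : (((R.flip (J a)).flip (J b)).comp J).comp J = -((R.flip (J a)).flip (J b)) := by
      ext c
      simp [hH.J_sq]
    have h4 : LinearMap.trace ℝ E ((J.comp ((R.flip a).flip b)).comp J) = -ric a b := by
      rw [h_cyc, hric, ← map_neg]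
      congr 1
      ext c
      simp [hH.J_sq]
    rw [← h, h3, ContinuousLinearMap.toLinearMap_neg, map_neg] at h4
    exact neg_injective h4
  have h_right : ∀ a b, LinearMap.trace ℝ E (((R.flip a).flip b).comp J) = ric a (J b) := by
    intro a b
    rw [h_cyc]
    congr 2
    ext c
    simp [h_comm]
  have h : (R a b).comp J = ((R.flip b).flip a).comp J - ((R.flip a).flip b).comp J := by
    ext c
    have h1 := h_bianchi a b (J c)
    rw [h_antisymm b (J c)] at h1
    simp only [neg_apply] at h1
    simp only [sub_apply, ContinuousLinearMap.comp_apply, h_flip]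
    rw [← sub_eq_zero, ← h1]
    abel
  have h2 := congrArg (fun A : E →L[ℝ] E => LinearMap.trace ℝ E A) h
  simp only [ContinuousLinearMap.toLinearMap_sub, map_sub, h_right] at h2
  have h3 : ric a (J b) = -ric (J a) b := by
    rw [← h_ricJ, hH.J_sq]
    simp [hric]
  rw [← h_cyc, h2, h3, h_symm b]
  change _ = 2 * ric b (J a)
  rw [h_symm b (J a)]
  ring

/-- The algebra behind the parallelism of `J` on an integrable almost-Kähler manifold, where
`S(a, b, c) = g((∇ₐ J) b, c)`: the first two conditions hold on any almost-Hermitian manifold, the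
third says that the fundamental form is closed and the last that the Nijenhuis tensor vanishes. -/
theorem eq_zero_of_cyclic_of_nijenhuis {S : E → E → E → ℝ}
    (h_skew : ∀ a b c, S a b c = -S a c b) (h_anti : ∀ a b c, S a (J b) c = S a b (J c))
    (h_cyclic : ∀ a b c, S a b c + S b c a + S c a b = 0)
    (h_nij : ∀ a b c, S (J a) b c - S (J b) a c + S a b (J c) - S b a (J c) = 0)
    (hJ : ∀ a, J (J a) = -a)
    (h_neg : ∀ a b c, S a b (-c) = -S a b c) (a b c : E) :
    S a b c = 0 := by
  -- `T` is symmetric in its first two and skew in its last two arguments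
  have hT : ∀ a b c, S (J a) b c + S a b (J c) = 0 := by
    have h1 : ∀ a b c, S (J a) b c + S a b (J c) = S (J b) a c + S b a (J c) := fun a b c => by
      linarith [h_nij a b c]
    have h2 : ∀ a b c, S (J a) b c + S a b (J c) = -(S (J a) c b + S a c (J b)) := fun a b c => by
      rw [← h_anti a b c, h_skew (J a) b c, h_skew a (J b) c]; ring
    intro a b c
    linarith [h1 a b c, h2 b a c, h1 b c a, h2 c b a, h1 c a b, h2 a c b]
  have hA : ∀ a b c, S a b (J c) = 0 := by
    have h1 : ∀ a b c, S a b (J c) + S b c (J a) - S c a (J b) = 0 := fun a b c => by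
      have h1 := h_cyclic a b (J c)
      rw [h_anti] at h1
      linarith [hT c a b]
    intro a b c
    linarith [h1 a b c, h1 c a b]
  have := hA a b (J c)
  rw [hJ, h_neg] at this
  linarith

end PointwiseSU3

/-! ### Kähler `SU(3)` structures on open subsets of a vector space -/

section ApplyRules

variable {E F G : Type*} [NormedAddCommGroup E] [NormedSpace ℝ E] [NormedAddCommGroup F]
  [NormedSpace ℝ F] [NormedAddCommGroup G] [NormedSpace ℝ G] {z : E} {u v w : E → F}

theorem fderiv_apply₁ {A : E → F →L[ℝ] G} (hA : DifferentiableAt ℝ A z)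
    (hu : DifferentiableAt ℝ u z) (X : E) :
    fderiv ℝ (fun y => A y (u y)) z X = fderiv ℝ A z X (u z) + A z (fderiv ℝ u z X) := by
  rw [(hA.hasFDerivAt.clm_apply hu.hasFDerivAt).fderiv]
  simp [add_comm]

theorem fderiv_apply₂ {A : E → F →L[ℝ] F →L[ℝ] G} (hA : DifferentiableAt ℝ A z)
    (hu : DifferentiableAt ℝ u z) (hv : DifferentiableAt ℝ v z) (X : E) :
    fderiv ℝ (fun y => A y (u y) (v y)) z X =
      fderiv ℝ A z X (u z) (v z) + A z (fderiv ℝ u z X) (v z) + A z (u z) (fderiv ℝ v z X) := by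
  rw [fderiv_apply₁ (hA.clm_apply hu) hv, fderiv_apply₁ hA hu]
  simp

theorem fderiv_apply₃ {A : E → F →L[ℝ] F →L[ℝ] F →L[ℝ] G} (hA : DifferentiableAt ℝ A z)
    (hu : DifferentiableAt ℝ u z) (hv : DifferentiableAt ℝ v z) (hw : DifferentiableAt ℝ w z)
    (X : E) :
    fderiv ℝ (fun y => A y (u y) (v y) (w y)) z X =
      fderiv ℝ A z X (u z) (v z) (w z) + A z (fderiv ℝ u z X) (v z) (w z)
        + A z (u z) (fderiv ℝ v z X) (w z) + A z (u z) (v z) (fderiv ℝ w z X) := by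
  rw [fderiv_apply₂ (hA.clm_apply hu) hv hw, fderiv_apply₁ hA hu]
  simp

/-- Equality of mixed second derivatives, for maps with values in linear maps. -/
theorem fderiv_fderiv_apply_comm {f : E → G} (hf : ContDiffAt ℝ ∞ f z) (X Y : E) :
    fderiv ℝ (fderiv ℝ f) z X Y = fderiv ℝ (fderiv ℝ f) z Y X :=
  (hf.isSymmSndFDerivAt (by simpa using ENat.LEInfty.out)) X Y

end ApplyRules

section LocalKahler

variable {E : Type*} [NormedAddCommGroup E] [NormedSpace ℝ E]

/-- The curvature `R(X, Y) Z` of the connection on the tangent bundle of an open subset of a vector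
space with Christoffel map `Γ`. -/
def curvatureMap (Γ : E → E →L[ℝ] E →L[ℝ] E) (z : E) : E →L[ℝ] E →L[ℝ] E →L[ℝ] E :=
  let A : E →L[ℝ] E →L[ℝ] E →L[ℝ] E :=
    fderiv ℝ Γ z + (ContinuousLinearMap.compL ℝ E E E).bilinearComp (Γ z) (Γ z)
  A - A.flip

theorem curvatureMap_apply (Γ : E → E →L[ℝ] E →L[ℝ] E) (z X Y a : E) :
    curvatureMap Γ z X Y a =
      fderiv ℝ Γ z X Y a + Γ z X (Γ z Y a) - (fderiv ℝ Γ z Y X a + Γ z Y (Γ z X a)) := by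
  simp [curvatureMap]

/-- An almost-Kähler `SU(3)` structure `(g, J, β)` with integrable `J` and closed `β` on an open
subset `U` of a vector space, where `β` has the squared norm `t`. The map `Γ` is the Christoffel map
of the Levi-Civita connection of `g`. -/
structure IsKahlerSU3 (U : Set E) (g : E → E →L[ℝ] E →L[ℝ] ℝ) (J : E → E →L[ℝ] E)
    (β : E → E →L[ℝ] E →L[ℝ] E →L[ℝ] ℝ) (t : E → ℝ) (Γ : E → E →L[ℝ] E →L[ℝ] E) : Prop where
  isOpen : IsOpen U
  smooth_g : ContDiffOn ℝ ∞ g U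
  smooth_J : ContDiffOn ℝ ∞ J U
  smooth_β : ContDiffOn ℝ ∞ β U
  smooth_t : ContDiffOn ℝ ∞ t U
  smooth_Γ : ContDiffOn ℝ ∞ Γ U
  isSU3 : ∀ z ∈ U, IsSU3 (g z) (J z) (β z) (t z)
  torsionFree : ∀ z ∈ U, ∀ X Y, Γ z X Y = Γ z Y X
  metric : ∀ z ∈ U, ∀ X a b, fderiv ℝ g z X a b = g z (Γ z X a) b + g z a (Γ z X b)
  closed_σ : ∀ z ∈ U, ∀ a b c, fderiv ℝ (fun y => g y (J y b) c) z a
    + fderiv ℝ (fun y => g y (J y c) a) z b + fderiv ℝ (fun y => g y (J y a) b) z c = 0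
  nijenhuis : ∀ z ∈ U, ∀ a b, fderiv ℝ J z (J z a) b - fderiv ℝ J z (J z b) a
    + J z (fderiv ℝ J z b a) - J z (fderiv ℝ J z a b) = 0
  closed_β : ∀ z ∈ U, ∀ a b c d, fderiv ℝ β z a b c d - fderiv ℝ β z b a c d
    + fderiv ℝ β z c a b d - fderiv ℝ β z d a b c = 0

namespace IsKahlerSU3

variable {U : Set E} {g : E → E →L[ℝ] E →L[ℝ] ℝ} {J : E → E →L[ℝ] E}
  {β : E → E →L[ℝ] E →L[ℝ] E →L[ℝ] ℝ} {t : E → ℝ} {Γ : E → E →L[ℝ] E →L[ℝ] E}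
  (H : IsKahlerSU3 U g J β t Γ) {z : E} (hz : z ∈ U)
include H hz

theorem mem_nhds : U ∈ nhds z := H.isOpen.mem_nhds hz

theorem contDiffAt_g : ContDiffAt ℝ ∞ g z := H.smooth_g.contDiffAt (H.mem_nhds hz)
theorem contDiffAt_J : ContDiffAt ℝ ∞ J z := H.smooth_J.contDiffAt (H.mem_nhds hz)
theorem contDiffAt_β : ContDiffAt ℝ ∞ β z := H.smooth_β.contDiffAt (H.mem_nhds hz)
theorem contDiffAt_t : ContDiffAt ℝ ∞ t z := H.smooth_t.contDiffAt (H.mem_nhds hz)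
theorem contDiffAt_Γ : ContDiffAt ℝ ∞ Γ z := H.smooth_Γ.contDiffAt (H.mem_nhds hz)

theorem diff_g : DifferentiableAt ℝ g z := (H.contDiffAt_g hz).differentiableAt (by simp)
theorem diff_J : DifferentiableAt ℝ J z := (H.contDiffAt_J hz).differentiableAt (by simp)
theorem diff_β : DifferentiableAt ℝ β z := (H.contDiffAt_β hz).differentiableAt (by simp)
theorem diff_t : DifferentiableAt ℝ t z := (H.contDiffAt_t hz).differentiableAt (by simp)
theorem diff_Γ : DifferentiableAt ℝ Γ z := (H.contDiffAt_Γ hz).differentiableAt (by simp)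

/-- An identity between functions on `U` may be differentiated. -/
theorem fderiv_congr {F : Type*} [NormedAddCommGroup F] [NormedSpace ℝ F] {f₁ f₂ : E → F}
    (h : ∀ y ∈ U, f₁ y = f₂ y) : fderiv ℝ f₁ z = fderiv ℝ f₂ z :=
  Filter.EventuallyEq.fderiv_eq (Filter.eventually_of_mem (H.mem_nhds hz) h)

theorem diff_J_apply (a : E) : DifferentiableAt ℝ (fun y => J y a) z :=
  (H.diff_J hz).clm_apply (differentiableAt_const a)

theorem fderiv_J_apply (a X : E) : fderiv ℝ (fun y => J y a) z X = fderiv ℝ J z X a := by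
  rw [fderiv_apply₁ (H.diff_J hz) (differentiableAt_const a)]
  simp

theorem fderiv_σ (a b X : E) : fderiv ℝ (fun y => g y (J y a) b) z X =
    fderiv ℝ g z X (J z a) b + g z (fderiv ℝ J z X a) b := by
  rw [fderiv_apply₂ (H.diff_g hz) (H.diff_J_apply hz a) (differentiableAt_const b),
    H.fderiv_J_apply hz]
  simp

theorem fderiv_J_J (a X : E) : fderiv ℝ J z X (J z a) + J z (fderiv ℝ J z X a) = 0 := by
  have h := congrArg (fun A : E →L[ℝ] E => A X)
    (H.fderiv_congr hz (fun y hy => (H.isSU3 y hy).J_sq a))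
  simp only [fderiv_apply₁ (H.diff_J hz) (H.diff_J_apply hz a), H.fderiv_J_apply hz] at h
  simpa using h

theorem fderiv_skew (a b X : E) :
    fderiv ℝ g z X (J z a) b + g z (fderiv ℝ J z X a) b =
      -(fderiv ℝ g z X a (J z b) + g z a (fderiv ℝ J z X b)) := by
  have h := congrArg (fun A : E →L[ℝ] ℝ => A X)
    (H.fderiv_congr hz (fun y hy => (H.isSU3 y hy).skew a b))
  simp only [H.fderiv_σ hz] at h
  rw [h, fderiv_fun_neg, neg_apply, fderiv_apply₂ (H.diff_g hz) (differentiableAt_const a)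
    (H.diff_J_apply hz b), H.fderiv_J_apply hz]
  simp

/-- `J` is parallel: `(∇_X J) a = 0`, written with the Christoffel map. -/
theorem fderiv_J (X a : E) : fderiv ℝ J z X a = J z (Γ z X a) - Γ z X (J z a) := by
  have hH : IsHermitian (g z) (J z) := (H.isSU3 z hz).toIsHermitian
  set S : E → E → E → ℝ := fun X a b =>
    g z (fderiv ℝ J z X a - J z (Γ z X a) + Γ z X (J z a)) b with hS
  have hm := H.metric z hz
  have key : ∀ X a b, S X a b = 0 := by
    refine eq_zero_of_cyclic_of_nijenhuis (J := J z) ?_ ?_ ?_ ?_ hH.J_sq ?_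
    · intro X a b
      have h := H.fderiv_skew hz a b X
      have h2 := hH.skew (Γ z X a) b
      have h3 := hH.skew (Γ z X b) a
      simp only [hm] at h
      simp only [hS, map_add, map_sub, add_apply, sub_apply]
      linarith [hH.symm (fderiv ℝ J z X b) a, hH.symm (Γ z X (J z b)) a,
        hH.symm (Γ z X b) (J z a)]
    · intro X a b
      have h := H.fderiv_J_J hz a X
      rw [add_eq_zero_iff_eq_neg] at h
      simp only [hS, h, hH.J_sq, map_add, map_sub, map_neg, add_apply, sub_apply, neg_apply,
        hH.skew]
      ring
    · intro a b c
      have h := H.closed_σ z hz a b c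
      simp only [H.fderiv_σ hz, hm] at h
      simp only [hS, map_add, map_sub, add_apply, sub_apply]
      have e : ∀ a b c, g z (J z b) (Γ z a c) = -g z (J z (Γ z c a)) b := fun a b c => by
        rw [hH.skew, hH.symm b, H.torsionFree z hz]
      linarith [e a b c, e b c a, e c a b]
    · intro a b c
      have h := congrArg (fun v => g z v c) (H.nijenhuis z hz a b)
      simp only [map_add, map_sub, add_apply, sub_apply, map_zero, zero_apply] at h
      have e : ∀ x, g z x (J z c) = -g z (J z x) c := fun x => by rw [hH.skew, neg_neg]
      simp only [hS, e, map_add, map_sub, add_apply, sub_apply, hH.J_sq, map_neg, neg_apply]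
      rw [H.torsionFree z hz (J z a) (J z b), H.torsionFree z hz (J z a) b,
        H.torsionFree z hz (J z b) a, H.torsionFree z hz a b]
      linarith
    · intro a b c
      simp only [hS, map_neg]
  have h := hH.eq_of_inner_eq (a := fderiv ℝ J z X a - J z (Γ z X a) + Γ z X (J z a)) (b := 0)
    (fun c => by rw [map_zero, zero_apply]; exact key X a c)
  rw [← sub_eq_zero, ← h]
  abel

/-- The covariant derivative `δ = ∇_X β` is of type `(3, 0) + (0, 3)`, because `J` is parallel. -/
theorem isRePart30_nabla (X : E) {δ : E →L[ℝ] E →L[ℝ] E →L[ℝ] ℝ}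
    (hδ : ∀ a b c, δ a b c = fderiv ℝ β z X a b c - β z (Γ z X a) b c - β z a (Γ z X b) c
      - β z a b (Γ z X c)) : IsRePart30 (J z) δ := by
  have hβ : IsRePart30 (J z) (β z) := (H.isSU3 z hz).toIsRePart30
  have hc : ∀ a : E, DifferentiableAt ℝ (fun _ : E => a) z := fun a => differentiableAt_const a
  have hd : ∀ a b c, fderiv ℝ (fun y => β y a b c) z X = fderiv ℝ β z X a b c := fun a b c => by
    rw [fderiv_apply₃ (H.diff_β hz) (hc a) (hc b) (hc c)]; simp
  constructor
  · intro a b c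
    have h := congrArg (fun A : E →L[ℝ] ℝ => A X)
      (H.fderiv_congr hz (fun y hy => (H.isSU3 y hy).swap₁₂ a b c))
    simp only [fderiv_fun_neg, neg_apply, hd] at h
    rw [hδ, hδ, h, hβ.swap₁₂ _ b, hβ.swap₁₂ a _, hβ.swap₁₂ a b]
    ring
  · intro a b c
    have h := congrArg (fun A : E →L[ℝ] ℝ => A X)
      (H.fderiv_congr hz (fun y hy => (H.isSU3 y hy).swap₂₃ a b c))
    simp only [fderiv_fun_neg, neg_apply, hd] at h
    rw [hδ, hδ, h, hβ.swap₂₃ _ b, hβ.swap₂₃ a _, hβ.swap₂₃ a b]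
    ring
  · intro a b c
    have h := congrArg (fun A : E →L[ℝ] ℝ => A X)
      (H.fderiv_congr hz (fun y hy => (H.isSU3 y hy).type a b c))
    simp only [fderiv_apply₃ (H.diff_β hz) (H.diff_J_apply hz _) (hc _) (hc _),
      fderiv_apply₃ (H.diff_β hz) (hc _) (H.diff_J_apply hz _) (hc _), H.fderiv_J_apply hz,
      H.fderiv_J hz] at h
    simp at h
    rw [hδ, hδ]
    have h1 := hβ.type (Γ z X a) b c
    have h2 := hβ.type a (Γ z X b) c
    have h3 := hβ.type a b (Γ z X c)
    linarith

/-- At a frame in which the Hadamard inequality is an equality, the derivative of `t` is read off from the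
covariant derivative of `β`: by the inequality, the function
`t g(e₀, e₀) g(e₁, e₁) g(e₂, e₂) - |β(e₀, e₁, e₂)|²` has a minimum there. -/
theorem fderiv_t_eq {e : Fin 3 → E} (he : IsUnitaryFrame (g z) (J z) e)
    (hβe : β z (e 0) (e 1) (e 2) ^ 2 + β z (J z (e 0)) (e 1) (e 2) ^ 2 = t z) (X : E) {p q : ℝ}
    (hpq : ∀ a b c, fderiv ℝ β z X a b c - β z (Γ z X a) b c - β z a (Γ z X b) c
      - β z a b (Γ z X c) = p * β z a b c + q * β z (J z a) b c) :
    fderiv ℝ t z X = 2 * p * t z := by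
  have hSU := H.isSU3 z hz
  -- extensions of the frame vectors that are parallel at `z`
  set u : Fin 3 → E → E := fun i y => e i - Γ z (y - z) (e i) with hu
  have hu_z : ∀ i, u i z = e i := fun i => by simp [hu]
  have hu_diff : ∀ i, DifferentiableAt ℝ (u i) z := fun i => by
    simp only [hu]; fun_prop
  have hu_fderiv : ∀ i, fderiv ℝ (u i) z X = -Γ z X (e i) := fun i => by
    have h : HasFDerivAt (u i) (-((Γ z).flip (e i))) z := by
      have h1 : HasFDerivAt (fun y => (Γ z).flip (e i) (y - z)) ((Γ z).flip (e i)) z :=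
        ((Γ z).flip (e i)).hasFDerivAt.comp z ((hasFDerivAt_id z).sub_const z)
      exact h1.const_sub (e i)
    rw [h.fderiv]
    simp
  set n : Fin 3 → E → ℝ := fun i y => g y (u i y) (u i y) with hn
  have hn_z : ∀ i, n i z = 1 := fun i => by simp [hn, hu_z, he.inner_eq]
  have hn_diff : ∀ i, DifferentiableAt ℝ (n i) z := fun i =>
    ((H.diff_g hz).clm_apply (hu_diff i)).clm_apply (hu_diff i)
  have hn_fderiv : ∀ i, fderiv ℝ (n i) z X = 0 := fun i => by
    simp only [hn]
    rw [fderiv_apply₂ (H.diff_g hz) (hu_diff i) (hu_diff i), hu_fderiv, hu_z, H.metric z hz]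
    simp
  set b : E → ℝ := fun y => β y (u 0 y) (u 1 y) (u 2 y) with hb
  set b' : E → ℝ := fun y => β y (J y (u 0 y)) (u 1 y) (u 2 y) with hb'
  have hJu_diff : DifferentiableAt ℝ (fun y => J y (u 0 y)) z :=
    (H.diff_J hz).clm_apply (hu_diff 0)
  have hb_diff : DifferentiableAt ℝ b z :=
    (((H.diff_β hz).clm_apply (hu_diff 0)).clm_apply (hu_diff 1)).clm_apply (hu_diff 2)
  have hb'_diff : DifferentiableAt ℝ b' z :=
    (((H.diff_β hz).clm_apply hJu_diff).clm_apply (hu_diff 1)).clm_apply (hu_diff 2)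
  have hb_fderiv : fderiv ℝ b z X = p * b z + q * b' z := by
    simp only [hb, hb']
    rw [fderiv_apply₃ (H.diff_β hz) (hu_diff 0) (hu_diff 1) (hu_diff 2)]
    simp only [hu_fderiv, hu_z, map_neg, neg_apply]
    linarith [hpq (e 0) (e 1) (e 2)]
  have hb'_fderiv : fderiv ℝ b' z X = p * b' z - q * b z := by
    simp only [hb, hb']
    rw [fderiv_apply₃ (H.diff_β hz) hJu_diff (hu_diff 1) (hu_diff 2),
      fderiv_apply₁ (H.diff_J hz) (hu_diff 0)]
    have h := hpq (J z (e 0)) (e 1) (e 2)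
    simp only [hu_fderiv, hu_z, map_neg, neg_apply, H.fderiv_J hz, map_add, map_sub, add_apply,
      sub_apply, hSU.J_sq] at h ⊢
    linarith
  set F : E → ℝ := fun y => t y * (n 0 y * n 1 y * n 2 y) - (b y ^ 2 + b' y ^ 2) with hF
  have hmin : IsLocalMin F z := by
    filter_upwards [H.mem_nhds hz] with y hy
    have h0 : F z = 0 := by
      simp only [hF, hn_z, hb, hb', hu_z]
      linarith
    rw [h0]
    simp only [hF, sub_nonneg]
    exact (H.isSU3 y hy).hadamard _ _ _
  have hF_fderiv : HasFDerivAt F _ z :=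
    ((H.diff_t hz).hasFDerivAt.mul (((hn_diff 0).hasFDerivAt.mul (hn_diff 1).hasFDerivAt).mul
      (hn_diff 2).hasFDerivAt)).sub ((hb_diff.hasFDerivAt.pow 2).add (hb'_diff.hasFDerivAt.pow 2))
  have h := congrArg (fun A : E →L[ℝ] ℝ => A X) (hmin.fderiv_eq_zero)
  simp only [hF_fderiv.fderiv] at h
  simp [hn_fderiv, hn_z, hb_fderiv, hb'_fderiv] at h
  have hbz : b z ^ 2 + b' z ^ 2 = t z := by simpa [hb, hb', hu_z] using hβe
  rw [← hbz]
  linarith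

/-- `∇ β = p ⊗ β + q ⊗ β(J ·, ·, ·)` with `p = ½ d log t` and `q = ½ dᶜ log t`: as `β` is closed, the
complex form `p + i q` is of type `(1, 0)`. -/
theorem nabla_β (hE : Module.finrank ℝ E = 6) (X a b c : E) :
    fderiv ℝ β z X a b c = β z (Γ z X a) b c + β z a (Γ z X b) c + β z a b (Γ z X c)
      + 1 / 2 * fderiv ℝ (fun y => Real.log (t y)) z X * β z a b c
      - 1 / 2 * fderiv ℝ (fun y => Real.log (t y)) z (J z X) * β z (J z a) b c := by
  have hSU := H.isSU3 z hz
  have hH := hSU.toIsHermitian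
  have hβ := hSU.toIsRePart30
  have ht := hSU.norm_pos
  rcases eq_or_ne X 0 with rfl | hX
  · simp
  obtain ⟨r, x, hx, rfl⟩ : ∃ (r : ℝ) (x : E), g z x x = 1 ∧ X = r • x := by
    have hpos := hSU.pos X hX
    refine ⟨√(g z X X), (√(g z X X))⁻¹ • X, ?_, ?_⟩
    · simp only [map_smul, smul_apply, smul_eq_mul]
      field_simp
      exact (Real.sq_sqrt hpos.le).symm
    · rw [smul_smul, mul_inv_cancel₀ (Real.sqrt_pos.mpr hpos).ne', one_smul]
  obtain ⟨e, rfl, he, hβe⟩ := hSU.exists_frame x hx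
  have hlog : ∀ Y, fderiv ℝ (fun y => Real.log (t y)) z Y = fderiv ℝ t z Y / t z := fun Y => by
    rw [fderiv.log (H.diff_t hz) ht.ne']
    simp [div_eq_inv_mul]
  have hcomb : ∀ Y, ∃ q : ℝ, ∀ a b c, fderiv ℝ β z Y a b c - β z (Γ z Y a) b c
      - β z a (Γ z Y b) c - β z a b (Γ z Y c) =
        1 / 2 * fderiv ℝ (fun y => Real.log (t y)) z Y * β z a b c + q * β z (J z a) b c := by
    intro Y
    set C : E →L[ℝ] E := Γ z Y
    set δ : E →L[ℝ] E →L[ℝ] E →L[ℝ] ℝ := fderiv ℝ β z Y - (β z).comp C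
      - ((ContinuousLinearMap.compL ℝ E E (E →L[ℝ] ℝ)).flip C).comp (β z)
      - (ContinuousLinearMap.compL ℝ E (E →L[ℝ] ℝ) (E →L[ℝ] ℝ)
          ((ContinuousLinearMap.compL ℝ E E ℝ).flip C)).comp (β z) with hδ_def
    have hδ : ∀ a b c, δ a b c = fderiv ℝ β z Y a b c - β z (C a) b c - β z a (C b) c
      - β z a b (C c) := fun a b c => by simp [hδ_def]
    obtain ⟨p, q, hpq⟩ := hβ.exists_combination hE hH he (H.isRePart30_nabla hz Y hδ)
      (by rw [hβe]; exact ht)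
    have hp := H.fderiv_t_eq hz he hβe Y (p := p) (q := q) (fun a b c => by rw [← hδ, hpq])
    refine ⟨q, fun a b c => ?_⟩
    rw [← hδ, hpq, hlog, hp]
    field_simp
  choose q hq using hcomb
  set θ : E → ℝ := fun Y => fderiv ℝ (fun y => Real.log (t y)) z Y with hθ
  have hval : ∀ Y a b c, fderiv ℝ β z Y a b c = β z (Γ z Y a) b c + β z a (Γ z Y b) c
      + β z a b (Γ z Y c) + 1 / 2 * θ Y * β z a b c + q Y * β z (J z a) b c :=
    fun Y a b c => by linarith [hq Y a b c]
  have hq_eq : q (e 0) = -(1 / 2 * θ (J z (e 0))) := by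
    -- the connection terms cancel in `dβ`, so that `p ∧ β + q ∧ β(J ·, ·, ·) = 0`
    have hcl : ∀ x y v w, (1 / 2 * θ x * β z y v w + q x * β z (J z y) v w)
        - (1 / 2 * θ y * β z x v w + q y * β z (J z x) v w)
        + (1 / 2 * θ v * β z x y w + q v * β z (J z x) y w)
        - (1 / 2 * θ w * β z x y v + q w * β z (J z x) y v) = 0 := by
      intro x y v w
      have h := H.closed_β z hz x y v w
      simp only [hval] at h
      rw [H.torsionFree z hz y x, H.torsionFree z hz v x, H.torsionFree z hz w x,
        H.torsionFree z hz v y, H.torsionFree z hz w y, H.torsionFree z hz w v] at h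
      have s1 := hβ.swap₁₂ y (Γ z x v) w
      have s2 := hβ.swap₁₃ y v (Γ z x w)
      have s3 := hβ.swap₂₃ (Γ z x w) v y
      have s4 := hβ.swap₂₃ x v (Γ z y w)
      linarith
    have h1 := hcl (e 0) (J z (e 0)) (e 1) (e 2)
    have h2 := hcl (e 0) (J z (e 0)) (J z (e 1)) (e 2)
    simp only [hβ.type₂, hβ.type₃, hSU.J_sq, map_neg, neg_apply, hβ.self₁₂,
      hβ.J_self₁₂] at h1 h2
    set b := β z (e 0) (e 1) (e 2)
    set b' := β z (J z (e 0)) (e 1) (e 2)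
    have h3 : (q (e 0) + 1 / 2 * θ (J z (e 0))) * t z = 0 := by
      rw [← hβe]
      linear_combination (-b) * h1 - b' * h2
    have h4 := (mul_eq_zero.mp h3).resolve_right ht.ne'
    linarith
  simp only [map_smul, smul_apply, smul_eq_mul]
  rw [hval, hq_eq]
  simp only [hθ]
  ring

end IsKahlerSU3

end LocalKahler

/-! ### The curvature of a Kähler `SU(3)` structure -/

section KahlerCurvature

variable {E : Type*} [NormedAddCommGroup E] [NormedSpace ℝ E]

namespace IsKahlerSU3

variable {U : Set E} {g : E → E →L[ℝ] E →L[ℝ] ℝ} {J : E → E →L[ℝ] E}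
  {β : E → E →L[ℝ] E →L[ℝ] E →L[ℝ] ℝ} {t : E → ℝ} {Γ : E → E →L[ℝ] E →L[ℝ] E}
  (H : IsKahlerSU3 U g J β t Γ) {z : E} (hz : z ∈ U)
include H hz

theorem curvatureMap_bianchi (a b c : E) :
    curvatureMap Γ z a b c + curvatureMap Γ z b c a + curvatureMap Γ z c a b = 0 := by
  have hsymm : ∀ X Y c, fderiv ℝ Γ z X Y c = fderiv ℝ Γ z X c Y := by
    intro X Y c
    have h := congrArg (fun A : E →L[ℝ] E => A X)
      (H.fderiv_congr hz (fun y hy => H.torsionFree y hy Y c))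
    simp only [fderiv_apply₂ (H.diff_Γ hz) (differentiableAt_const _) (differentiableAt_const _)] at h
    simpa using h
  simp only [curvatureMap_apply]
  rw [hsymm a b c, hsymm b a c, hsymm c a b, H.torsionFree z hz a c, H.torsionFree z hz b c,
    H.torsionFree z hz a b]
  abel

/-- The curvature is skew with respect to any parallel bilinear form. -/
theorem curvatureMap_skew_of_parallel {B : E → E →L[ℝ] E →L[ℝ] ℝ} (hB : ContDiffAt ℝ ∞ B z)
    (hBp : ∀ y ∈ U, ∀ X a b, fderiv ℝ B y X a b = B y (Γ y X a) b + B y a (Γ y X b))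
    (X Y a b : E) :
    B z (curvatureMap Γ z X Y a) b = -B z a (curvatureMap Γ z X Y b) := by
  have hBd : DifferentiableAt ℝ B z := hB.differentiableAt (by simp)
  have hB' : DifferentiableAt ℝ (fderiv ℝ B) z :=
    (hB.fderiv_right (m := ∞) (by simp)).differentiableAt (by simp)
  have hc : ∀ a : E, DifferentiableAt ℝ (fun _ : E => a) z := fun a => differentiableAt_const a
  have hΓd : ∀ X a : E, DifferentiableAt ℝ (fun y => Γ y X a) z := fun X a =>
    ((H.diff_Γ hz).clm_apply (hc X)).clm_apply (hc a)
  have hΓf : ∀ X Y a : E, fderiv ℝ (fun y => Γ y X a) z Y = fderiv ℝ Γ z Y X a := fun X Y a => by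
    rw [fderiv_apply₂ (H.diff_Γ hz) (hc X) (hc a)]; simp
  have h2 : ∀ X Y, fderiv ℝ (fderiv ℝ B) z Y X a b =
      B z (Γ z Y (Γ z X a)) b + B z (Γ z X a) (Γ z Y b) + B z (fderiv ℝ Γ z Y X a) b
        + (B z (Γ z Y a) (Γ z X b) + B z a (Γ z Y (Γ z X b)) + B z a (fderiv ℝ Γ z Y X b)) := by
    intro X Y
    have h := congrArg (fun A : E →L[ℝ] ℝ => A Y)
      (H.fderiv_congr hz (fun y hy => hBp y hy X a b))
    simp only [fderiv_apply₃ hB' (hc X) (hc a) (hc b)] at h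
    rw [fderiv_fun_add ((hBd.clm_apply (hΓd X a)).clm_apply (hc b))
      ((hBd.clm_apply (hc a)).clm_apply (hΓd X b)), add_apply,
      fderiv_apply₂ hBd (hΓd X a) (hc b), fderiv_apply₂ hBd (hc a) (hΓd X b), hΓf, hΓf] at h
    simpa [hBp z hz] using h
  have h3 := congrArg (fun A : E →L[ℝ] E →L[ℝ] ℝ => A a b) (fderiv_fderiv_apply_comm hB X Y)
  simp only [h2] at h3
  simp only [curvatureMap_apply, map_add, map_sub, add_apply, sub_apply]
  linarith

theorem curvatureMap_skew (X Y a b : E) :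
    g z (curvatureMap Γ z X Y a) b = -g z a (curvatureMap Γ z X Y b) :=
  H.curvatureMap_skew_of_parallel hz (H.contDiffAt_g hz) H.metric X Y a b

/-- The curvature operators commute with `J`, as both `g` and `g(J ·, ·)` are parallel. -/
theorem curvatureMap_J (X Y a : E) :
    curvatureMap Γ z X Y (J z a) = J z (curvatureMap Γ z X Y a) := by
  have hH := (H.isSU3 z hz).toIsHermitian
  -- the fundamental form `g(J ·, ·)`
  set σ : E → E →L[ℝ] E →L[ℝ] ℝ := fun y => (g y).comp (J y) with hσ
  have hσ_apply : ∀ y a, σ y a = g y (J y a) := fun y a => rfl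
  have hσs : ContDiffOn ℝ ∞ σ U := H.smooth_g.clm_comp H.smooth_J
  have hσp : ∀ y ∈ U, ∀ X a b, fderiv ℝ σ y X a b = σ y (Γ y X a) b + σ y a (Γ y X b) := by
    intro y hy X a b
    have h1 : fderiv ℝ (fun w => σ w a b) y X = fderiv ℝ σ y X a b := by
      rw [fderiv_apply₂ ((hσs.contDiffAt (H.mem_nhds hy)).differentiableAt (by simp))
        (differentiableAt_const _) (differentiableAt_const _)]
      simp
    rw [← h1]
    simp only [hσ_apply]
    rw [H.fderiv_σ hy, H.metric y hy, H.fderiv_J hy]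
    simp only [map_sub, sub_apply]
    ring
  refine hH.eq_of_inner_eq fun c => ?_
  have h := H.curvatureMap_skew_of_parallel hz (hσs.contDiffAt (H.mem_nhds hz)) hσp X Y a c
  simp only [hσ_apply] at h
  rw [h, H.curvatureMap_skew hz]

set_option maxHeartbeats 1000000 in
/-- The sum over the arguments of `β` of the actions of the curvature operator is
`-½ (d dᶜ log t) β(J ·, ·, ·)`. -/
theorem curvatureMap_β (hE : Module.finrank ℝ E = 6) (X Y a b c : E) :
    β z (curvatureMap Γ z X Y a) b c + β z a (curvatureMap Γ z X Y b) c
      + β z a b (curvatureMap Γ z X Y c) =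
      1 / 2 * (fderiv ℝ (fun y => fderiv ℝ (fun w => Real.log (t w)) y (J y Y)) z X
        - fderiv ℝ (fun y => fderiv ℝ (fun w => Real.log (t w)) y (J y X)) z Y)
        * β z (J z a) b c := by
  have hSU := H.isSU3 z hz
  set L : E → E →L[ℝ] ℝ := fderiv ℝ fun w => Real.log (t w) with hL
  have hlog : ContDiffAt ℝ ∞ (fun w => Real.log (t w)) z :=
    (H.contDiffAt_t hz).log hSU.norm_pos.ne'
  have hLd : DifferentiableAt ℝ L z :=
    (hlog.fderiv_right (m := ∞) (by simp)).differentiableAt (by simp)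
  have hL_comm : ∀ X Y, fderiv ℝ L z X Y = fderiv ℝ L z Y X := fderiv_fderiv_apply_comm hlog
  have hβd := H.diff_β hz
  have hβ' : DifferentiableAt ℝ (fderiv ℝ β) z :=
    ((H.contDiffAt_β hz).fderiv_right (m := ∞) (by simp)).differentiableAt (by simp)
  have hc : ∀ a : E, DifferentiableAt ℝ (fun _ : E => a) z := fun a => differentiableAt_const a
  have hJd := H.diff_J_apply hz
  have hΓd : ∀ X a : E, DifferentiableAt ℝ (fun y => Γ y X a) z := fun X a =>
    ((H.diff_Γ hz).clm_apply (hc X)).clm_apply (hc a)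
  have hΓf : ∀ X Y a : E, fderiv ℝ (fun y => Γ y X a) z Y = fderiv ℝ Γ z Y X a := fun X Y a => by
    rw [fderiv_apply₂ (H.diff_Γ hz) (hc X) (hc a)]; simp
  have hLX : ∀ X Y, fderiv ℝ (fun y => L y X) z Y = fderiv ℝ L z Y X := fun X Y => by
    rw [fderiv_apply₁ hLd (hc X)]; simp
  have hLJ : ∀ X, DifferentiableAt ℝ (fun y => L y (J y X)) z := fun X => hLd.clm_apply (hJd X)
  have hβJ : DifferentiableAt ℝ (fun y => β y (J y a) b c) z :=
    ((hβd.clm_apply (hJd a)).clm_apply (hc b)).clm_apply (hc c)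
  have hβ₀ : DifferentiableAt ℝ (fun y => β y a b c) z :=
    ((hβd.clm_apply (hc a)).clm_apply (hc b)).clm_apply (hc c)
  have hv := H.nabla_β hz hE
  have h2 : ∀ X Y, fderiv ℝ (fderiv ℝ β) z Y X a b c =
      (fderiv ℝ β z Y (Γ z X a) b c + β z (fderiv ℝ Γ z Y X a) b c)
      + (fderiv ℝ β z Y a (Γ z X b) c + β z a (fderiv ℝ Γ z Y X b) c)
      + (fderiv ℝ β z Y a b (Γ z X c) + β z a b (fderiv ℝ Γ z Y X c))
      + (1 / 2 * L z X * fderiv ℝ β z Y a b c + 1 / 2 * fderiv ℝ L z Y X * β z a b c)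
      - (1 / 2 * L z (J z X) * (fderiv ℝ β z Y (J z a) b c + β z (fderiv ℝ J z Y a) b c)
        + 1 / 2 * fderiv ℝ (fun y => L y (J y X)) z Y * β z (J z a) b c) := by
    intro X Y
    set F : E → ℝ := fun y => β y (Γ y X a) b c + β y a (Γ y X b) c + β y a b (Γ y X c)
      + 1 / 2 * L y X * β y a b c - 1 / 2 * L y (J y X) * β y (J y a) b c with hF
    have h := congrArg (fun A : E →L[ℝ] ℝ => A Y)
      (H.fderiv_congr hz (f₁ := fun y => fderiv ℝ β y X a b c) (f₂ := F)
        (fun y hy => H.nabla_β hy hE X a b c))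
    have e0 : fderiv ℝ (fun y => fderiv ℝ β y X a b c) z Y =
        fderiv ℝ (fderiv ℝ β) z Y X a b c := by
      rw [fderiv_apply₃ (A := fun y => fderiv ℝ β y X) (hβ'.clm_apply (hc X)) (hc a) (hc b) (hc c),
        fderiv_apply₁ hβ' (hc X)]
      simp
    have d1 : DifferentiableAt ℝ (fun y => β y (Γ y X a) b c) z :=
      ((hβd.clm_apply (hΓd X a)).clm_apply (hc b)).clm_apply (hc c)
    have d2 : DifferentiableAt ℝ (fun y => β y a (Γ y X b) c) z :=
      ((hβd.clm_apply (hc a)).clm_apply (hΓd X b)).clm_apply (hc c)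
    have d3 : DifferentiableAt ℝ (fun y => β y a b (Γ y X c)) z :=
      ((hβd.clm_apply (hc a)).clm_apply (hc b)).clm_apply (hΓd X c)
    have hFd : HasFDerivAt F _ z :=
      (((d1.hasFDerivAt.add d2.hasFDerivAt).add d3.hasFDerivAt).add
        (((hLd.clm_apply (hc X)).hasFDerivAt.const_mul (1 / 2)).mul hβ₀.hasFDerivAt)).sub
        (((hLJ X).hasFDerivAt.const_mul (1 / 2)).mul hβJ.hasFDerivAt)
    rw [e0, hFd.fderiv] at h
    simp only [add_apply, sub_apply, smul_apply, smul_eq_mul,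
      fderiv_apply₃ hβd (hΓd X a) (hc b) (hc c), fderiv_apply₃ hβd (hc a) (hΓd X b) (hc c),
      fderiv_apply₃ hβd (hc a) (hc b) (hΓd X c), fderiv_apply₃ hβd (hc a) (hc b) (hc c),
      fderiv_apply₃ hβd (hJd a) (hc b) (hc c), hΓf, hLX, H.fderiv_J_apply hz,
      fderiv_fun_const, Pi.zero_apply, zero_apply, map_zero, add_zero] at h
    rw [h]
    ring
  have h3 := congrArg (fun A : E →L[ℝ] E →L[ℝ] E →L[ℝ] ℝ => A a b c)
    (fderiv_fderiv_apply_comm (H.contDiffAt_β hz) X Y)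
  simp only [h2, hL_comm Y X] at h3
  simp only [hv, H.fderiv_J hz, hSU.J_sq, map_neg, neg_apply, map_sub, sub_apply, ← hL] at h3
  simp only [curvatureMap_apply, map_add, map_sub, add_apply, sub_apply]
  linear_combination h3

/-- The Ricci form of the metric `g` is `½ d dᶜ log t`. -/
theorem trace_curvatureMap (hE : Module.finrank ℝ E = 6) (a b : E) :
    LinearMap.trace ℝ E (((curvatureMap Γ z).flip b).flip (J z a)) =
      1 / 2 * (fderiv ℝ (fun y => -fderiv ℝ (fun w => Real.log (t w)) y (J y b)) z a
        - fderiv ℝ (fun y => -fderiv ℝ (fun w => Real.log (t w)) y (J y a)) z b) := by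
  have hSU := H.isSU3 z hz
  have hH := hSU.toIsHermitian
  have : Nontrivial E := Module.nontrivial_of_finrank_pos (R := ℝ) (by rw [hE]; norm_num)
  obtain ⟨x, hx⟩ := exists_ne (0 : E)
  have hpos := hSU.pos x hx
  obtain ⟨e, -, he, hβe⟩ := hSU.exists_frame ((√(g z x x))⁻¹ • x) (by
    simp only [map_smul, smul_apply, smul_eq_mul]
    field_simp
    exact (Real.sq_sqrt hpos.le).symm)
  have h_antisymm : ∀ a b, curvatureMap Γ z a b = -curvatureMap Γ z b a := fun a b => by
    ext c
    simp only [curvatureMap_apply, neg_apply]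
    abel
  have h_tr := trace_J_comp_curvature hE hH he h_antisymm (H.curvatureMap_bianchi hz)
    (H.curvatureMap_skew hz) (H.curvatureMap_J hz) a b
  have h_tr0 : LinearMap.trace ℝ E (curvatureMap Γ z a b) = 0 := by
    have h0 : ∀ c, g z (curvatureMap Γ z a b c) c = 0 := fun c => by
      have h := H.curvatureMap_skew hz a b c c
      rw [hH.symm c] at h
      linarith
    rw [he.trace_eq hE hH]
    simp [h0]
  have hβ := hSU.toIsRePart30
  have h1 := hβ.derivation_apply hE hH he (H.curvatureMap_J hz a b)
  have h2 := hβ.comp_J.derivation_apply hE hH he (H.curvatureMap_J hz a b)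
  simp only [ContinuousLinearMap.comp_apply, ← H.curvatureMap_J hz] at h2
  rw [H.curvatureMap_β hz hE, h_tr0, h_tr] at h1 h2
  simp only [hSU.J_sq, map_neg, neg_apply] at h2
  simp only [fderiv_fun_neg, neg_apply]
  set R := LinearMap.trace ℝ E (((curvatureMap Γ z).flip b).flip (J z a))
  set D := fderiv ℝ (fun y => fderiv ℝ (fun w => Real.log (t w)) y (J y b)) z a
    - fderiv ℝ (fun y => fderiv ℝ (fun w => Real.log (t w)) y (J y a)) z b
  have h3 : (R + 1 / 2 * D) * t z = 0 := by
    rw [← hβe]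
    linear_combination (β z (J z (e 0)) (e 1) (e 2)) * h1 - β z (e 0) (e 1) (e 2) * h2
  have h4 := (mul_eq_zero.mp h3).resolve_right hSU.norm_pos.ne'
  linarith

end IsKahlerSU3

end KahlerCurvature

/-! ### The cross product of `ℝ⁷` -/

section CrossProduct

/-- The cross product of `ℝ⁷`, characterized by `⟪u × v, w⟫ = phi0(u, v, w)` (`inner_cross`). -/
def cross (u v : EuclideanSpace ℝ (Fin 7)) : EuclideanSpace ℝ (Fin 7) :=
  !₂[u 1 * v 2 - u 2 * v 1 + u 3 * v 4 - u 4 * v 3 + u 5 * v 6 - u 6 * v 5,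
    u 2 * v 0 - u 0 * v 2 + u 3 * v 5 - u 5 * v 3 - u 4 * v 6 + u 6 * v 4,
    u 0 * v 1 - u 1 * v 0 - u 3 * v 6 + u 6 * v 3 - u 4 * v 5 + u 5 * v 4,
    u 4 * v 0 - u 0 * v 4 + u 5 * v 1 - u 1 * v 5 - u 6 * v 2 + u 2 * v 6,
    u 0 * v 3 - u 3 * v 0 - u 6 * v 1 + u 1 * v 6 - u 5 * v 2 + u 2 * v 5,
    u 6 * v 0 - u 0 * v 6 + u 1 * v 3 - u 3 * v 1 - u 2 * v 4 + u 4 * v 2,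
    u 0 * v 5 - u 5 * v 0 - u 1 * v 4 + u 4 * v 1 - u 2 * v 3 + u 3 * v 2]

theorem coordForm_apply {n k : ℕ} (I : Fin k → Fin n) (v : Fin k → EuclideanSpace ℝ (Fin n)) :
    coordForm I v = Matrix.det (Matrix.of fun a b => v a (I b)) := rfl

theorem coordForm_three (i j k : Fin 7) (u v w : EuclideanSpace ℝ (Fin 7)) :
    coordForm (k := 3) ![i, j, k] ![u, v, w] =
      u i * v j * w k - u i * v k * w j - u j * v i * w k + u j * v k * w i + u k * v i * w j
        - u k * v j * w i := by
  rw [coordForm_apply, Matrix.det_fin_three]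
  simp

theorem coordForm_four (i j k l : Fin 7) (u v w x : EuclideanSpace ℝ (Fin 7)) :
    coordForm (k := 4) ![i, j, k, l] ![u, v, w, x] =
      u i * v j * w k * x l - u i * v j * w l * x k - u i * v k * w j * x l + u i * v
        k * w l * x j + u i * v l * w j * x k - u i * v l * w k * x j - u j * v i * w k
        * x l + u j * v i * w l * x k + u j * v k * w i * x l - u j * v k * w l * x i -
        u j * v l * w i * x k + u j * v l * w k * x i + u k * v i * w j * x l - u k * v
        i * w l * x j - u k * v j * w i * x l + u k * v j * w l * x i + u k * v l * w i
        * x j - u k * v l * w j * x i - u l * v i * w j * x k + u l * v i * w k * x j +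
        u l * v j * w i * x k - u l * v j * w k * x i - u l * v k * w i * x j + u l * v
        k * w j * x i := by
  rw [coordForm_apply, Matrix.det_succ_row_zero]
  simp [Fin.sum_univ_succ, Matrix.det_fin_three, Fin.succAbove]
  ring

theorem inner_cross (u v w : EuclideanSpace ℝ (Fin 7)) :
    inner ℝ (cross u v) w = phi0 ![u, v, w] := by
  change _ = coordForm (k := 3) ![0, 1, 2] ![u, v, w] + coordForm (k := 3) ![0, 3, 4] ![u, v, w]
    + coordForm (k := 3) ![0, 5, 6] ![u, v, w] + coordForm (k := 3) ![1, 3, 5] ![u, v, w]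
    - coordForm (k := 3) ![1, 4, 6] ![u, v, w] - coordForm (k := 3) ![2, 3, 6] ![u, v, w]
    - coordForm (k := 3) ![2, 4, 5] ![u, v, w]
  simp only [coordForm_three]
  simp [cross, PiLp.inner_apply, Fin.sum_univ_succ]
  ring

set_option maxHeartbeats 2000000 in
theorem inner_cross_cross (u v w x : EuclideanSpace ℝ (Fin 7)) :
    inner ℝ (cross u v) (cross w x) =
      inner ℝ u w * inner ℝ v x - inner ℝ u x * inner ℝ v w + starPhi0 ![u, v, w, x] := by
  change _ = _ + (coordForm (k := 4) ![3, 4, 5, 6] ![u, v, w, x]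
    + coordForm (k := 4) ![1, 2, 5, 6] ![u, v, w, x]
    + coordForm (k := 4) ![1, 2, 3, 4] ![u, v, w, x]
    + coordForm (k := 4) ![0, 2, 4, 6] ![u, v, w, x]
    - coordForm (k := 4) ![0, 2, 3, 5] ![u, v, w, x]
    - coordForm (k := 4) ![0, 1, 4, 5] ![u, v, w, x]
    - coordForm (k := 4) ![0, 1, 3, 6] ![u, v, w, x])
  simp only [coordForm_four]
  simp [cross, PiLp.inner_apply, Fin.sum_univ_succ]
  ring

end CrossProduct

/-! ### The metric and the Hodge dual as smooth functions of a `G₂` form -/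

section SmoothMatrices

variable {X : Type*} [NormedAddCommGroup X] [NormedSpace ℝ X] {ι : Type*} [Fintype ι]
  [DecidableEq ι] {x : X} {M : X → Matrix ι ι ℝ}

theorem contDiffAt_det (hM : ∀ i j, ContDiffAt ℝ ∞ (fun y => M y i j) x) :
    ContDiffAt ℝ ∞ (fun y => (M y).det) x := by
  simp only [Matrix.det_apply']
  exact ContDiffAt.sum fun σ _ => contDiffAt_const.mul (contDiffAt_prod fun i _ => hM _ _)

theorem contDiffAt_matrix_inv (hM : ∀ i j, ContDiffAt ℝ ∞ (fun y => M y i j) x)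
    (hx : (M x).det ≠ 0) (i j : ι) : ContDiffAt ℝ ∞ (fun y => (M y)⁻¹ i j) x := by
  simp only [Matrix.inv_def, Matrix.smul_apply, smul_eq_mul, Ring.inverse_eq_inv',
    Matrix.adjugate_apply]
  refine ((contDiffAt_det hM).inv hx).mul (contDiffAt_det fun a b => ?_)
  by_cases h : a = j
  · subst h
    simpa using contDiffAt_const
  · simpa [Matrix.updateRow_ne h] using hM a b

end SmoothMatrices

section Trilinear

variable {E : Type*} [NormedAddCommGroup E] [NormedSpace ℝ E]

theorem form_swap₁₂ (α : E [⋀^Fin 3]→L[ℝ] ℝ) (u v w : E) : α ![u, v, w] = -α ![v, u, w] := by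
  have h := α.map_swap ![v, u, w] (i := 0) (j := 1) (by decide)
  have e : ![v, u, w] ∘ Equiv.swap (0 : Fin 3) 1 = ![u, v, w] := by
    ext i; fin_cases i <;> rfl
  rwa [e] at h

theorem form_swap₂₃ (α : E [⋀^Fin 3]→L[ℝ] ℝ) (u v w : E) : α ![u, v, w] = -α ![u, w, v] := by
  have h := α.map_swap ![u, w, v] (i := 1) (j := 2) (by decide)
  have e : ![u, w, v] ∘ Equiv.swap (1 : Fin 3) 2 = ![u, v, w] := by
    ext i; fin_cases i <;> rfl
  rwa [e] at h

theorem form_self₁₂ (α : E [⋀^Fin 3]→L[ℝ] ℝ) (u v : E) : α ![u, u, v] = 0 := by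
  linarith [form_swap₁₂ α u u v]

theorem form_comp₃ {F : Type*} [NormedAddCommGroup F] [NormedSpace ℝ F] (α : F [⋀^Fin 3]→L[ℝ] ℝ)
    (f : E →L[ℝ] F) (u v w : E) :
    α.compContinuousLinearMap f ![u, v, w] = α ![f u, f v, f w] :=
  congrArg α (by funext i; fin_cases i <;> rfl)

/-- The trilinear map attached to a 3-form. -/
def trilinear (E : Type*) [NormedAddCommGroup E] [NormedSpace ℝ E] :
    (E [⋀^Fin 3]→L[ℝ] ℝ) →L[ℝ] (E →L[ℝ] E →L[ℝ] E →L[ℝ] ℝ) :=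
  (ContinuousLinearMap.compL ℝ E (E [⋀^Fin 2]→L[ℝ] ℝ) (E →L[ℝ] E →L[ℝ] ℝ)
    ((ContinuousLinearMap.compL ℝ E (E [⋀^Fin 1]→L[ℝ] ℝ) (E →L[ℝ] ℝ)
      (ContinuousAlternatingMap.ofSubsingletonLIE (𝕜 := ℝ) (E := E) (F := ℝ)
        (0 : Fin 1)).symm.toContinuousLinearEquiv.toContinuousLinearMap).comp
      (ContinuousAlternatingMap.curryLeftLI (𝕜 := ℝ) (E := E) (F := ℝ)
        (n := 1)).toContinuousLinearMap)).comp
    (ContinuousAlternatingMap.curryLeftLI (𝕜 := ℝ) (E := E) (F := ℝ)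
      (n := 2)).toContinuousLinearMap

theorem trilinear_apply (α : E [⋀^Fin 3]→L[ℝ] ℝ) (u v w : E) :
    trilinear E α u v w = α ![u, v, w] := by
  simp only [trilinear, ContinuousLinearMap.comp_apply]
  exact congrArg α (by funext i; fin_cases i <;> rfl)

end Trilinear

section FormCoordinates

variable {n k : ℕ}

/-- A continuous linear map that recovers a form from its values on the tuples of vectors of the
standard basis. -/
theorem exists_form_reconstruction (n k : ℕ) :
    ∃ L : ((Fin k → Fin n) → ℝ) →L[ℝ] (EuclideanSpace ℝ (Fin n) [⋀^Fin k]→L[ℝ] ℝ),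
      ∀ α : EuclideanSpace ℝ (Fin n) [⋀^Fin k]→L[ℝ] ℝ,
        L (fun I => α fun i => EuclideanSpace.single (I i) 1) = α := by
  let ev : (EuclideanSpace ℝ (Fin n) [⋀^Fin k]→L[ℝ] ℝ) →ₗ[ℝ] ((Fin k → Fin n) → ℝ) :=
    { toFun := fun α I => α fun i => EuclideanSpace.single (I i) 1
      map_add' := fun _ _ => rfl
      map_smul' := fun _ _ => rfl }
  have hev : LinearMap.ker ev = ⊥ := by
    refine LinearMap.ker_eq_bot.mpr fun α β h => ?_
    apply ContinuousAlternatingMap.toAlternatingMap_injective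
    apply AlternatingMap.coe_multilinearMap_injective
    refine Module.Basis.ext_multilinear
      (fun _ => (EuclideanSpace.basisFun (Fin n) ℝ).toBasis) fun I => ?_
    have := congrFun h I
    simpa [ev] using this
  obtain ⟨L, hL⟩ := LinearMap.exists_leftInverse_of_injective ev hev
  exact ⟨LinearMap.toContinuousLinearMap L, fun α => LinearMap.congr_fun hL α⟩

theorem contDiff_form_apply {E : Type*} [NormedAddCommGroup E] [NormedSpace ℝ E] (v : Fin k → E) :
    ContDiff ℝ ∞ (fun φ : E [⋀^Fin k]→L[ℝ] ℝ => φ v) :=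
  ContinuousLinearMap.contDiff (𝕜 := ℝ) (E := E [⋀^Fin k]→L[ℝ] ℝ) (F := ℝ)
    (ContinuousAlternatingMap.apply ℝ E ℝ v)

/-- A form-valued map is smooth if its coefficients are. -/
theorem contDiffAt_form {X : Type*} [NormedAddCommGroup X] [NormedSpace ℝ X] {x : X}
    {α : X → EuclideanSpace ℝ (Fin n) [⋀^Fin k]→L[ℝ] ℝ}
    (h : ∀ I : Fin k → Fin n,
      ContDiffAt ℝ ∞ (fun y => α y fun i => EuclideanSpace.single (I i) 1) x) :
    ContDiffAt ℝ ∞ α x := by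
  obtain ⟨L, hL⟩ := exists_form_reconstruction n k
  have h1 : α = fun y => L (fun I => α y fun i => EuclideanSpace.single (I i) 1) :=
    funext fun y => (hL (α y)).symm
  rw [h1]
  exact L.contDiff.contDiffAt.comp x (contDiffAt_pi.mpr h)

end FormCoordinates

section MetricOfForm

open scoped Matrix

/-- The determinant of `P + ξ ξᵀ`, up to sign, for a skew matrix `P` with
`P² = x xᵀ - |x|²`. -/
theorem det_skew_add_sq {P : Matrix (Fin 7) (Fin 7) ℝ} {x : Fin 7 → ℝ}
    (hP : P.transpose = -P) (hPP : P * P = Matrix.vecMulVec x x - (x ⬝ᵥ x) • 1)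
    (hPx : P.mulVec x = 0) (hx : x ⬝ᵥ x ≠ 0) (ξ : Fin 7 → ℝ) :
    (P + Matrix.vecMulVec ξ ξ).det ^ 2 = (x ⬝ᵥ x) ^ 4 * (ξ ⬝ᵥ x) ^ 4 := by
  set s := x ⬝ᵥ x with hs
  have key : ∀ ξ : Fin 7 → ℝ, (P + Matrix.vecMulVec ξ ξ).det * (-P + Matrix.vecMulVec x x).det =
      s ^ 6 * (ξ ⬝ᵥ x) ^ 2 := by
    intro ξ
    set c := ξ ⬝ᵥ x with hc
    have hxP : x ᵥ* P = 0 := by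
      rw [← Matrix.mulVec_transpose, hP, Matrix.neg_mulVec, hPx, neg_zero]
    have hξP : ξ ᵥ* P = -(P *ᵥ ξ) := by
      rw [← Matrix.mulVec_transpose, hP, Matrix.neg_mulVec]
    have hPξx : (P *ᵥ ξ) ⬝ᵥ x = 0 := by
      rw [dotProduct_comm, Matrix.dotProduct_mulVec, hxP, zero_dotProduct]
    have hPξξ : (P *ᵥ ξ) ⬝ᵥ ξ = 0 := by
      have h1 : ξ ⬝ᵥ P *ᵥ ξ = -(P *ᵥ ξ) ⬝ᵥ ξ := by
        rw [Matrix.dotProduct_mulVec, hξP]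
      rw [dotProduct_comm, neg_dotProduct] at h1
      linarith
    -- the product of the two matrices is `s` times a perturbation of `1` of rank 2
    set A : Matrix (Fin 7) (Fin 2) ℝ := Matrix.of fun i => ![-(x i / s), ξ i / s] with hA
    set B : Matrix (Fin 2) (Fin 7) ℝ := Matrix.of ![x, P *ᵥ ξ + c • x] with hB
    have h1 : (P + Matrix.vecMulVec ξ ξ) * (-P + Matrix.vecMulVec x x) = s • (1 + A * B) := by
      rw [Matrix.add_mul, Matrix.mul_add, Matrix.mul_add, Matrix.mul_neg, hPP, Matrix.mul_neg,
        Matrix.mul_vecMulVec, hPx, Matrix.vecMulVec_mul, hξP, Matrix.vecMulVec_mul_vecMulVec]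
      ext i j
      simp [hA, hB, Matrix.mul_apply, Fin.sum_univ_two, Matrix.vecMulVec_apply, Matrix.one_apply,
        ← hc]
      field_simp
      split_ifs <;> ring
    have h2 : (1 + B * A).det = c ^ 2 / s := by
      rw [Matrix.det_fin_two]
      have e1 : ∑ i, x i * x i = s := rfl
      have e2 : ∑ i, (P *ᵥ ξ) i * x i = 0 := hPξx
      have e3 : ∑ i, (P *ᵥ ξ) i * ξ i = 0 := hPξξ
      have e4 : ∑ i, ξ i * x i = c := rfl
      have hx' : s ≠ 0 := hx
      have a00 : (B * A) 0 0 = -1 := by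
        have : (B * A) 0 0 = -(1 / s) * ∑ i, x i * x i := by
          rw [Matrix.mul_apply, Finset.mul_sum]
          exact Finset.sum_congr rfl fun i _ => by simp [hA, hB]; ring
        rw [this, e1]
        field_simp
      have a01 : (B * A) 0 1 = c / s := by
        have : (B * A) 0 1 = (1 / s) * ∑ i, ξ i * x i := by
          rw [Matrix.mul_apply, Finset.mul_sum]
          exact Finset.sum_congr rfl fun i _ => by simp [hA, hB]; ring
        rw [this, e4]
        field_simp
      have a10 : (B * A) 1 0 = -c := by
        have : (B * A) 1 0 = -(1 / s) * ∑ i, (P *ᵥ ξ) i * x i - (c / s) * ∑ i, x i * x i := by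
          rw [Matrix.mul_apply, Finset.mul_sum, Finset.mul_sum, ← Finset.sum_sub_distrib]
          exact Finset.sum_congr rfl fun i _ => by simp [hA, hB]; ring
        rw [this, e1, e2]
        field_simp
        ring
      have a11 : (B * A) 1 1 = c ^ 2 / s := by
        have : (B * A) 1 1 = (1 / s) * ∑ i, (P *ᵥ ξ) i * ξ i + (c / s) * ∑ i, ξ i * x i := by
          rw [Matrix.mul_apply, Finset.mul_sum, Finset.mul_sum, ← Finset.sum_add_distrib]
          exact Finset.sum_congr rfl fun i _ => by simp [hA, hB]; ring
        rw [this, e3, e4]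
        field_simp
        ring
      simp [a00, a01, a10, a11]
      field_simp
    rw [← Matrix.det_mul, h1, Matrix.det_smul, Matrix.det_one_add_mul_comm, h2]
    simp
    field_simp
  have hT : (-P + Matrix.vecMulVec x x).det = (P + Matrix.vecMulVec x x).det := by
    rw [← Matrix.det_transpose]
    simp [hP, Matrix.transpose_vecMulVec]
  have h1 := key x
  have h2 := key ξ
  rw [hT] at h1 h2
  set D := (P + Matrix.vecMulVec x x).det
  have h3 : s ^ 8 * (P + Matrix.vecMulVec ξ ξ).det ^ 2 = s ^ 8 * (s ^ 4 * (ξ ⬝ᵥ x) ^ 4) := by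
    have h4 : s ^ 8 = D * D := by rw [h1]; ring
    calc s ^ 8 * (P + Matrix.vecMulVec ξ ξ).det ^ 2
        = ((P + Matrix.vecMulVec ξ ξ).det * D) ^ 2 := by rw [h4]; ring
      _ = _ := by rw [h2]; ring
  exact mul_left_cancel₀ (pow_ne_zero _ hx) h3

/-- For `u ≠ 0` and a `G₂` form `φ` with metric `k`, the square of this determinant is
`(det k)² k(u, u)⁴ |u|⁸` (`formDet_sq`). The summand `u uᵀ` is there because the skew form
`φ(u, ·, ·)` alone is degenerate. -/
def formDet (φ : EuclideanSpace ℝ (Fin 7) [⋀^Fin 3]→L[ℝ] ℝ) (u : EuclideanSpace ℝ (Fin 7)) : ℝ :=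
  (Matrix.of fun i j => φ ![u, EuclideanSpace.single i 1, EuclideanSpace.single j 1] + u i * u j).det

/-- The matrix of an endomorphism of `ℝ⁷`. -/
def stdMatrix (A : EuclideanSpace ℝ (Fin 7) →L[ℝ] EuclideanSpace ℝ (Fin 7)) :
    Matrix (Fin 7) (Fin 7) ℝ :=
  Matrix.of fun m i => A (EuclideanSpace.single i 1) m

variable (A : EuclideanSpace ℝ (Fin 7) ≃L[ℝ] EuclideanSpace ℝ (Fin 7))

theorem stdMatrix_mul_symm : stdMatrix A * stdMatrix A.symm = 1 := by
  ext m i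
  have h : ∀ x : EuclideanSpace ℝ (Fin 7), A x m = ∑ k, x k * A (EuclideanSpace.single k 1) m := by
    intro x
    conv_lhs => rw [← (EuclideanSpace.basisFun (Fin 7) ℝ).sum_repr x]
    simp
  have h1 := h (A.symm (EuclideanSpace.single i 1))
  rw [A.apply_symm_apply] at h1
  simp only [Matrix.mul_apply, stdMatrix, Matrix.of_apply, ContinuousLinearEquiv.coe_coe]
  rw [Finset.sum_congr rfl fun k _ => mul_comm _ _, ← h1]
  simp [Matrix.one_apply]

theorem det_stdMatrix_ne_zero : (stdMatrix A).det ≠ 0 := by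
  intro h
  have := congrArg Matrix.det (stdMatrix_mul_symm A)
  simp [h] at this

theorem stdMatrix_gram (i j : Fin 7) :
    ((stdMatrix A)ᵀ * stdMatrix A) i j =
      inner ℝ (A (EuclideanSpace.single i 1)) (A (EuclideanSpace.single j 1)) := by
  simp [Matrix.mul_apply, stdMatrix, PiLp.inner_apply, mul_comm]

theorem sum_single {n : ℕ} (x : EuclideanSpace ℝ (Fin n)) :
    x = ∑ m, x m • (EuclideanSpace.single m 1 : EuclideanSpace ℝ (Fin n)) := by
  conv_lhs => rw [← (EuclideanSpace.basisFun (Fin n) ℝ).sum_repr x]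
  simp

theorem stdMatrix_mulVec (u : EuclideanSpace ℝ (Fin 7)) : stdMatrix A *ᵥ u.ofLp = (A u).ofLp := by
  ext m
  conv_rhs => rw [sum_single u]
  simp [stdMatrix, Matrix.mulVec, dotProduct, mul_comm]

theorem formDet_sq (u : EuclideanSpace ℝ (Fin 7)) (hu : u ≠ 0) :
    formDet (phi0.compContinuousLinearMap A) u ^ 2 =
      ((stdMatrix A).det ^ 2 * (inner ℝ (A u) (A u)) ^ 2 * inner ℝ u u ^ 2) ^ 2 := by
  set v := A u with hv
  have hv0 : v ≠ 0 := by simpa [hv] using hu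
  set M := stdMatrix A with hM
  set M' := stdMatrix A.symm with hM'
  have hMM' : M * M' = 1 := stdMatrix_mul_symm A
  have hM'M : M' * M = 1 := mul_eq_one_comm.mp hMM'
  -- the covector `⟪u, ·⟫` transported by `A`
  set ξ : Fin 7 → ℝ := M'ᵀ *ᵥ u.ofLp with hξ
  have hMξ : Mᵀ *ᵥ ξ = u.ofLp := by
    rw [hξ, Matrix.mulVec_mulVec, ← Matrix.transpose_mul, hM'M, Matrix.transpose_one,
      Matrix.one_mulVec]
  set P : Matrix (Fin 7) (Fin 7) ℝ :=
    Matrix.of fun m n => phi0 ![v, EuclideanSpace.single m 1, EuclideanSpace.single n 1] with hP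
  have hPM : (Matrix.of fun i j => phi0 ![v, A (EuclideanSpace.single i 1),
      A (EuclideanSpace.single j 1)]) = Mᵀ * P * M := by
    ext i j
    simp only [Matrix.of_apply, ← trilinear_apply]
    rw [sum_single (A (EuclideanSpace.single i 1)), sum_single (A (EuclideanSpace.single j 1))]
    simp only [map_sum, map_smul, sum_apply, smul_apply, smul_eq_mul, Matrix.mul_apply, hP, hM,
      stdMatrix, Matrix.transpose_apply, Matrix.of_apply, Finset.sum_mul, trilinear_apply,
      ContinuousLinearEquiv.coe_coe]
    refine Finset.sum_congr rfl fun m _ => ?_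
    rw [Finset.mul_sum]
    exact Finset.sum_congr rfl fun n _ => by ring
  have h1 : (Matrix.of fun i j => (phi0.compContinuousLinearMap (A : _ →L[ℝ] _))
      ![u, EuclideanSpace.single i 1, EuclideanSpace.single j 1] + u i * u j) =
      Mᵀ * (P + Matrix.vecMulVec ξ ξ) * M := by
    rw [Matrix.mul_add, Matrix.add_mul, ← hPM, Matrix.mul_vecMulVec, Matrix.vecMulVec_mul,
      ← Matrix.mulVec_transpose, hMξ]
    ext i j
    simp only [Matrix.of_apply, Matrix.add_apply, Matrix.vecMulVec_apply, form_comp₃,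
      ContinuousLinearEquiv.coe_coe, hv]
  have h2 : (ξ ⬝ᵥ v.ofLp) = inner ℝ u u := by
    rw [hv, ← stdMatrix_mulVec, ← hM, Matrix.dotProduct_mulVec, ← Matrix.mulVec_transpose, hMξ,
      PiLp.inner_apply]
    rfl
  have h4 : v.ofLp ⬝ᵥ v.ofLp = inner ℝ v v := by
    rw [PiLp.inner_apply]; rfl
  have hPv : ∀ m n, P m n = inner ℝ (cross v (EuclideanSpace.single m 1))
      (EuclideanSpace.single n 1) := fun m n => (inner_cross _ _ _).symm
  have hPT : Pᵀ = -P := by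
    ext m n
    exact form_swap₂₃ phi0 _ _ _
  have h3 := det_skew_add_sq (P := P) (x := v.ofLp) hPT ?_ ?_ ?_ ξ
  · rw [formDet, h1, Matrix.det_mul, Matrix.det_mul, Matrix.det_transpose]
    rw [h2, h4] at h3
    calc _ = M.det ^ 4 * (P + Matrix.vecMulVec ξ ξ).det ^ 2 := by ring
      _ = _ := by rw [h3]; ring
  · have h5 : P * P = -(P * Pᵀ) := by rw [hPT, Matrix.mul_neg, neg_neg]
    rw [h5]
    ext m n
    have h6 : (P * Pᵀ) m n = inner ℝ (cross v (EuclideanSpace.single m 1))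
        (cross v (EuclideanSpace.single n 1)) := by
      simp [Matrix.mul_apply, hPv, PiLp.inner_apply, mul_comm]
    have h7 : starPhi0 ![v, EuclideanSpace.single m 1, v, EuclideanSpace.single n 1] = 0 :=
      starPhi0.map_eq_zero_of_eq _ (i := 0) (j := 2) rfl (by decide)
    rw [Matrix.neg_apply, h6, inner_cross_cross, h7, h4]
    have h8 : ∀ (i : Fin 7) (x : EuclideanSpace ℝ (Fin 7)),
        inner ℝ (EuclideanSpace.single i (1 : ℝ)) x = x i := fun i x => by
      simp [EuclideanSpace.inner_single_left]
    have h9 : ∀ (i : Fin 7) (x : EuclideanSpace ℝ (Fin 7)),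
        inner ℝ x (EuclideanSpace.single i (1 : ℝ)) = x i := fun i x => by
      simp [EuclideanSpace.inner_single_right]
    simp only [h8, h9, Matrix.sub_apply, Matrix.vecMulVec_apply, Matrix.smul_apply,
      Matrix.one_apply, smul_eq_mul, PiLp.single_apply]
    ring
  · ext m
    have : (P *ᵥ v.ofLp) m = phi0 ![v, EuclideanSpace.single m 1, v] := by
      rw [← inner_cross]
      simp [Matrix.mulVec, dotProduct, hPv, PiLp.inner_apply, mul_comm]
    rw [this]
    exact phi0.map_eq_zero_of_eq _ (i := 0) (j := 2) rfl (by decide)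
  · rw [h4]
    exact inner_self_ne_zero.mpr hv0

/-- For a `G₂` form `φ` with metric `k` and `u ≠ 0`, this is `√(det k) k(u, u)`. -/
def densitySq (φ : EuclideanSpace ℝ (Fin 7) [⋀^Fin 3]→L[ℝ] ℝ) (u : EuclideanSpace ℝ (Fin 7)) : ℝ :=
  (formDet φ u ^ 2) ^ (1 / 4 : ℝ) / inner ℝ u u

/-- The matrix of the bilinear form with the quadratic form `densitySq φ`. -/
def densityMatrix (φ : EuclideanSpace ℝ (Fin 7) [⋀^Fin 3]→L[ℝ] ℝ) : Matrix (Fin 7) (Fin 7) ℝ :=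
  Matrix.of fun i j => 1 / 2 * (densitySq φ (EuclideanSpace.single i 1 + EuclideanSpace.single j 1)
    - densitySq φ (EuclideanSpace.single i 1) - densitySq φ (EuclideanSpace.single j 1))

/-- The Gram matrix, in the standard basis, of the metric `k` of a `G₂` form `φ` on `ℝ⁷`, as a function
of the coefficients of `φ`. The exponent arises from `det (√(det k) k) = (det k)^(9/2)`. -/
def gramOfForm (φ : EuclideanSpace ℝ (Fin 7) [⋀^Fin 3]→L[ℝ] ℝ) : Matrix (Fin 7) (Fin 7) ℝ :=
  ((densityMatrix φ).det ^ (-(1 / 9) : ℝ)) • densityMatrix φ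

theorem densitySq_comp (u : EuclideanSpace ℝ (Fin 7)) (hu : u ≠ 0) :
    densitySq (phi0.compContinuousLinearMap A) u =
      |(stdMatrix A).det| * inner ℝ (A u) (A u) := by
  have hu' : (inner ℝ u u : ℝ) ≠ 0 := inner_self_ne_zero.mpr hu
  have h1 : (inner ℝ u u : ℝ) = ‖u‖ ^ 2 := real_inner_self_eq_norm_sq u
  have h2 : (inner ℝ (A u) (A u) : ℝ) = ‖A u‖ ^ 2 := real_inner_self_eq_norm_sq _
  have h3 : ((stdMatrix A).det ^ 2 * (inner ℝ (A u) (A u)) ^ 2 * inner ℝ u u ^ 2) ^ 2 =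
      (|(stdMatrix A).det| * inner ℝ (A u) (A u) * inner ℝ u u) ^ (4 : ℕ) := by
    rw [← sq_abs (stdMatrix A).det]; ring
  rw [densitySq, formDet_sq A u hu, h3, ← Real.rpow_natCast, ← Real.rpow_mul
    (by rw [h1, h2]; positivity)]
  norm_num
  rw [mul_div_assoc, div_self, mul_one]
  simpa using hu

theorem single_add_single_ne_zero (i j : Fin 7) :
    (EuclideanSpace.single i 1 + EuclideanSpace.single j 1 : EuclideanSpace ℝ (Fin 7)) ≠ 0 := by
  intro h
  have := congrArg (fun x : EuclideanSpace ℝ (Fin 7) => x i) h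
  simp only [PiLp.add_apply, PiLp.single_apply, PiLp.zero_apply] at this
  split_ifs at this <;> norm_num at this

theorem densityMatrix_comp :
    densityMatrix (phi0.compContinuousLinearMap A) =
      |(stdMatrix A).det| • ((stdMatrix A)ᵀ * stdMatrix A) := by
  have h0 : ∀ i : Fin 7, (EuclideanSpace.single i 1 : EuclideanSpace ℝ (Fin 7)) ≠ 0 := by simp
  have h1 := single_add_single_ne_zero
  ext i j
  rw [Matrix.smul_apply, stdMatrix_gram]
  simp only [densityMatrix, Matrix.of_apply, densitySq_comp A _ (h0 _), densitySq_comp A _ (h1 i j),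
    map_add, inner_add_left, inner_add_right, smul_eq_mul]
  rw [real_inner_comm (A (EuclideanSpace.single j 1)) (A (EuclideanSpace.single i 1))]
  ring

theorem det_densityMatrix_comp :
    (densityMatrix (phi0.compContinuousLinearMap A)).det = |(stdMatrix A).det| ^ 9 := by
  rw [densityMatrix_comp, Matrix.det_smul, Matrix.det_mul, Matrix.det_transpose,
    ← abs_mul_abs_self (stdMatrix A).det, Fintype.card_fin]
  ring

theorem gramOfForm_comp :
    gramOfForm (phi0.compContinuousLinearMap A) = (stdMatrix A)ᵀ * stdMatrix A := by
  have hpos : 0 < |(stdMatrix A).det| := abs_pos.mpr (det_stdMatrix_ne_zero A)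
  rw [gramOfForm, det_densityMatrix_comp, densityMatrix_comp, smul_smul, ← Real.rpow_natCast,
    ← Real.rpow_mul hpos.le]
  norm_num
  rw [Real.rpow_neg_one, inv_mul_cancel₀ hpos.ne', one_smul]

theorem det_gramOfForm_comp_ne_zero :
    (gramOfForm (phi0.compContinuousLinearMap A)).det ≠ 0 := by
  have := det_stdMatrix_ne_zero A
  simp [gramOfForm_comp, this]

theorem gramOfForm_comp_apply (i j : Fin 7) :
    gramOfForm (phi0.compContinuousLinearMap A) i j =
      inner ℝ (A (EuclideanSpace.single i 1)) (A (EuclideanSpace.single j 1)) := by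
  rw [gramOfForm_comp, stdMatrix_gram]

theorem contDiffAt_densitySq (u : EuclideanSpace ℝ (Fin 7)) (hu : u ≠ 0) :
    ContDiffAt ℝ ∞ (fun φ => densitySq φ u) (phi0.compContinuousLinearMap A) := by
  have h : ContDiffAt ℝ ∞ (fun φ => formDet φ u) (phi0.compContinuousLinearMap A) := by
    refine contDiffAt_det fun i j => ContDiffAt.add ?_ contDiffAt_const
    exact (contDiff_form_apply _).contDiffAt
  refine ((h.pow 2).rpow_const_of_ne ?_).div_const _
  rw [formDet_sq A u hu]
  have h1 : (inner ℝ u u : ℝ) ≠ 0 := inner_self_ne_zero.mpr hu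
  have h2 : (inner ℝ (A u) (A u) : ℝ) ≠ 0 := inner_self_ne_zero.mpr (by simpa using hu)
  have h3 := det_stdMatrix_ne_zero A
  positivity

theorem contDiffAt_gramOfForm (i j : Fin 7) :
    ContDiffAt ℝ ∞ (fun φ => gramOfForm φ i j) (phi0.compContinuousLinearMap A) := by
  have h0 : ∀ i : Fin 7, (EuclideanSpace.single i 1 : EuclideanSpace ℝ (Fin 7)) ≠ 0 := by simp
  have h1 := single_add_single_ne_zero
  have h2 : ∀ i j, ContDiffAt ℝ ∞ (fun φ => densityMatrix φ i j)
      (phi0.compContinuousLinearMap A) := fun i j =>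
    contDiffAt_const.mul (((contDiffAt_densitySq A _ (h1 i j)).sub
      (contDiffAt_densitySq A _ (h0 i))).sub (contDiffAt_densitySq A _ (h0 j)))
  refine ContDiffAt.mul ((contDiffAt_det h2).rpow_const_of_ne ?_) (h2 i j)
  rw [det_densityMatrix_comp]
  have := det_stdMatrix_ne_zero A
  positivity

/-- The coefficients of the 4-form `*φ` of a `G₂` form `φ`, obtained from
`⟪u × v, w × x⟫ = ⟪u, w⟫ ⟪v, x⟫ - ⟪u, x⟫ ⟪v, w⟫ + *φ(u, v, w, x)`. -/
def starCoeff (φ : EuclideanSpace ℝ (Fin 7) [⋀^Fin 3]→L[ℝ] ℝ) (I : Fin 4 → Fin 7) : ℝ :=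
  ∑ m, ∑ n, (gramOfForm φ)⁻¹ m n *
      φ ![EuclideanSpace.single (I 0) 1, EuclideanSpace.single (I 1) 1, EuclideanSpace.single m 1] *
      φ ![EuclideanSpace.single (I 2) 1, EuclideanSpace.single (I 3) 1, EuclideanSpace.single n 1]
    - (gramOfForm φ (I 0) (I 2) * gramOfForm φ (I 1) (I 3)
      - gramOfForm φ (I 0) (I 3) * gramOfForm φ (I 1) (I 2))

theorem starCoeff_comp (I : Fin 4 → Fin 7) :
    starCoeff (phi0.compContinuousLinearMap A) I =
      starPhi0.compContinuousLinearMap (A : _ →L[ℝ] _)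
        fun i => EuclideanSpace.single (I i) (1 : ℝ) := by
  set a : Fin 4 → EuclideanSpace ℝ (Fin 7) := fun i => A (EuclideanSpace.single (I i) (1 : ℝ)) with ha
  have h1 : starPhi0.compContinuousLinearMap (A : _ →L[ℝ] _)
      (fun i => EuclideanSpace.single (I i) (1 : ℝ)) = starPhi0 ![a 0, a 1, a 2, a 3] :=
    congrArg starPhi0 (by funext i; fin_cases i <;> rfl)
  have h2 := inner_cross_cross (a 0) (a 1) (a 2) (a 3)
  set M := stdMatrix A with hM
  have hdet : IsUnit M.det := (det_stdMatrix_ne_zero A).isUnit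
  have h3 : ∀ u v m, (phi0.compContinuousLinearMap (A : _ →L[ℝ] _))
      ![EuclideanSpace.single u (1 : ℝ), EuclideanSpace.single v (1 : ℝ),
        EuclideanSpace.single m (1 : ℝ)] =
      (Mᵀ *ᵥ (cross (A (EuclideanSpace.single u (1 : ℝ)))
        (A (EuclideanSpace.single v (1 : ℝ)))).ofLp) m := by
    intro u v m
    rw [form_comp₃]
    simp only [ContinuousLinearEquiv.coe_coe]
    rw [← inner_cross, PiLp.inner_apply]
    simp [Matrix.mulVec, dotProduct, hM, stdMatrix]
  have h4 : ∀ x y : Fin 7 → ℝ, ∑ m, ∑ n, (Mᵀ * M)⁻¹ m n * (Mᵀ *ᵥ x) m * (Mᵀ *ᵥ y) n = x ⬝ᵥ y := by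
    intro x y
    have : ∑ m, ∑ n, (Mᵀ * M)⁻¹ m n * (Mᵀ *ᵥ x) m * (Mᵀ *ᵥ y) n =
        (Mᵀ *ᵥ x) ⬝ᵥ ((Mᵀ * M)⁻¹ *ᵥ (Mᵀ *ᵥ y)) := by
      generalize Mᵀ *ᵥ x = x', Mᵀ *ᵥ y = y', (Mᵀ * M)⁻¹ = G
      simp only [dotProduct, Matrix.mulVec, Finset.mul_sum]
      exact Finset.sum_congr rfl fun m _ => Finset.sum_congr rfl fun n _ => by ring
    rw [this, Matrix.mul_inv_rev, Matrix.mulVec_mulVec, Matrix.mul_assoc,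
      Matrix.nonsing_inv_mul _ (by simpa using hdet), Matrix.mul_one, Matrix.mulVec_transpose,
      ← Matrix.dotProduct_mulVec, Matrix.mulVec_mulVec, Matrix.mul_nonsing_inv _ hdet,
      Matrix.one_mulVec]
  rw [h1, starCoeff]
  simp only [gramOfForm_comp_apply]
  rw [gramOfForm_comp]
  simp only [h3]
  rw [h4]
  have h5 : (cross (a 0) (a 1)).ofLp ⬝ᵥ (cross (a 2) (a 3)).ofLp =
      inner ℝ (cross (a 0) (a 1)) (cross (a 2) (a 3)) := by
    simp [PiLp.inner_apply, dotProduct, mul_comm]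
  simp only [ha] at h5 h2 ⊢
  rw [h5, h2]
  ring

/-- The Hodge dual `φ ↦ *φ` of `G₂` forms extends to a map that is smooth near all `G₂` forms. -/
theorem exists_smooth_star :
    ∃ S : (EuclideanSpace ℝ (Fin 7) [⋀^Fin 3]→L[ℝ] ℝ) → EuclideanSpace ℝ (Fin 7) [⋀^Fin 4]→L[ℝ] ℝ,
      ∀ A : EuclideanSpace ℝ (Fin 7) ≃L[ℝ] EuclideanSpace ℝ (Fin 7),
        S (phi0.compContinuousLinearMap A) = starPhi0.compContinuousLinearMap (A : _ →L[ℝ] _) ∧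
          ContDiffAt ℝ ∞ S (phi0.compContinuousLinearMap A) := by
  obtain ⟨L, hL⟩ := exists_form_reconstruction 7 4
  refine ⟨fun φ => L (starCoeff φ), fun A => ⟨?_, ?_⟩⟩
  · rw [← hL (starPhi0.compContinuousLinearMap (A : _ →L[ℝ] _))]
    exact congrArg L (funext fun I => starCoeff_comp A I)
  · refine L.contDiff.contDiffAt.comp _ (contDiffAt_pi.mpr fun I => ?_)
    have hG := contDiffAt_gramOfForm A
    have hGi := contDiffAt_matrix_inv hG (det_gramOfForm_comp_ne_zero A)
    have he : ∀ v : Fin 3 → EuclideanSpace ℝ (Fin 7), ContDiffAt ℝ ∞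
        (fun φ : EuclideanSpace ℝ (Fin 7) [⋀^Fin 3]→L[ℝ] ℝ => φ v)
        (phi0.compContinuousLinearMap (A : _ →L[ℝ] _)) := fun v =>
      (contDiff_form_apply v).contDiffAt
    exact (ContDiffAt.sum fun m _ => ContDiffAt.sum fun n _ =>
      ((hGi m n).mul (he _)).mul (he _)).sub
        (((hG _ _).mul (hG _ _)).sub ((hG _ _).mul (hG _ _)))

end MetricOfForm

/-! ### Lie derivatives of forms on a vector space -/

section LieDerivative

variable {E : Type*} [NormedAddCommGroup E] [NormedSpace ℝ E] {k : ℕ}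

/-- `ℒ_W α = 0` at the point `y` of a vector space, in terms of the derivatives of the form `α`
and of the vector field `W`. -/
def LieDerivEqZero (α : E → E [⋀^Fin k]→L[ℝ] ℝ) (W : E → E) (y : E) : Prop :=
  ∀ v : Fin k → E,
    fderiv ℝ α y (W y) v + ∑ i, α y (Function.update v i (fderiv ℝ W y (v i))) = 0

theorem fderiv_curryLeft_apply {α : E → E [⋀^Fin (k + 1)]→L[ℝ] ℝ} {W : E → E} {y : E}
    (hα : DifferentiableAt ℝ α y) (hW : DifferentiableAt ℝ W y) (a : E) (v : Fin k → E) :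
    fderiv ℝ (fun z => (α z).curryLeft (W z)) y a v =
      fderiv ℝ α y a (Matrix.vecCons (W y) v) + α y (Matrix.vecCons (fderiv ℝ W y a) v) := by
  have h := (((ContinuousAlternatingMap.curryLeftLI (𝕜 := ℝ) (E := E) (F := ℝ)
    (n := k)).toContinuousLinearMap.hasFDerivAt).comp y hα.hasFDerivAt).clm_apply hW.hasFDerivAt
  have h2 := congrArg (fun f => f a v) h.fderiv
  refine h2.trans ?_
  simp only [add_apply, ContinuousLinearMap.comp_apply, ContinuousLinearMap.flip_apply]
  rw [add_comm]
  rfl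

/-- A consequence of Cartan's formula `ℒ_W = d ι_W + ι_W d`. -/
theorem extDeriv_curryLeft_eq_zero {α : E → E [⋀^Fin (k + 1)]→L[ℝ] ℝ} {W : E → E} {y : E}
    (hα : DifferentiableAt ℝ α y) (hW : DifferentiableAt ℝ W y) (hd : extDeriv α y = 0)
    (hL : LieDerivEqZero α W y) : extDeriv (fun z => (α z).curryLeft (W z)) y = 0 := by
  ext v
  have h1 : extDeriv α y (Matrix.vecCons (W y) v) = 0 := by rw [hd]; rfl
  have h2 := hL v
  simp only [extDeriv, ContinuousAlternatingMap.alternatizeUncurryFin_apply,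
    fderiv_curryLeft_apply hα hW] at h1 ⊢
  rw [Fin.sum_univ_succ] at h1
  have h3 : ∀ i : Fin (k + 1), i.succ.removeNth (Matrix.vecCons (W y) v) =
      Matrix.vecCons (W y) (i.removeNth v) := by
    intro i
    obtain _ | k := k
    · funext j
      fin_cases i; fin_cases j; rfl
    · funext j
      refine Fin.cases ?_ (fun j => ?_) j <;> simp [Fin.removeNth]
  have h4 : ∀ (i : Fin (k + 1)) (a : E),
      (-1 : ℤ) ^ (i : ℕ) • α y (Matrix.vecCons a (i.removeNth v)) = α y (Function.update v i a) := by
    intro i a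
    rw [← Fin.insertNth_removeNth]
    exact ((α y).toAlternatingMap.map_insertNth i a (i.removeNth v)).symm
  simp only [h3, Fin.val_succ, pow_succ, Matrix.cons_val_succ, mul_neg, mul_one, neg_smul,
    Finset.sum_neg_distrib, Fin.removeNth_zero, Fin.val_zero, pow_zero, Matrix.cons_val_zero,
    one_smul] at h1
  have h5 : Fin.tail (Matrix.vecCons (W y) v) = v := rfl
  rw [h5] at h1
  simp only [smul_add, Finset.sum_add_distrib, h4]
  change _ = (0 : ℝ)
  linarith

/-- The Lie derivative `ℒ_W α` at `y` as the derivative at `s = 0` of the pullbacks of `α` by maps that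
agree to first order in `s` with the flow of `W`: they send `y` to `y + s W(y)`, with the
differential `1 + s DW(y)`. -/
theorem hasDerivAt_comp_one_add_smul {α : E → E [⋀^Fin k]→L[ℝ] ℝ} {W : E → E} {y : E}
    (hα : DifferentiableAt ℝ α y) : ∃ α' : E [⋀^Fin k]→L[ℝ] ℝ,
      HasDerivAt (fun s : ℝ => (α (y + s • W y)).compContinuousLinearMap
        (ContinuousLinearMap.id ℝ E + s • fderiv ℝ W y)) α' 0 ∧
      ∀ v, α' v =
        fderiv ℝ α y (W y) v + ∑ i, α y (Function.update v i (fderiv ℝ W y (v i))) := by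
  have hc : HasFDerivAt (fun s : ℝ => y + s • W y)
      ((ContinuousLinearMap.id ℝ ℝ).smulRight (W y)) 0 := by
    simpa using ((hasFDerivAt_id (𝕜 := ℝ) (0 : ℝ)).smul_const (W y)).const_add y
  have hB : HasFDerivAt (fun s : ℝ => ContinuousLinearMap.id ℝ E + s • fderiv ℝ W y)
      ((ContinuousLinearMap.id ℝ ℝ).smulRight (fderiv ℝ W y)) 0 := by
    simpa using ((hasFDerivAt_id (𝕜 := ℝ) (0 : ℝ)).smul_const (fderiv ℝ W y)).const_add
      (ContinuousLinearMap.id ℝ E)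
  have hα' : HasFDerivAt α (fderiv ℝ α y) (y + (0 : ℝ) • W y) := by simpa using hα.hasFDerivAt
  have h := (hα'.comp (0 : ℝ) hc).continuousAlternatingMapCompContinuousLinearMap hB
  refine ⟨_, h.hasDerivAt, fun v => ?_⟩
  simp only [add_apply, ContinuousLinearMap.comp_apply, ContinuousLinearMap.smulRight_apply,
    ContinuousLinearMap.id_apply, zero_smul, add_zero, one_smul, ContinuousAlternatingMap.add_apply,
    Function.comp_apply, ContinuousAlternatingMap.fderivCompContinuousLinearMap_apply]
  refine congrArg₂ (· + ·) rfl (Finset.sum_congr rfl fun i _ => congrArg (α y) (funext fun j => ?_))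
  by_cases h : j = i
  · subst h
    simp
  · simp [h]

end LieDerivative

/-- As `*φ` is a smooth function of `φ`, a symmetry of `φ` is a symmetry of `*φ`. -/
theorem LieDerivEqZero.star
    {φ : EuclideanSpace ℝ (Fin 7) → EuclideanSpace ℝ (Fin 7) [⋀^Fin 3]→L[ℝ] ℝ}
    {χ : EuclideanSpace ℝ (Fin 7) → EuclideanSpace ℝ (Fin 7) [⋀^Fin 4]→L[ℝ] ℝ}
    {W : EuclideanSpace ℝ (Fin 7) → EuclideanSpace ℝ (Fin 7)} {y : EuclideanSpace ℝ (Fin 7)}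
    (hφ : DifferentiableAt ℝ φ y) (hχ : DifferentiableAt ℝ χ y)
    (h : ∀ᶠ z in nhds y, ∃ A : EuclideanSpace ℝ (Fin 7) ≃L[ℝ] EuclideanSpace ℝ (Fin 7),
      φ z = phi0.compContinuousLinearMap (A : _ →L[ℝ] _) ∧
        χ z = starPhi0.compContinuousLinearMap (A : _ →L[ℝ] _))
    (hL : LieDerivEqZero φ W y) : LieDerivEqZero χ W y := by
  obtain ⟨S, hS⟩ := exists_smooth_star
  obtain ⟨φ', hφ', hφ'v⟩ := hasDerivAt_comp_one_add_smul (W := W) hφ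
  obtain ⟨χ', hχ', hχ'v⟩ := hasDerivAt_comp_one_add_smul (W := W) hχ
  have h0 : φ' = 0 := by
    ext v
    rw [hφ'v v]
    exact hL v
  subst h0
  intro v
  rw [← hχ'v v]
  obtain ⟨A, hA, -⟩ := h.self_of_nhds
  have e0 : (φ (y + (0 : ℝ) • W y)).compContinuousLinearMap
      (ContinuousLinearMap.id ℝ _ + (0 : ℝ) • fderiv ℝ W y) =
        phi0.compContinuousLinearMap (A : _ →L[ℝ] _) := by
    simp only [zero_smul, add_zero, ← hA]
    rfl
  have hSd : HasFDerivAt S (fderiv ℝ S (phi0.compContinuousLinearMap (A : _ →L[ℝ] _)))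
      ((φ (y + (0 : ℝ) • W y)).compContinuousLinearMap
        (ContinuousLinearMap.id ℝ _ + (0 : ℝ) • fderiv ℝ W y)) := by
    rw [e0]
    exact ((hS A).2.differentiableAt (by simp)).hasFDerivAt
  have h1 := hSd.comp_hasDerivAt (0 : ℝ) hφ'
  have hc : Filter.Tendsto (fun s : ℝ => y + s • W y) (nhds 0) (nhds y) := by
    have : Continuous fun s : ℝ => y + s • W y := by fun_prop
    simpa using this.tendsto 0
  have hB : ∀ᶠ s : ℝ in nhds 0, ∃ B : EuclideanSpace ℝ (Fin 7) ≃L[ℝ] EuclideanSpace ℝ (Fin 7),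
      (B : _ →L[ℝ] _) = ContinuousLinearMap.id ℝ _ + s • fderiv ℝ W y := by
    have : Continuous fun s : ℝ => ContinuousLinearMap.id ℝ (EuclideanSpace ℝ (Fin 7)) +
        s • fderiv ℝ W y := by fun_prop
    have h2 := this.tendsto 0
    simp only [zero_smul, add_zero] at h2
    exact h2 (ContinuousLinearEquiv.nhds (ContinuousLinearEquiv.refl ℝ _))
  have h2 : (S ∘ fun s : ℝ => (φ (y + s • W y)).compContinuousLinearMap
      (ContinuousLinearMap.id ℝ _ + s • fderiv ℝ W y)) =ᶠ[nhds 0]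
      fun s : ℝ => (χ (y + s • W y)).compContinuousLinearMap
        (ContinuousLinearMap.id ℝ _ + s • fderiv ℝ W y) := by
    filter_upwards [hc.eventually h, hB] with s ⟨A, hA1, hA2⟩ ⟨B, hB⟩
    rw [Function.comp_apply, hA1, hA2, ← hB]
    exact (hS (B.trans A)).1
  have h3 := (h1.congr_of_eventuallyEq h2.symm).unique hχ'
  rw [← h3, map_zero]
  rfl

/-! ### Tensor fields in charts -/

theorem two_le_infty : (2 : WithTop ℕ∞) ≤ ∞ := WithTop.coe_le_coe.mpr le_top

section ChartFields

open VectorField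

variable {E H M : Type*} [NormedAddCommGroup E] [NormedSpace ℝ E] [CompleteSpace E]
  [TopologicalSpace H] {I : ModelWithCorners ℝ E H} [TopologicalSpace M] [ChartedSpace H M]
  [IsManifold I ∞ M]

theorem contMDiffAt_mpullback_extChartAt {q p : M} (hp : p ∈ (extChartAt I q).source) {W : E → E}
    (hW : ContDiffAt ℝ ∞ W (extChartAt I q p)) :
    ContMDiffAt I I.tangent ∞ (fun p => (⟨p, mpullback I 𝓘(ℝ, E) (extChartAt I q) W p⟩ :
      TangentBundle I M)) p := by
  have : IsManifold I 1 M := IsManifold.of_le (n := ∞) (by simp)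
  refine ContMDiffAt.mpullback_vectorField_preimage (n := ∞) ?_
    (contMDiffAt_extChartAt' (by simpa using hp)) (isInvertible_mfderiv_extChartAt hp) (by simp)
  exact contMDiffAt_vectorSpace_iff_contDiffAt.mpr hW

theorem mlieBracket_mpullback_extChartAt {q p : M} (hp : p ∈ (extChartAt I q).source)
    {W W' : E → E} (hW : ContDiffAt ℝ ∞ W (extChartAt I q p))
    (hW' : ContDiffAt ℝ ∞ W' (extChartAt I q p)) :
    mlieBracket I (mpullback I 𝓘(ℝ, E) (extChartAt I q) W)
      (mpullback I 𝓘(ℝ, E) (extChartAt I q) W') p =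
        mpullback I 𝓘(ℝ, E) (extChartAt I q) (lieBracket ℝ W W') p := by
  have : IsManifold I 1 M := IsManifold.of_le (n := ∞) (by simp)
  have : IsManifold I (minSmoothness ℝ 2) M :=
    IsManifold.of_le (n := ∞) (by simpa using two_le_infty)
  have h : ∀ W : E → E, ContDiffAt ℝ ∞ W (extChartAt I q p) →
      MDifferentiableAt 𝓘(ℝ, E) 𝓘(ℝ, E).tangent
        (fun y => (⟨y, W y⟩ : TangentBundle 𝓘(ℝ, E) E)) (extChartAt I q p) := fun W hW =>
    ((contMDiffAt_vectorSpace_iff_contDiffAt (𝕜 := ℝ) (V := W) (n := ∞)).mpr hW).mdifferentiableAt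
      (by simp)
  have h2 : mlieBracket 𝓘(ℝ, E) W W' = lieBracket ℝ W W' :=
    mlieBracketWithin_univ.symm.trans (mlieBracketWithin_eq_lieBracketWithin.trans
      (lieBracketWithin_univ (𝕜 := ℝ)))
  exact (mpullback_mlieBracket (n := ∞) (h W hW) (h W' hW')
    (contMDiffAt_extChartAt' (by simpa using hp)) (by simpa using two_le_infty)).symm.trans
      (congrArg (fun Z : E → E => mpullback I 𝓘(ℝ, E) (extChartAt I q) Z p) h2)

end ChartFields

section Charts

open VectorField

variable {n : ℕ} {M : Type*} [TopologicalSpace M] [ChartedSpace (EuclideanSpace ℝ (Fin n)) M]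

theorem DForm.Smooth.contDiffAt {k : ℕ} {α : DForm n M k} (hα : α.Smooth) {q : M}
    {y : EuclideanSpace ℝ (Fin n)} (hy : y ∈ (extChartAt (𝓡 n) q).target) :
    ContDiffAt ℝ ∞ (α.inChart q) y :=
  (hα q).contDiffAt ((isOpen_extChartAt_target q).mem_nhds hy)

variable [IsManifold (𝓡 n) ∞ M]

instance isManifold_one : IsManifold (𝓡 n) 1 M := IsManifold.of_le (n := ∞) (by simp)

theorem chartDeriv_eq_id (x : M) :
    chartDeriv x = ContinuousLinearMap.id ℝ (EuclideanSpace ℝ (Fin n)) :=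
  mfderiv_extChartAt_self

theorem mfderiv_chartInvDeriv {q : M} {y : EuclideanSpace ℝ (Fin n)}
    (hy : y ∈ (extChartAt (𝓡 n) q).target) (v : EuclideanSpace ℝ (Fin n)) :
    mfderiv (𝓡 n) 𝓘(ℝ, EuclideanSpace ℝ (Fin n)) (extChartAt (𝓡 n) q)
      ((extChartAt (𝓡 n) q).symm y) (chartInvDeriv q y v) = v := by
  have h := mfderiv_extChartAt_comp_mfderivWithin_extChartAt_symm (I := 𝓡 n) hy
  rw [ModelWithCorners.range_eq_univ, mfderivWithin_univ] at h
  exact DFunLike.congr_fun h v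

theorem chartInvDeriv_mfderiv {q : M} {y : EuclideanSpace ℝ (Fin n)}
    (hy : y ∈ (extChartAt (𝓡 n) q).target)
    (v : TangentSpace (𝓡 n) ((extChartAt (𝓡 n) q).symm y)) :
    chartInvDeriv q y (mfderiv (𝓡 n) 𝓘(ℝ, EuclideanSpace ℝ (Fin n)) (extChartAt (𝓡 n) q)
      ((extChartAt (𝓡 n) q).symm y) v) = v := by
  have h := mfderivWithin_extChartAt_symm_comp_mfderiv_extChartAt (I := 𝓡 n) hy
  rw [ModelWithCorners.range_eq_univ, mfderivWithin_univ] at h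
  exact DFunLike.congr_fun h v

/-- The differential of the inverse of a chart, as an isomorphism. -/
def chartInvEquiv (q : M) (y : EuclideanSpace ℝ (Fin n)) (hy : y ∈ (extChartAt (𝓡 n) q).target) :
    EuclideanSpace ℝ (Fin n) ≃L[ℝ] TangentSpace (𝓡 n) ((extChartAt (𝓡 n) q).symm y) :=
  ContinuousLinearEquiv.equivOfInverse (chartInvDeriv q y)
    (mfderiv (𝓡 n) 𝓘(ℝ, EuclideanSpace ℝ (Fin n)) (extChartAt (𝓡 n) q)
      ((extChartAt (𝓡 n) q).symm y)) (mfderiv_chartInvDeriv hy) (chartInvDeriv_mfderiv hy)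

/-- The expression of a vector field in the preferred chart at `q`. -/
def VField.inChart (X : VField n M) (q : M) (y : EuclideanSpace ℝ (Fin n)) :
    EuclideanSpace ℝ (Fin n) :=
  mfderiv (𝓡 n) 𝓘(ℝ, EuclideanSpace ℝ (Fin n)) (extChartAt (𝓡 n) q)
    ((extChartAt (𝓡 n) q).symm y) (X ((extChartAt (𝓡 n) q).symm y))

theorem chartInvDeriv_inChart (X : VField n M) {q : M} {y : EuclideanSpace ℝ (Fin n)}
    (hy : y ∈ (extChartAt (𝓡 n) q).target) :
    chartInvDeriv q y (X.inChart q y) = X ((extChartAt (𝓡 n) q).symm y) :=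
  chartInvDeriv_mfderiv hy _

theorem VField.contDiffOn_inChart {X : VField n M} (hX : ∀ p, SmoothFieldAt X p) (q : M) :
    ContDiffOn ℝ ∞ (X.inChart q) (extChartAt (𝓡 n) q).target := by
  rw [← contMDiffOn_iff_contDiffOn]
  intro y hy
  have hp : (extChartAt (𝓡 n) q).symm y ∈ (chartAt (EuclideanSpace ℝ (Fin n)) q).source := by
    simpa using (extChartAt (𝓡 n) q).map_target hy
  have h1 := ((trivializationAt (EuclideanSpace ℝ (Fin n)) (TangentSpace (𝓡 n)) q
    ).contMDiffAt_section_iff (n := ∞) (IB := 𝓡 n) (s := X) (x₀ := (extChartAt (𝓡 n) q).symm y)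
      (by simpa using hp)).mp (hX _)
  have h2 := (contMDiffOn_extChartAt_symm (n := ∞) (I := 𝓡 n) q).contMDiffAt
    ((isOpen_extChartAt_target q).mem_nhds hy)
  refine ((h1.comp y h2).congr_of_eventuallyEq ?_).contMDiffWithinAt
  filter_upwards [(isOpen_extChartAt_target q).mem_nhds hy] with z hz
  have hz' : (extChartAt (𝓡 n) q).symm z ∈ (chartAt (EuclideanSpace ℝ (Fin n)) q).source := by
    simpa using (extChartAt (𝓡 n) q).map_target hz
  have h3 := TangentBundle.continuousLinearMapAt_trivializationAt (𝕜 := ℝ) (I := 𝓡 n) hz'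
  refine (DFunLike.congr_fun h3 (X _)).symm.trans ?_
  exact congrFun (Bundle.Trivialization.coe_linearMapAt_of_mem (R := ℝ)
    (trivializationAt (EuclideanSpace ℝ (Fin n)) (TangentSpace (𝓡 n)) q) (by simpa using hz')) _

/-- The vector field on `M` represented by `W` in the preferred chart at `q`. -/
def ofChart (q : M) (W : EuclideanSpace ℝ (Fin n) → EuclideanSpace ℝ (Fin n)) : VField n M :=
  mpullback (𝓡 n) 𝓘(ℝ, EuclideanSpace ℝ (Fin n)) (extChartAt (𝓡 n) q) W

theorem ofChart_symm (q : M) (W : EuclideanSpace ℝ (Fin n) → EuclideanSpace ℝ (Fin n))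
    {y : EuclideanSpace ℝ (Fin n)} (hy : y ∈ (extChartAt (𝓡 n) q).target) :
    ofChart q W ((extChartAt (𝓡 n) q).symm y) = chartInvDeriv q y (W y) := by
  have h : mfderiv (𝓡 n) 𝓘(ℝ, EuclideanSpace ℝ (Fin n)) (extChartAt (𝓡 n) q)
      ((extChartAt (𝓡 n) q).symm y) = ((chartInvEquiv q y hy).symm :
        TangentSpace (𝓡 n) ((extChartAt (𝓡 n) q).symm y) →L[ℝ] EuclideanSpace ℝ (Fin n)) := rfl
  have h1 : ContinuousLinearMap.inverse ((chartInvEquiv q y hy).symm :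
        TangentSpace (𝓡 n) ((extChartAt (𝓡 n) q).symm y) →L[ℝ] EuclideanSpace ℝ (Fin n)) =
      chartInvDeriv q y := ContinuousLinearMap.inverse_equiv _
  exact (congrArg (fun f => ContinuousLinearMap.inverse f
      (W (extChartAt (𝓡 n) q ((extChartAt (𝓡 n) q).symm y)))) h).trans
    ((DFunLike.congr_fun h1 _).trans
      (congrArg (fun z => chartInvDeriv q y (W z)) ((extChartAt (𝓡 n) q).right_inv hy)))

theorem smoothFieldAt_ofChart {q p : M} (hp : p ∈ (extChartAt (𝓡 n) q).source)
    {W : EuclideanSpace ℝ (Fin n) → EuclideanSpace ℝ (Fin n)}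
    (hW : ContDiffAt ℝ ∞ W (extChartAt (𝓡 n) q p)) : SmoothFieldAt (ofChart q W) p := by
  exact contMDiffAt_mpullback_extChartAt hp hW

theorem mlieBracket_ofChart {q p : M} (hp : p ∈ (extChartAt (𝓡 n) q).source)
    {W W' : EuclideanSpace ℝ (Fin n) → EuclideanSpace ℝ (Fin n)}
    (hW : ContDiffAt ℝ ∞ W (extChartAt (𝓡 n) q p)) (hW' : ContDiffAt ℝ ∞ W' (extChartAt (𝓡 n) q p)) :
    mlieBracket (𝓡 n) (ofChart q W) (ofChart q W') p = ofChart q (lieBracket ℝ W W') p := by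
  exact mlieBracket_mpullback_extChartAt hp hW hW'

theorem ofChart_inChart (X : VField n M) {q p : M} (hp : p ∈ (extChartAt (𝓡 n) q).source) :
    ofChart q (X.inChart q) p = X p := by
  have h := ofChart_symm q (X.inChart q) ((extChartAt (𝓡 n) q).map_source hp)
  rw [chartInvDeriv_inChart _ ((extChartAt (𝓡 n) q).map_source hp)] at h
  rwa [(extChartAt (𝓡 n) q).left_inv hp] at h

theorem DForm.apply_ofChart {k : ℕ} (α : DForm n M k) {q p : M}
    (hp : p ∈ (extChartAt (𝓡 n) q).source)
    (W : Fin k → EuclideanSpace ℝ (Fin n) → EuclideanSpace ℝ (Fin n)) :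
    α p (fun i => ofChart q (W i) p) =
      α.inChart q (extChartAt (𝓡 n) q p) (fun i => W i (extChartAt (𝓡 n) q p)) := by
  have h := (extChartAt (𝓡 n) q).left_inv hp
  have h1 : α p (fun i => ofChart q (W i) p) =
      α ((extChartAt (𝓡 n) q).symm (extChartAt (𝓡 n) q p))
        (fun i => ofChart q (W i) ((extChartAt (𝓡 n) q).symm (extChartAt (𝓡 n) q p))) := by rw [h]
  rw [h1]
  exact congrArg (α ((extChartAt (𝓡 n) q).symm (extChartAt (𝓡 n) q p)))
    (funext fun i => ofChart_symm q (W i) ((extChartAt (𝓡 n) q).map_source hp))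

theorem DForm.extDeriv_inChart_eq_zero {k : ℕ} {α : DForm n M k} (hα : α.d = 0) (q : M) :
    extDeriv (α.inChart q) (extChartAt (𝓡 n) q q) = 0 := by
  have h := congrFun hα q
  rw [DForm.d, chartDeriv_eq_id] at h
  exact h

theorem DForm.IsInvariant.lieDerivEqZero {k : ℕ} {α : DForm n M k} (hα : α.Smooth)
    {V : VField n M} (hV : ∀ p, SmoothFieldAt V p) (h : α.IsInvariant V) (q : M) :
    LieDerivEqZero (α.inChart q) (V.inChart q) (extChartAt (𝓡 n) q q) := by
  intro v
  set c := extChartAt (𝓡 n) q with hc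
  have hq : q ∈ c.source := mem_extChartAt_source q
  have hy : c q ∈ c.target := c.map_source hq
  have hαd := hα.contDiffAt hy
  have hVd : ContDiffAt ℝ ∞ (V.inChart q) (c q) :=
    (V.contDiffOn_inChart hV q).contDiffAt ((isOpen_extChartAt_target q).mem_nhds hy)
  have hVo : V =ᶠ[nhds q] ofChart q (V.inChart q) := by
    filter_upwards [extChartAt_source_mem_nhds (I := 𝓡 n) q] with p hp
    exact (ofChart_inChart V hp).symm
  have h1 := h q (fun i => ofChart q (fun _ => v i)) (fun i =>
    smoothFieldAt_ofChart hq contDiffAt_const)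
  have h2 : ∀ i, mlieBracket (𝓡 n) V (ofChart q (fun _ => v i)) q =
      ofChart q (fun _ => -fderiv ℝ (V.inChart q) (c q) (v i)) q := by
    intro i
    rw [hVo.mlieBracket_vectorField_eq (Filter.EventuallyEq.refl _ (ofChart q fun _ => v i)),
      mlieBracket_ofChart hq hVd contDiffAt_const]
    have : lieBracket ℝ (V.inChart q) (fun _ => v i) (c q) =
        -fderiv ℝ (V.inChart q) (c q) (v i) := by simp [lieBracket]
    exact congrArg (fun w => ContinuousLinearMap.inverse
      (mfderiv (𝓡 n) 𝓘(ℝ, EuclideanSpace ℝ (Fin n)) c q) w) this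
  have h3 : ∀ i, α q (Function.update (fun j => ofChart q (fun _ => v j) q) i
      (mlieBracket (𝓡 n) V (ofChart q (fun _ => v i)) q)) =
      -α.inChart q (c q) (Function.update v i (fderiv ℝ (V.inChart q) (c q) (v i))) := by
    intro i
    rw [h2]
    have e : Function.update (fun j => ofChart q (fun _ => v j) q) i
        (ofChart q (fun _ => -fderiv ℝ (V.inChart q) (c q) (v i)) q) =
        fun j => ofChart q (fun _ =>
          Function.update v i (-fderiv ℝ (V.inChart q) (c q) (v i)) j) q := by
      funext j
      by_cases hj : j = i
      · subst hj; simp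
      · simp [hj]
    rw [e, α.apply_ofChart hq]
    exact (α.inChart q (c q)).toAlternatingMap.map_update_neg v i _
  have h4 : (fun p => α p (fun i => ofChart q (fun _ => v i) p)) =ᶠ[nhds q]
      (fun y => α.inChart q y v) ∘ c := by
    filter_upwards [extChartAt_source_mem_nhds (I := 𝓡 n) q] with p hp
    exact α.apply_ofChart hp _
  have hd : DifferentiableAt ℝ (fun y => α.inChart q y v) (c q) :=
    ((contDiff_form_apply v).contDiffAt.comp _ hαd).differentiableAt (by simp)
  have h5 : mfderiv (𝓡 n) 𝓘(ℝ, ℝ) (fun p => α p (fun i => ofChart q (fun _ => v i) p)) q (V q) =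
      fderiv ℝ (α.inChart q) (c q) (V.inChart q (c q)) v := by
    rw [h4.mfderiv_eq]
    have h6 := mfderiv_comp (I := 𝓡 n) (I' := 𝓘(ℝ, EuclideanSpace ℝ (Fin n))) (I'' := 𝓘(ℝ, ℝ)) q
      (g := fun y => α.inChart q y v) hd.mdifferentiableAt
      (mdifferentiableAt_extChartAt (I := 𝓡 n) (mem_chart_source _ q))
    have h7 : V.inChart q (c q) =
        mfderiv (𝓡 n) 𝓘(ℝ, EuclideanSpace ℝ (Fin n)) c q (V q) :=
      congrArg (fun p => (mfderiv (𝓡 n) 𝓘(ℝ, EuclideanSpace ℝ (Fin n)) c p (V p) :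
        EuclideanSpace ℝ (Fin n))) (c.left_inv hq)
    have h8 := DFunLike.congr_fun h6 (V q)
    have h9 := fderiv_continuousAlternatingMap_apply_const_apply
      (hαd.differentiableAt (by simp)) v (V.inChart q (c q))
    rw [← h9, h7]
    exact h8.trans (congrArg (fun f : EuclideanSpace ℝ (Fin n) →L[ℝ] ℝ => f _) mfderiv_eq_fderiv)
  rw [h5] at h1
  rw [h1, ← Finset.sum_add_distrib]
  exact Finset.sum_eq_zero fun i _ => by rw [h3]; ring

/-- The expression of a field of endomorphisms in the preferred chart at `q`. -/
def EndField.inChart (J : EndField n M) (q : M) (y : EuclideanSpace ℝ (Fin n)) :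
    EuclideanSpace ℝ (Fin n) →L[ℝ] EuclideanSpace ℝ (Fin n) :=
  (mfderiv (𝓡 n) 𝓘(ℝ, EuclideanSpace ℝ (Fin n)) (extChartAt (𝓡 n) q)
    ((extChartAt (𝓡 n) q).symm y)).comp
      ((J ((extChartAt (𝓡 n) q).symm y)).comp (chartInvDeriv q y))

theorem EndField.chartInvDeriv_inChart (J : EndField n M) {q : M} {y : EuclideanSpace ℝ (Fin n)}
    (hy : y ∈ (extChartAt (𝓡 n) q).target) (v : EuclideanSpace ℝ (Fin n)) :
    chartInvDeriv q y (J.inChart q y v) =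
      J ((extChartAt (𝓡 n) q).symm y) (chartInvDeriv q y v) :=
  chartInvDeriv_mfderiv hy _

theorem EndField.apply_ofChart (J : EndField n M) {q p : M}
    (hp : p ∈ (extChartAt (𝓡 n) q).source) (W : EuclideanSpace ℝ (Fin n) → EuclideanSpace ℝ (Fin n)) :
    J p (ofChart q W p) = ofChart q (fun y => J.inChart q y (W y)) p := by
  obtain ⟨y, hy, rfl⟩ : ∃ y ∈ (extChartAt (𝓡 n) q).target, (extChartAt (𝓡 n) q).symm y = p :=
    ⟨_, (extChartAt (𝓡 n) q).map_source hp, (extChartAt (𝓡 n) q).left_inv hp⟩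
  rw [ofChart_symm q _ hy, ofChart_symm q _ hy, J.chartInvDeriv_inChart hy]

/-- The vanishing of the Nijenhuis tensor, evaluated on the coordinate fields of a chart. -/
theorem IsIntegrable.inChart {J : EndField n M} (hJ : IsIntegrable J) {q : M}
    {y : EuclideanSpace ℝ (Fin n)} (hy : y ∈ (extChartAt (𝓡 n) q).target)
    (hs : ContDiffAt ℝ ∞ (J.inChart q) y) (a b : EuclideanSpace ℝ (Fin n)) :
    fderiv ℝ (J.inChart q) y (J.inChart q y a) b - fderiv ℝ (J.inChart q) y (J.inChart q y b) a
      + J.inChart q y (fderiv ℝ (J.inChart q) y b a)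
      - J.inChart q y (fderiv ℝ (J.inChart q) y a b) = 0 := by
  set c := extChartAt (𝓡 n) q with hc
  set p := c.symm y with hp'
  have hp : p ∈ c.source := c.map_target hy
  have hcp : c p = y := c.right_inv hy
  have hconst : ∀ a, ContDiffAt ℝ ∞ (fun _ : EuclideanSpace ℝ (Fin n) => a) (c p) :=
    fun a => contDiffAt_const (c := (a : EuclideanSpace ℝ (Fin n)))
  have hs' : ∀ a, ContDiffAt ℝ ∞ (fun z => J.inChart q z a) (c p) := fun a => by
    rw [hcp]; exact hs.clm_apply contDiffAt_const
  have hfd : ∀ a b, fderiv ℝ (fun z => J.inChart q z a) y b = fderiv ℝ (J.inChart q) y b a :=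
    fun a b => by
      rw [fderiv_clm_apply (hs.differentiableAt (by simp)) (differentiableAt_const a)]
      simp
  have hJe : ∀ a, (fun p => J p (ofChart q (fun _ => a) p)) =ᶠ[nhds p]
      ofChart q (fun z => J.inChart q z a) := by
    intro a
    filter_upwards [(isOpen_extChartAt_source q).mem_nhds hp] with x hx
    exact J.apply_ofChart hx _
  have h := hJ p (ofChart q fun _ => a) (ofChart q fun _ => b)
    (smoothFieldAt_ofChart hp (hconst a)) (smoothFieldAt_ofChart hp (hconst b))
  rw [(hJe a).mlieBracket_vectorField_eq (hJe b),
    (hJe a).mlieBracket_vectorField_eq (Filter.EventuallyEq.refl _ (ofChart q fun _ => b)),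
    (Filter.EventuallyEq.refl _ (ofChart q fun _ => a)).mlieBracket_vectorField_eq (hJe b),
    mlieBracket_ofChart hp (hs' a) (hs' b), mlieBracket_ofChart hp (hs' a) (hconst b),
    mlieBracket_ofChart hp (hconst a) (hs' b), mlieBracket_ofChart hp (hconst a) (hconst b),
    J.apply_ofChart hp, J.apply_ofChart hp, ofChart_symm q _ hy, ofChart_symm q _ hy,
    ofChart_symm q _ hy, ofChart_symm q _ hy, ← map_sub, ← map_sub, ← map_sub] at h
  have h2 := congrArg (mfderiv (𝓡 n) 𝓘(ℝ, EuclideanSpace ℝ (Fin n)) c (c.symm y)) h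
  rw [mfderiv_chartInvDeriv hy, map_zero] at h2
  simp only [lieBracket, hfd, fderiv_fun_const, Pi.zero_apply, zero_apply, sub_zero, zero_sub,
    map_neg, sub_neg_eq_add] at h2
  exact h2

end Charts

/-! ### The `SU(3)` structure on the quotient of `ℝ⁷` by a line -/

section FormFour

variable {E : Type*} [NormedAddCommGroup E] [NormedSpace ℝ E] (α : E [⋀^Fin 4]→L[ℝ] ℝ)

theorem form_four_swap₂₃ (n u v w : E) : α ![n, u, v, w] = -α ![n, v, u, w] :=
  form_swap₁₂ (α.curryLeft n) u v w

theorem form_four_swap₃₄ (n u v w : E) : α ![n, u, v, w] = -α ![n, u, w, v] :=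
  form_swap₂₃ (α.curryLeft n) u v w

theorem trilinear_curryLeft_apply (n u v w : E) :
    trilinear E (α.curryLeft n) u v w = α ![n, u, v, w] :=
  trilinear_apply _ _ _ _

end FormFour

section CrossProductAlgebra

variable {n u v w x : EuclideanSpace ℝ (Fin 7)}

theorem inner_cross_swap₁₂ (u v w : EuclideanSpace ℝ (Fin 7)) :
    inner ℝ (cross u v) w = -inner ℝ (cross v u) w := by
  rw [inner_cross, inner_cross, form_swap₁₂]

theorem inner_cross_swap₂₃ (u v w : EuclideanSpace ℝ (Fin 7)) :
    inner ℝ (cross u v) w = -inner ℝ (cross u w) v := by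
  rw [inner_cross, inner_cross, form_swap₂₃]

theorem inner_cross_left (u v : EuclideanSpace ℝ (Fin 7)) : inner ℝ (cross u v) u = 0 := by
  have h1 := inner_cross_swap₂₃ u v u
  have h2 := inner_cross_swap₁₂ u u v
  linarith

theorem inner_cross_right (u v : EuclideanSpace ℝ (Fin 7)) : inner ℝ (cross u v) v = 0 := by
  linarith [inner_cross_swap₂₃ u v v]

theorem inner_cross_cross_left (n v x : EuclideanSpace ℝ (Fin 7)) :
    inner ℝ (cross n v) (cross n x) = inner ℝ n n * inner ℝ v x - inner ℝ n x * inner ℝ v n := by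
  rw [inner_cross_cross, starPhi0.map_eq_zero_of_eq ![n, v, n, x] (i := 0) (j := 2) rfl (by decide),
    add_zero]

theorem cross_cross (hn : inner ℝ n n = (1 : ℝ)) (hx : inner ℝ x n = (0 : ℝ)) :
    cross n (cross n x) = -x := by
  refine ext_inner_right ℝ fun w => ?_
  rw [inner_cross_swap₂₃, inner_cross_cross_left, hn, inner_neg_left, real_inner_comm x n, hx,
    real_inner_comm]
  ring

/-- On the orthogonal complement of a unit vector `n`, the form `ι_n *φ` is of type
`(3, 0) + (0, 3)`, and is `φ` itself up to the complex structure `n × ·`. -/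
theorem starPhi0_cross (hn : inner ℝ n n = (1 : ℝ)) (hu : inner ℝ u n = (0 : ℝ))
    (hv : inner ℝ v n = (0 : ℝ)) (hw : inner ℝ w n = (0 : ℝ)) :
    starPhi0 ![n, cross n u, v, w] = -phi0 ![u, v, w] := by
  have h := inner_cross_cross n (cross n u) v w
  rw [cross_cross hn hu, inner_neg_left, real_inner_comm v n, hv, real_inner_comm w n, hw,
    real_inner_comm, inner_cross, form_swap₂₃, form_swap₁₂] at h
  linarith

theorem starPhi0_eq_inner (hv : inner ℝ v n = (0 : ℝ)) (hw : inner ℝ w n = (0 : ℝ)) :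
    starPhi0 ![n, u, v, w] = inner ℝ (cross v w) (cross n u) := by
  have h := inner_cross_cross n u v w
  rw [real_inner_comm v n, hv, real_inner_comm w n, hw, real_inner_comm] at h
  linarith

theorem bessel_two (hxy : inner ℝ u v = (0 : ℝ)) (huv : inner ℝ u u = (inner ℝ v v : ℝ)) :
    inner ℝ w u ^ 2 + inner ℝ w v ^ 2 ≤ (inner ℝ w w * inner ℝ u u : ℝ) := by
  set r : ℝ := inner ℝ u u with hr
  have h := real_inner_self_nonneg (x := r • w - (inner ℝ w u : ℝ) • u - (inner ℝ w v : ℝ) • v)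
  simp only [inner_sub_left, inner_sub_right, real_inner_smul_left, real_inner_smul_right,
    real_inner_comm u v, real_inner_comm w u, real_inner_comm w v, hxy, ← hr, ← huv] at h
  rcases eq_or_lt_of_le (real_inner_self_nonneg (x := u)) with h0 | h0
  · have hu : u = 0 := inner_self_eq_zero.mp h0.symm
    have hv : v = 0 := inner_self_eq_zero.mp (huv.symm.trans h0.symm)
    simp [hr, hu, hv]
  · have : 0 ≤ r * (inner ℝ w w * r - (inner ℝ w u ^ 2 + inner ℝ w v ^ 2)) := by nlinarith
    have := nonneg_of_mul_nonneg_right this h0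
    linarith

end CrossProductAlgebra

section SU3OfG2

variable {E : Type*} [NormedAddCommGroup E] [NormedSpace ℝ E] {g : E →L[ℝ] E →L[ℝ] ℝ}
  {J : E →L[ℝ] E} {β : E →L[ℝ] E →L[ℝ] E →L[ℝ] ℝ}

theorem exists_unit_orthogonal (n x y : EuclideanSpace ℝ (Fin 7)) :
    ∃ z : EuclideanSpace ℝ (Fin 7), inner ℝ z z = (1 : ℝ) ∧ inner ℝ z n = (0 : ℝ) ∧
      inner ℝ z x = (0 : ℝ) ∧ inner ℝ z y = (0 : ℝ) := by
  set K := Submodule.span ℝ (Set.range ![n, x, y]) with hK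
  have h1 : Module.finrank ℝ K ≤ 3 := (finrank_range_le_card _).trans (by simp)
  have h2 := K.finrank_add_finrank_orthogonal
  have h3 : Module.finrank ℝ (EuclideanSpace ℝ (Fin 7)) = 7 := by simp
  have h4 : 0 < Module.finrank ℝ Kᗮ := by omega
  have := Module.finrank_pos_iff.mp h4
  obtain ⟨⟨z, hz⟩, hz0⟩ := exists_ne (0 : Kᗮ)
  have hz0' : z ≠ 0 := fun h => hz0 (Subtype.ext h)
  have h5 : ∀ i, inner ℝ z (![n, x, y] i) = (0 : ℝ) := fun i => by
    rw [real_inner_comm]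
    exact (Submodule.mem_orthogonal _ _).mp hz _ (Submodule.subset_span ⟨i, rfl⟩)
  have h6 : ‖z‖ ≠ 0 := norm_ne_zero_iff.mpr hz0'
  refine ⟨‖z‖⁻¹ • z, ?_, ?_, ?_, ?_⟩
  · rw [real_inner_smul_left, real_inner_smul_right, real_inner_self_eq_norm_sq]
    field_simp
  · rw [real_inner_smul_left, show inner ℝ z n = (0 : ℝ) from h5 0, mul_zero]
  · rw [real_inner_smul_left, show inner ℝ z x = (0 : ℝ) from h5 1, mul_zero]
  · rw [real_inner_smul_left, show inner ℝ z y = (0 : ℝ) from h5 2, mul_zero]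

/-- An isometry of `E` onto the orthogonal complement of a unit vector `n` of `ℝ⁷` turns the data
`n × ·` and `ι_n *φ` into an `SU(3)` structure. -/
theorem isSU3_of_isometry (hE : Module.finrank ℝ E = 6) (f : E →ₗ[ℝ] EuclideanSpace ℝ (Fin 7))
    {n : EuclideanSpace ℝ (Fin 7)} {r : ℝ} (hn : inner ℝ n n = (1 : ℝ)) (hr : r ≠ 0)
    (hpos : ∀ a, a ≠ 0 → 0 < g a a) (hfn : ∀ a, inner ℝ (f a) n = (0 : ℝ))
    (hfg : ∀ a b, inner ℝ (f a) (f b) = g a b) (hJ : ∀ a b, g (J a) b = phi0 ![n, f a, f b])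
    (hβ : ∀ a b c, β a b c = r * starPhi0 ![n, f a, f b, f c]) : IsSU3 g J β (r ^ 2) := by
  have hinj : Function.Injective f := by
    refine (injective_iff_map_eq_zero f).mpr fun a ha => ?_
    by_contra h
    have := hpos a h
    rw [← hfg, ha, inner_zero_left] at this
    exact lt_irrefl _ this
  have hsurj : ∀ y : EuclideanSpace ℝ (Fin 7), inner ℝ y n = (0 : ℝ) → ∃ a, f a = y := by
    have hfin : FiniteDimensional ℝ E := Module.finite_of_finrank_pos (by omega)
    let F : E × ℝ →ₗ[ℝ] EuclideanSpace ℝ (Fin 7) :=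
      f.coprod (LinearMap.toSpanSingleton ℝ _ n)
    have hF : ∀ p, F p = f p.1 + p.2 • n := fun p => rfl
    have hFi : Function.Injective F := by
      refine (injective_iff_map_eq_zero F).mpr fun p hp => ?_
      rw [hF] at hp
      have h1 := congrArg (fun z => inner ℝ z n) hp
      simp only [inner_add_left, hfn, real_inner_smul_left, hn, inner_zero_left, zero_add,
        mul_one] at h1
      rw [h1, zero_smul, add_zero] at hp
      exact Prod.ext ((injective_iff_map_eq_zero f).mp hinj _ hp) h1
    have hFs : Function.Surjective F :=
      (LinearMap.injective_iff_surjective_of_finrank_eq_finrank (by simp [hE])).mp hFi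
    intro y hy
    obtain ⟨p, hp⟩ := hFs y
    rw [hF] at hp
    have h1 := congrArg (fun z => inner ℝ z n) hp
    simp only [inner_add_left, hfn, real_inner_smul_left, hn, zero_add, mul_one, hy] at h1
    exact ⟨p.1, by rw [← hp, h1, zero_smul, add_zero]⟩
  have hfJ : ∀ a, f (J a) = cross n (f a) := by
    intro a
    obtain ⟨c, hc⟩ := hsurj (cross n (f a)) (by rw [inner_cross_left])
    rw [← hc]
    refine congrArg f (sub_eq_zero.mp ?_)
    by_contra h
    have h1 := hpos _ h
    have h2 : ∀ b, g (J a - c) b = 0 := fun b => by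
      rw [map_sub, sub_apply, hJ, ← hfg c, hc, inner_cross, sub_self]
    rw [h2] at h1
    exact lt_irrefl _ h1
  have hβJ : ∀ a b c, β (J a) b c = -(r * phi0 ![f a, f b, f c]) := by
    intro a b c
    rw [hβ, hfJ, starPhi0_cross hn (hfn a) (hfn b) (hfn c)]
    ring
  have hsw₁₂ : ∀ a b c, β a b c = -β b a c := by
    intro a b c
    rw [hβ, hβ, form_four_swap₂₃]
    ring
  have hsw₂₃ : ∀ a b c, β a b c = -β a c b := by
    intro a b c
    rw [hβ, hβ, form_four_swap₃₄]
    ring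
  have hhad : ∀ a b c, β a b c ^ 2 + β (J a) b c ^ 2 ≤ r ^ 2 * (g a a * g b b * g c c) := by
    intro a b c
    have h1 : β a b c = r * inner ℝ (cross (f b) (f c)) (cross n (f a)) := by
      rw [hβ, starPhi0_eq_inner (hfn b) (hfn c)]
    have h2 : β (J a) b c = -(r * inner ℝ (cross (f b) (f c)) (f a)) := by
      rw [hβJ, inner_cross, form_swap₁₂, form_swap₂₃]
      ring
    have h3 := bessel_two (w := cross (f b) (f c)) (u := f a) (v := cross n (f a))
      (by rw [real_inner_comm, inner_cross_right])
      (by rw [inner_cross_cross_left, hn, hfn]; ring)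
    have h4 : inner ℝ (cross (f b) (f c)) (cross (f b) (f c)) ≤ (g b b * g c c : ℝ) := by
      rw [inner_cross_cross_left, hfg, hfg, hfg, hfg]
      have : g b c = g c b := by rw [← hfg, real_inner_comm, hfg]
      rw [this]
      linarith [mul_self_nonneg (g c b)]
    have h5 : 0 ≤ g a a := by rw [← hfg]; exact real_inner_self_nonneg
    rw [h1, h2]
    rw [hfg a a] at h3
    have h6 := mul_le_mul_of_nonneg_right h4 h5
    have h7 := mul_le_mul_of_nonneg_left (h3.trans h6) (sq_nonneg r)
    nlinarith
  refine
    { symm := fun a b => by rw [← hfg, real_inner_comm, hfg]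
      pos := hpos
      J_sq := fun a => hinj (by rw [hfJ, hfJ, cross_cross hn (hfn a), map_neg])
      skew := fun a b => by
        rw [← hfg, ← hfg, hfJ, hfJ, inner_cross_swap₂₃, real_inner_comm]
      swap₁₂ := hsw₁₂
      swap₂₃ := hsw₂₃
      type := fun a b c => by
        rw [hβJ, hsw₁₂, hβJ, form_swap₁₂]
        ring
      norm_pos := by positivity
      hadamard := hhad
      exists_frame := fun a ha => ?_ }
  -- a unitary frame `a, b, c` with `f c = f a × f b`, where `b` is orthogonal to `a` and `J a`
  obtain ⟨y, hyy, hyn, hyx, hyJ⟩ := exists_unit_orthogonal n (f a) (cross n (f a))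
  obtain ⟨b, rfl⟩ := hsurj y hyn
  have hcn : inner ℝ (cross (f a) (f b)) n = (0 : ℝ) := by
    rw [inner_cross_swap₂₃, inner_cross_swap₁₂, real_inner_comm, hyJ]
    simp
  obtain ⟨c, hc⟩ := hsurj _ hcn
  have hgab : g b a = 0 := by rw [← hfg, hyx]
  have hsymm : ∀ a b, g a b = g b a := fun a b => by rw [← hfg, real_inner_comm, hfg]
  have hskew : ∀ a b, g (J a) b = -g (J b) a := fun a b => by
    rw [← hfg, ← hfg, hfJ, hfJ, inner_cross_swap₂₃]
  have hself : ∀ a, g (J a) a = 0 := fun a => by linarith [hskew a a]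
  have hca : g c a = 0 := by rw [← hfg, hc, inner_cross_left]
  have hcb : g c b = 0 := by rw [← hfg, hc, inner_cross_right]
  have haa : inner ℝ (f a) (f a) = (1 : ℝ) := by rw [hfg, ha]
  have hbb : g b b = 1 := by rw [← hfg, hyy]
  have hcc : g c c = 1 := by
    rw [← hfg, hc, inner_cross_cross_left, haa, hyy, hyx]
    ring
  have hJab : g (J a) b = 0 := by rw [← hfg, hfJ, real_inner_comm, hyJ]
  have hJac : g (J a) c = 0 := by
    rw [← hfg, hfJ, hc, inner_cross_swap₁₂, inner_cross_cross_left, real_inner_comm (f b) n, hyn,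
      real_inner_comm (f a) n, hfn]
    ring
  have hJbc : g (J b) c = 0 := by
    rw [← hfg, hfJ, hc, inner_cross_swap₁₂, inner_cross_swap₁₂, neg_neg]
    have h1 : inner ℝ (cross n (f b)) (cross (f a) (f b)) =
        (inner ℝ (cross (f b) n) (cross (f b) (f a)) : ℝ) := by
      rw [inner_cross_swap₁₂, real_inner_comm, inner_cross_swap₁₂, real_inner_comm, neg_neg]
    rw [h1, inner_cross_cross_left, real_inner_comm (f b) n, hyn, real_inner_comm (f a) n, hfn]
    ring
  refine ⟨![a, b, c], rfl, ⟨fun i j => ?_, fun i j => ?_⟩, ?_⟩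
  · fin_cases i <;> fin_cases j <;>
      simp [ha, hgab, hca, hcb, hcc, hsymm a b, hsymm a c, hsymm b c, hbb]
  · fin_cases i <;> fin_cases j <;>
      simp [hself, hJab, hJac, hJbc, hskew b a, hskew c a, hskew c b]
  · have h1 := hhad a b c
    have h2 : β (J a) b c = -r := by
      rw [hβJ, hc, ← inner_cross, ← hc, hfg, hcc, mul_one]
    rw [h2, ha, ← hfg b b, hyy, hcc] at h1
    change β a b c ^ 2 + β (J a) b c ^ 2 = r ^ 2
    rw [h2]
    nlinarith [sq_nonneg (β a b c)]

/-- The `SU(3)` structure on a 6-dimensional quotient of `ℝ⁷` by the line of a vector `v`, seen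
through a section `B` of the quotient map: the quotient metric is `t g` with `t = |v|⁻¹`. -/
theorem isSU3_of_section (hE : Module.finrank ℝ E = 6) (B : E →ₗ[ℝ] EuclideanSpace ℝ (Fin 7))
    {v : EuclideanSpace ℝ (Fin 7)} {t : ℝ} (ht : 0 < t) (hv : t ^ 2 * inner ℝ v v = (1 : ℝ))
    (hpos : ∀ a, a ≠ 0 → 0 < g a a)
    (hg : ∀ a b, inner ℝ (B a) (B b) = t * g a b + t ^ 2 * (inner ℝ (B a) v * inner ℝ (B b) v))
    (hJ : ∀ a b, g (J a) b = phi0 ![v, B a, B b])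
    (hβ : ∀ a b c, β a b c = starPhi0 ![v, B a, B b, B c]) : IsSU3 g J β t := by
  obtain ⟨n, hn⟩ : ∃ n, n = t • v := ⟨_, rfl⟩
  obtain ⟨s, hs0, hs⟩ : ∃ s : ℝ, 0 < s ∧ s ^ 2 = t :=
    ⟨√t, Real.sqrt_pos.mpr ht, Real.sq_sqrt ht.le⟩
  have hnn : inner ℝ n n = (1 : ℝ) := by
    rw [hn, real_inner_smul_left, real_inner_smul_right, ← hv]
    ring
  -- the orthogonal projection of `B` to the complement of `n`, rescaled to an isometry
  let f : E →ₗ[ℝ] EuclideanSpace ℝ (Fin 7) :=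
    s⁻¹ • (B - (LinearMap.toSpanSingleton ℝ _ n).comp
      ((innerSL ℝ n : EuclideanSpace ℝ (Fin 7) →L[ℝ] ℝ).toLinearMap.comp B))
  have hf : ∀ a, f a = s⁻¹ • (B a - (inner ℝ n (B a) : ℝ) • n) := fun a => rfl
  have hB : ∀ a, B a = s • f a + (inner ℝ n (B a) : ℝ) • n := fun a => by
    rw [hf, smul_smul, mul_inv_cancel₀ hs0.ne', one_smul, sub_add_cancel]
  have hvn : v = t⁻¹ • n := by rw [hn, smul_smul, inv_mul_cancel₀ ht.ne', one_smul]
  have h3 : ∀ x y, phi0 ![v, B x, B y] = phi0 ![n, f x, f y] := by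
    intro x y
    rw [← trilinear_apply, ← trilinear_apply, hvn, hB x, hB y]
    have h1 : ∀ y, trilinear _ phi0 n n y = 0 := fun y => by rw [trilinear_apply, form_self₁₂]
    have h2 : ∀ y, trilinear _ phi0 n y n = 0 := fun y => by
      rw [trilinear_apply, form_swap₂₃, form_self₁₂, neg_zero]
    simp only [map_add, map_smul, add_apply, smul_apply, h1, h2, smul_eq_mul]
    rw [← hs]
    field_simp
    ring
  have h4 : ∀ x y z, starPhi0 ![v, B x, B y, B z] = s * starPhi0 ![n, f x, f y, f z] := by
    intro x y z
    have e : starPhi0.curryLeft v = t⁻¹ • starPhi0.curryLeft n := by rw [hvn, map_smul]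
    rw [← trilinear_curryLeft_apply, ← trilinear_curryLeft_apply, e, map_smul]
    have h1 : ∀ y z, trilinear _ (starPhi0.curryLeft n) n y z = 0 := fun y z => by
      rw [trilinear_curryLeft_apply]
      exact starPhi0.map_eq_zero_of_eq _ (i := 0) (j := 1) rfl (by decide)
    have h2 : ∀ y z, trilinear _ (starPhi0.curryLeft n) y n z = 0 := fun y z => by
      rw [trilinear_curryLeft_apply]
      exact starPhi0.map_eq_zero_of_eq _ (i := 0) (j := 2) rfl (by decide)
    have h3 : ∀ y z, trilinear _ (starPhi0.curryLeft n) y z n = 0 := fun y z => by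
      rw [trilinear_curryLeft_apply]
      exact starPhi0.map_eq_zero_of_eq _ (i := 0) (j := 3) rfl (by decide)
    rw [hB x, hB y, hB z]
    simp only [map_add, map_smul, add_apply, smul_apply, h1, h2, h3, smul_eq_mul]
    rw [← hs]
    field_simp
    ring
  have hnB : ∀ a, inner ℝ n (B a) = (t * inner ℝ (B a) v : ℝ) := fun a => by
    rw [hn, real_inner_smul_left, real_inner_comm]
  rw [← hs]
  refine isSU3_of_isometry hE f hnn hs0.ne' hpos (fun a => ?_) (fun a b => ?_)
    (fun a b => by rw [hJ, h3]) (fun a b c => by rw [hβ, h4])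
  · rw [hf, real_inner_smul_left, inner_sub_left, real_inner_smul_left, hnn,
      real_inner_comm n (B a)]
    ring
  · have h5 : inner ℝ (f a) (f b) = (s⁻¹ ^ 2 * (inner ℝ (B a) (B b) -
        inner ℝ n (B a) * inner ℝ n (B b)) : ℝ) := by
      simp only [hf, real_inner_smul_left, real_inner_smul_right, inner_sub_left, inner_sub_right,
        hnn, real_inner_comm n (B a)]
      ring
    rw [h5, hg, hnB, hnB, ← hs]
    field_simp
    ring

end SU3OfG2

/-! ### Contraction and pullback of forms on manifolds -/

section FormSmoothness

variable {E X : Type*} [NormedAddCommGroup E] [NormedSpace ℝ E] [NormedAddCommGroup X]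
  [NormedSpace ℝ X] {x : X}

theorem contDiffAt_curryLeft {k : ℕ} {α : X → E [⋀^Fin (k + 1)]→L[ℝ] ℝ} {W : X → E}
    (hα : ContDiffAt ℝ ∞ α x) (hW : ContDiffAt ℝ ∞ W x) :
    ContDiffAt ℝ ∞ (fun z => (α z).curryLeft (W z)) x :=
  (((ContinuousAlternatingMap.curryLeftLI (𝕜 := ℝ) (E := E) (F := ℝ)
    (n := k)).toContinuousLinearMap.contDiff.contDiffAt).comp x hα).clm_apply hW

theorem contDiffAt_form_eval {k : ℕ} {α : X → E [⋀^Fin k]→L[ℝ] ℝ} {v : Fin k → X → E}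
    (hα : ContDiffAt ℝ ∞ α x) (hv : ∀ i, ContDiffAt ℝ ∞ (v i) x) :
    ContDiffAt ℝ ∞ (fun y => α y fun i => v i y) x := by
  induction k with
  | zero =>
    have : (fun y => α y fun i => v i y) = fun y => α y ![] :=
      funext fun y => congrArg (α y) (Subsingleton.elim _ _)
    rw [this]
    exact (contDiff_form_apply _).contDiffAt.comp x hα
  | succ k ih =>
    have h := ih (α := fun y => (α y).curryLeft (v 0 y)) (v := fun i => v i.succ)
      (contDiffAt_curryLeft hα (hv 0)) fun i => hv _
    refine h.congr_of_eventuallyEq (Filter.Eventually.of_forall fun y => ?_)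
    refine congrArg (α y) (funext fun i => ?_)
    refine Fin.cases ?_ (fun j => ?_) i <;> rfl

end FormSmoothness

section Interior

variable {n : ℕ} {M : Type*} [TopologicalSpace M] [ChartedSpace (EuclideanSpace ℝ (Fin n)) M]
  [IsManifold (𝓡 n) ∞ M]

/-- The contraction `ι_V α` of a form with a vector field. -/
def DForm.interior {k : ℕ} (α : DForm n M (k + 1)) (V : VField n M) : DForm n M k := fun p =>
  ContinuousAlternatingMap.curryLeft (E := EuclideanSpace ℝ (Fin n)) (α p) (V p)

theorem DForm.interior_inChart {k : ℕ} (α : DForm n M (k + 1)) (V : VField n M) {q : M}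
    {y : EuclideanSpace ℝ (Fin n)} (hy : y ∈ (extChartAt (𝓡 n) q).target) :
    (α.interior V).inChart q y = (α.inChart q y).curryLeft (V.inChart q y) := by
  ext v
  refine congrArg (α ((extChartAt (𝓡 n) q).symm y)) (funext fun i => ?_)
  refine Fin.cases ?_ (fun j => ?_) i
  · exact (chartInvDeriv_inChart V hy).symm
  · rfl

theorem DForm.Smooth.interior {k : ℕ} {α : DForm n M (k + 1)} {V : VField n M} (hα : α.Smooth)
    (hV : ∀ p, SmoothFieldAt V p) : (α.interior V).Smooth := by
  intro q
  refine ContDiffOn.congr (fun y hy => ?_) fun y hy => α.interior_inChart V hy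
  exact (contDiffAt_curryLeft (hα.contDiffAt hy) ((V.contDiffOn_inChart hV q).contDiffAt
    ((isOpen_extChartAt_target q).mem_nhds hy))).contDiffWithinAt

theorem DForm.extDeriv_interior_eq_zero {k : ℕ} {α : DForm n M (k + 1)} {V : VField n M}
    (hα : α.Smooth) (hV : ∀ p, SmoothFieldAt V p) (hd : α.d = 0) (q : M)
    (hL : LieDerivEqZero (α.inChart q) (V.inChart q) (extChartAt (𝓡 n) q q)) :
    extDeriv ((α.interior V).inChart q) (extChartAt (𝓡 n) q q) = 0 := by
  have hy : extChartAt (𝓡 n) q q ∈ (extChartAt (𝓡 n) q).target := mem_extChartAt_target q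
  have hn := (isOpen_extChartAt_target (I := 𝓡 n) q).mem_nhds hy
  have h1 : (α.interior V).inChart q =ᶠ[nhds (extChartAt (𝓡 n) q q)]
      fun z => (α.inChart q z).curryLeft (V.inChart q z) := by
    filter_upwards [hn] with z hz
    exact α.interior_inChart V hz
  rw [h1.extDeriv_eq]
  exact extDeriv_curryLeft_eq_zero ((hα.contDiffAt hy).differentiableAt (by simp))
    (((V.contDiffOn_inChart hV q).contDiffAt hn).differentiableAt (by simp))
    (DForm.extDeriv_inChart_eq_zero hd q) hL

/-- The expression in the preferred chart at `q` of a map from a vector space to `M`. -/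
def mapInChart {m : ℕ} (f : EuclideanSpace ℝ (Fin m) → M) (q : M) (w : EuclideanSpace ℝ (Fin m)) :
    EuclideanSpace ℝ (Fin n) :=
  extChartAt (𝓡 n) q (f w)

variable {m : ℕ} {f : EuclideanSpace ℝ (Fin m) → M} {z : EuclideanSpace ℝ (Fin m)}

theorem contDiffAt_mapInChart (hf : ContMDiffAt (𝓡 m) (𝓡 n) ∞ f z) {q : M}
    (hq : f z ∈ (extChartAt (𝓡 n) q).source) : ContDiffAt ℝ ∞ (mapInChart (n := n) f q) z :=
  ((contMDiffAt_extChartAt' (n := ∞) (by simpa using hq)).comp z hf).contDiffAt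

theorem fderiv_mapInChart (hf : MDifferentiableAt (𝓡 m) (𝓡 n) f z) {q : M}
    (hq : f z ∈ (extChartAt (𝓡 n) q).source) (a : EuclideanSpace ℝ (Fin m)) :
    fderiv ℝ (mapInChart f q) z a =
      mfderiv (𝓡 n) 𝓘(ℝ, EuclideanSpace ℝ (Fin n)) (extChartAt (𝓡 n) q) (f z)
        (mfderiv (𝓡 m) (𝓡 n) f z a) := by
  have h := mfderiv_comp (I := 𝓡 m) (I' := 𝓡 n) (I'' := 𝓘(ℝ, EuclideanSpace ℝ (Fin n))) z
    (mdifferentiableAt_extChartAt (I := 𝓡 n) (by simpa using hq)) hf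
  refine Eq.trans ?_ (DFunLike.congr_fun h a)
  exact congrArg (fun f : EuclideanSpace ℝ (Fin m) →L[ℝ] EuclideanSpace ℝ (Fin n) => f a)
    mfderiv_eq_fderiv.symm

/-- The pullback of a form on `M` by a map from a vector space to `M`. -/
def DForm.pullback {k : ℕ} (α : DForm n M k) (f : EuclideanSpace ℝ (Fin m) → M)
    (z : EuclideanSpace ℝ (Fin m)) : EuclideanSpace ℝ (Fin m) [⋀^Fin k]→L[ℝ] ℝ :=
  (α (f z)).compContinuousLinearMap (mfderiv (𝓡 m) (𝓡 n) f z)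

theorem DForm.apply_eq_inChart {k : ℕ} (α : DForm n M k) {q p : M}
    (hp : p ∈ (extChartAt (𝓡 n) q).source) (u : Fin k → TangentSpace (𝓡 n) p) :
    α p u = α.inChart q (extChartAt (𝓡 n) q p)
      fun i => mfderiv (𝓡 n) 𝓘(ℝ, EuclideanSpace ℝ (Fin n)) (extChartAt (𝓡 n) q) p (u i) := by
  obtain ⟨y, hy, rfl⟩ : ∃ y ∈ (extChartAt (𝓡 n) q).target, (extChartAt (𝓡 n) q).symm y = p :=
    ⟨_, (extChartAt (𝓡 n) q).map_source hp, (extChartAt (𝓡 n) q).left_inv hp⟩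
  refine Eq.trans ?_ (congrArg (fun y' => α.inChart q y' fun i => mfderiv (𝓡 n)
    𝓘(ℝ, EuclideanSpace ℝ (Fin n)) (extChartAt (𝓡 n) q) ((extChartAt (𝓡 n) q).symm y) (u i))
      ((extChartAt (𝓡 n) q).right_inv hy).symm)
  exact congrArg (α ((extChartAt (𝓡 n) q).symm y))
    (funext fun i => (chartInvDeriv_mfderiv hy (u i)).symm)

theorem DForm.pullback_eq {k : ℕ} (α : DForm n M k) (hf : MDifferentiableAt (𝓡 m) (𝓡 n) f z)
    {q : M} (hq : f z ∈ (extChartAt (𝓡 n) q).source) :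
    α.pullback f z =
      (α.inChart q (mapInChart f q z)).compContinuousLinearMap (fderiv ℝ (mapInChart f q) z) := by
  ext v
  refine (α.apply_eq_inChart hq _).trans ?_
  exact congrArg (α.inChart q (mapInChart f q z))
    (funext fun i => (fderiv_mapInChart hf hq (v i)).symm)

theorem eventually_mdifferentiableAt (hf : ContMDiffAt (𝓡 m) (𝓡 n) ∞ f z) :
    ∀ᶠ w in nhds z, MDifferentiableAt (𝓡 m) (𝓡 n) f w ∧
      f w ∈ (extChartAt (𝓡 n) (f z)).source := by
  have h1 := (contMDiffAt_iff_contMDiffAt_nhds (n := 1) (by simp)).mp (hf.of_le (by simp))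
  have h2 := hf.continuousAt.eventually (extChartAt_source_mem_nhds (I := 𝓡 n) (f z))
  filter_upwards [h1, h2] with w hw hw'
  exact ⟨hw.mdifferentiableAt (by simp), hw'⟩

theorem DForm.pullback_eventuallyEq {k : ℕ} (α : DForm n M k)
    (hf : ContMDiffAt (𝓡 m) (𝓡 n) ∞ f z) :
    α.pullback f =ᶠ[nhds z] fun w => (α.inChart (f z) (mapInChart f (f z) w)
      ).compContinuousLinearMap (fderiv ℝ (mapInChart f (f z)) w) := by
  filter_upwards [eventually_mdifferentiableAt hf] with w hw
  exact α.pullback_eq hw.1 hw.2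

theorem DForm.Smooth.contDiffAt_pullback {k : ℕ} {α : DForm n M k} (hα : α.Smooth)
    (hf : ContMDiffAt (𝓡 m) (𝓡 n) ∞ f z) : ContDiffAt ℝ ∞ (α.pullback f) z := by
  refine ContDiffAt.congr_of_eventuallyEq (contDiffAt_form fun I => ?_)
    (α.pullback_eventuallyEq hf)
  have hF := contDiffAt_mapInChart hf (mem_extChartAt_source (I := 𝓡 n) (f z))
  have h1 : ContDiffAt ℝ ∞ (fun w => α.inChart (f z) (mapInChart f (f z) w)) z :=
    ContDiffAt.comp (g := α.inChart (f z)) (f := mapInChart f (f z)) z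
      (hα.contDiffAt (mem_extChartAt_target (I := 𝓡 n) (f z))) hF
  exact contDiffAt_form_eval h1 (v := fun i w => fderiv ℝ (mapInChart f (f z)) w
    (EuclideanSpace.single (I i) 1)) fun i =>
      (hF.fderiv_right (m := ∞) (by simp)).clm_apply contDiffAt_const

theorem DForm.extDeriv_pullback_eq_zero {k : ℕ} {α : DForm n M k} (hα : α.Smooth)
    (hf : ContMDiffAt (𝓡 m) (𝓡 n) ∞ f z)
    (hd : extDeriv (α.inChart (f z)) (extChartAt (𝓡 n) (f z) (f z)) = 0) :
    extDeriv (α.pullback f) z = 0 := by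
  rw [(α.pullback_eventuallyEq hf).extDeriv_eq]
  have hF := contDiffAt_mapInChart hf (mem_extChartAt_source (I := 𝓡 n) (f z))
  have h1 : ContDiffAt ℝ ∞ (α.inChart (f z)) (mapInChart f (f z) z) :=
    hα.contDiffAt (mem_extChartAt_target (I := 𝓡 n) (f z))
  rw [extDeriv_pullback (f := mapInChart f (f z)) (r := ∞) (h1.differentiableAt (by simp)) hF
    (by simpa using two_le_infty)]
  ext v
  exact congrArg (fun β : EuclideanSpace ℝ (Fin n) [⋀^Fin (k + 1)]→L[ℝ] ℝ =>
    β.compContinuousLinearMap (fderiv ℝ (mapInChart f (f z)) z) v) hd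

end Interior

/-! ### Symmetries of a torsion-free `G₂` structure -/

section G2Charts

variable {Y : Type*} [TopologicalSpace Y] [ChartedSpace (EuclideanSpace ℝ (Fin 7)) Y]
  {φ : DForm 7 Y 3} (hφ : IsAdmissible φ)

theorem eq_phi0_comp_g2Frame (p : Y) : φ p = phi0.compContinuousLinearMap
    (g2Frame hφ p : TangentSpace (𝓡 7) p →L[ℝ] EuclideanSpace ℝ (Fin 7)) :=
  Classical.choose_spec (hφ p)

variable [IsManifold (𝓡 7) ∞ Y]

/-- The frame `g2Frame` in the coordinates of the preferred chart at `q`. -/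
def frameInChart (q : Y) (y : EuclideanSpace ℝ (Fin 7)) (hy : y ∈ (extChartAt (𝓡 7) q).target) :
    EuclideanSpace ℝ (Fin 7) ≃L[ℝ] EuclideanSpace ℝ (Fin 7) :=
  (chartInvEquiv q y hy).trans (g2Frame hφ ((extChartAt (𝓡 7) q).symm y))

theorem inChart_eq_phi0_comp {q : Y} {y : EuclideanSpace ℝ (Fin 7)}
    (hy : y ∈ (extChartAt (𝓡 7) q).target) : φ.inChart q y = phi0.compContinuousLinearMap
      (frameInChart hφ q y hy : EuclideanSpace ℝ (Fin 7) →L[ℝ] EuclideanSpace ℝ (Fin 7)) := by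
  rw [DForm.inChart, eq_phi0_comp_g2Frame hφ]
  rfl

theorem starPhi_inChart_eq {q : Y} {y : EuclideanSpace ℝ (Fin 7)}
    (hy : y ∈ (extChartAt (𝓡 7) q).target) :
    (starPhi hφ).inChart q y = starPhi0.compContinuousLinearMap
      (frameInChart hφ q y hy : EuclideanSpace ℝ (Fin 7) →L[ℝ] EuclideanSpace ℝ (Fin 7)) := rfl

theorem starPhi_smooth (hs : φ.Smooth) : (starPhi hφ).Smooth := by
  obtain ⟨S, hS⟩ := exists_smooth_star
  intro q
  refine ContDiffOn.congr (f := fun y => S (φ.inChart q y)) (fun y hy => ?_) fun y hy => ?_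
  · have h1 := (hS (frameInChart hφ q y hy)).2
    rw [← inChart_eq_phi0_comp hφ hy] at h1
    exact (h1.comp y (hs.contDiffAt hy)).contDiffWithinAt
  · rw [inChart_eq_phi0_comp hφ hy, (hS _).1, starPhi_inChart_eq]

variable {V : VField 7 Y}

/-- A symmetry of `φ` is a symmetry of `*φ`. -/
theorem starPhi_lieDerivEqZero (hs : φ.Smooth) (hV : IsNonvanishingSymmetry φ V) (q : Y) :
    LieDerivEqZero ((starPhi hφ).inChart q) (V.inChart q) (extChartAt (𝓡 7) q q) := by
  have hy : extChartAt (𝓡 7) q q ∈ (extChartAt (𝓡 7) q).target := mem_extChartAt_target q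
  refine LieDerivEqZero.star ((hs.contDiffAt hy).differentiableAt (by simp))
    (((starPhi_smooth hφ hs).contDiffAt hy).differentiableAt (by simp)) ?_
    (hV.invariant.lieDerivEqZero hs hV.smooth q)
  filter_upwards [(isOpen_extChartAt_target (I := 𝓡 7) q).mem_nhds hy] with z hz
  exact ⟨frameInChart hφ q z hz, inChart_eq_phi0_comp hφ hz, starPhi_inChart_eq hφ hz⟩

variable {m : ℕ} {f : EuclideanSpace ℝ (Fin m) → Y} {z : EuclideanSpace ℝ (Fin m)}

theorem extDeriv_pullback_interior_phi (hs : φ.Smooth) (ht : IsTorsionFree hφ)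
    (hV : IsNonvanishingSymmetry φ V) (hf : ContMDiffAt (𝓡 m) (𝓡 7) ∞ f z) :
    extDeriv ((DForm.interior φ V).pullback f) z = 0 :=
  DForm.extDeriv_pullback_eq_zero (hs.interior hV.smooth) hf
    (DForm.extDeriv_interior_eq_zero hs hV.smooth ht.1 _
      (hV.invariant.lieDerivEqZero hs hV.smooth _))

theorem extDeriv_pullback_interior_starPhi (hs : φ.Smooth) (ht : IsTorsionFree hφ)
    (hV : IsNonvanishingSymmetry φ V) (hf : ContMDiffAt (𝓡 m) (𝓡 7) ∞ f z) :
    extDeriv ((DForm.interior (starPhi hφ) V).pullback f) z = 0 :=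
  DForm.extDeriv_pullback_eq_zero ((starPhi_smooth hφ hs).interior hV.smooth) hf
    (DForm.extDeriv_interior_eq_zero (starPhi_smooth hφ hs) hV.smooth ht.2 _
      (starPhi_lieDerivEqZero hφ hs hV _))

theorem g2Metric_inChart {q : Y} {y : EuclideanSpace ℝ (Fin 7)}
    (hy : y ∈ (extChartAt (𝓡 7) q).target) :
    g2Metric hφ ((extChartAt (𝓡 7) q).symm y) (V ((extChartAt (𝓡 7) q).symm y))
      (V ((extChartAt (𝓡 7) q).symm y)) =
        ∑ i, ∑ j, gramOfForm (φ.inChart q y) i j * V.inChart q y i * V.inChart q y j := by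
  rw [inChart_eq_phi0_comp hφ hy]
  simp only [gramOfForm_comp_apply]
  set A := frameInChart hφ q y hy with hA
  have h1 : g2Frame hφ ((extChartAt (𝓡 7) q).symm y) (V ((extChartAt (𝓡 7) q).symm y)) =
      A (V.inChart q y) :=
    congrArg (g2Frame hφ ((extChartAt (𝓡 7) q).symm y)) (chartInvDeriv_inChart V hy).symm
  have h2 : A (V.inChart q y) = ∑ i, V.inChart q y i • A (EuclideanSpace.single i (1 : ℝ)) := by
    conv_lhs => rw [← (EuclideanSpace.basisFun (Fin 7) ℝ).sum_repr (V.inChart q y)]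
    simp
  rw [g2Metric, h1, h2]
  simp only [sum_inner, inner_sum, real_inner_smul_left, real_inner_smul_right]
  exact Finset.sum_congr rfl fun i _ => Finset.sum_congr rfl fun j _ => by
    rw [real_inner_comm]; ring

theorem contDiffAt_g2Metric (hs : φ.Smooth) (hV : ∀ p, SmoothFieldAt V p)
    (hf : ContMDiffAt (𝓡 m) (𝓡 7) ∞ f z) :
    ContDiffAt ℝ ∞ (fun w => g2Metric hφ (f w) (V (f w)) (V (f w))) z := by
  set q := f z with hq
  have hF := contDiffAt_mapInChart hf (mem_extChartAt_source (I := 𝓡 7) (f z))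
  have hy : extChartAt (𝓡 7) q q ∈ (extChartAt (𝓡 7) q).target := mem_extChartAt_target q
  have h1 : ContDiffAt ℝ ∞ (fun y => ∑ i, ∑ j,
      gramOfForm (φ.inChart q y) i j * V.inChart q y i * V.inChart q y j) (mapInChart f q z) := by
    have h2 := (V.contDiffOn_inChart hV q).contDiffAt
      ((isOpen_extChartAt_target (I := 𝓡 7) q).mem_nhds hy)
    have h3 : ∀ i, ContDiffAt ℝ ∞ (fun y => V.inChart q y i) (extChartAt (𝓡 7) q q) := fun i =>
      (EuclideanSpace.proj (𝕜 := ℝ) i).contDiff.contDiffAt.comp _ h2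
    have h4 : ∀ i j, ContDiffAt ℝ ∞ (fun y => gramOfForm (φ.inChart q y) i j)
        (extChartAt (𝓡 7) q q) := by
      intro i j
      have h5 := contDiffAt_gramOfForm (frameInChart hφ q _ hy) i j
      rw [← inChart_eq_phi0_comp hφ hy] at h5
      exact h5.comp (f := φ.inChart q) _ (hs.contDiffAt hy)
    exact ContDiffAt.sum fun i _ => ContDiffAt.sum fun j _ => ((h4 i j).mul (h3 i)).mul (h3 j)
  refine (h1.comp z hF).congr_of_eventuallyEq ?_
  filter_upwards [eventually_mdifferentiableAt hf] with w hw
  have h6 := g2Metric_inChart hφ (V := V) ((extChartAt (𝓡 7) q).map_source hw.2)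
  rw [(extChartAt (𝓡 7) q).left_inv hw.2] at h6
  exact h6

end G2Charts

/-! ### Local sections of submersions -/

section LocalSections

/-- A smooth map has a smooth local right inverse at a point where its differential is surjective. -/
theorem exists_smooth_rightInverse {E F : Type*} [NormedAddCommGroup E] [NormedSpace ℝ E]
    [NormedAddCommGroup F] [NormedSpace ℝ F] [FiniteDimensional ℝ F] {P : E → F} {O : Set E}
    (hO : IsOpen O) (hP : ContDiffOn ℝ ∞ P O) {a : E} (ha : a ∈ O)
    (hs : Function.Surjective (fderiv ℝ P a)) :
    ∃ (U : Set F) (s : F → E), IsOpen U ∧ P a ∈ U ∧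
      ∀ w ∈ U, ContDiffAt ℝ ∞ s w ∧ s w ∈ O ∧ P (s w) = w := by
  have hcF : CompleteSpace F := FiniteDimensional.complete ℝ F
  obtain ⟨L₀, hL₀⟩ := (fderiv ℝ P a).toLinearMap.exists_rightInverse_of_surjective
    (LinearMap.range_eq_top.mpr hs)
  set L : F →L[ℝ] E := LinearMap.toContinuousLinearMap L₀ with hL
  have hLr : ∀ w, fderiv ℝ P a (L w) = w := fun w => LinearMap.congr_fun hL₀ w
  set A : F → E := fun w => a + L (w - P a) with hA
  have hAd : ContDiff ℝ ∞ A :=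
    contDiff_const.add (L.contDiff.comp (contDiff_id.sub contDiff_const))
  have hAa : A (P a) = a := by simp [hA]
  set O' := A ⁻¹' O with hO'
  have hO'o : IsOpen O' := hO.preimage hAd.continuous
  have hmem : P a ∈ O' := by rw [hO', Set.mem_preimage, hAa]; exact ha
  set G : F → F := fun w => P (A w) with hG
  have hGd : ContDiffOn ℝ ∞ G O' := hP.comp hAd.contDiffOn fun w hw => hw
  have hGat : ∀ w ∈ O', ContDiffAt ℝ ∞ G w := fun w hw => hGd.contDiffAt (hO'o.mem_nhds hw)
  have hGa : G (P a) = P a := by simp only [hG, hAa]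
  have hG' : HasFDerivAt G ((ContinuousLinearEquiv.refl ℝ F : F ≃L[ℝ] F) : F →L[ℝ] F) (P a) := by
    have h1 : HasFDerivAt A L (P a) :=
      (L.hasFDerivAt.comp (f := fun w => w - P a) (P a)
        ((hasFDerivAt_id (P a)).sub_const (P a))).const_add a
    have h2 : HasFDerivAt P (fderiv ℝ P a) (A (P a)) := by
      rw [hAa]
      exact ((hP.contDiffAt (hO.mem_nhds ha)).differentiableAt (by simp)).hasFDerivAt
    have h3 := h2.comp (P a) h1
    have h4 : (fderiv ℝ P a).comp L = ((ContinuousLinearEquiv.refl ℝ F : F ≃L[ℝ] F) : F →L[ℝ] F) :=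
      ContinuousLinearMap.ext hLr
    rwa [h4] at h3
  set K := (hGat _ hmem).toOpenPartialHomeomorph G hG' (by simp) with hK
  have hKG : ∀ w, K w = G w := fun w => rfl
  set S := O' ∩ fderiv ℝ G ⁻¹' Set.range ((↑) : (F ≃L[ℝ] F) → F →L[ℝ] F) with hS
  have hSo : IsOpen S := (hGd.continuousOn_fderiv_of_isOpen hO'o (by simp)).isOpen_inter_preimage
    hO'o ContinuousLinearEquiv.isOpen
  have hKs : P a ∈ K.source := (hGat _ hmem).mem_toOpenPartialHomeomorph_source hG' (by simp)
  have hKt : P a ∈ K.target := by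
    have := K.map_source hKs
    rwa [hKG, hGa] at this
  have hKa : K.symm (P a) = P a := by
    have := K.left_inv hKs
    rwa [hKG, hGa] at this
  refine ⟨K.target ∩ K.symm ⁻¹' S, fun w => A (K.symm w), K.isOpen_inter_preimage_symm hSo,
    ⟨hKt, ?_⟩, fun w hw => ⟨?_, hw.2.1, ?_⟩⟩
  · rw [Set.mem_preimage, hKa]
    exact ⟨hmem, ContinuousLinearEquiv.refl ℝ F, hG'.fderiv.symm⟩
  · obtain ⟨T, hT⟩ := hw.2.2
    have h1 := hGat _ hw.2.1
    refine hAd.contDiffAt.comp w (K.contDiffAt_symm hw.1 (f₀' := T) ?_ h1)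
    rw [hT]
    exact (h1.differentiableAt (by simp)).hasFDerivAt
  · exact K.right_inv hw.1

variable {m n : ℕ} {M N : Type*} [TopologicalSpace M] [ChartedSpace (EuclideanSpace ℝ (Fin m)) M]
  [IsManifold (𝓡 m) ∞ M] [TopologicalSpace N] [ChartedSpace (EuclideanSpace ℝ (Fin n)) N]
  [IsManifold (𝓡 n) ∞ N]

/-- A surjective submersion has local sections, here expressed in a chart of the base. -/
theorem exists_local_section {π : M → N} (hπ : ContMDiff (𝓡 m) (𝓡 n) ∞ π)
    (hsurj : Function.Surjective π)
    (hsub : ∀ p, Function.Surjective (mfderiv (𝓡 m) (𝓡 n) π p)) (x₀ : N) :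
    ∃ (U : Set (EuclideanSpace ℝ (Fin n))) (f : EuclideanSpace ℝ (Fin n) → M),
      IsOpen U ∧ extChartAt (𝓡 n) x₀ x₀ ∈ U ∧ U ⊆ (extChartAt (𝓡 n) x₀).target ∧
      ∀ z ∈ U, ContMDiffAt (𝓡 n) (𝓡 m) ∞ f z ∧ π (f z) = (extChartAt (𝓡 n) x₀).symm z := by
  obtain ⟨q, rfl⟩ := hsurj x₀
  set c := extChartAt (𝓡 m) q with hc
  set e := extChartAt (𝓡 n) (π q) with he
  have hct : IsOpen c.target := isOpen_extChartAt_target q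
  have hcs := contMDiffOn_extChartAt_symm (n := ∞) (I := 𝓡 m) q
  set O := c.target ∩ (fun y => π (c.symm y)) ⁻¹' e.source with hO
  have hOo : IsOpen O := (hπ.continuous.comp_continuousOn
    hcs.continuousOn).isOpen_inter_preimage hct (isOpen_extChartAt_source (π q))
  have hqt : c q ∈ c.target := mem_extChartAt_target q
  have hqs : c.symm (c q) = q := c.left_inv (mem_extChartAt_source q)
  have hqO : c q ∈ O := ⟨hqt, by rw [Set.mem_preimage, hqs]; exact mem_extChartAt_source (π q)⟩
  set P : EuclideanSpace ℝ (Fin m) → EuclideanSpace ℝ (Fin n) := fun y => e (π (c.symm y)) with hP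
  have hPa : P (c q) = e (π q) := by simp only [hP, hqs]
  have hPd : ContDiffOn ℝ ∞ P O := by
    intro y hy
    have h1 := hcs.contMDiffAt (hct.mem_nhds hy.1)
    have h2 := (contMDiffAt_extChartAt' (n := ∞) (I := 𝓡 n) (x := π q) (x' := π (c.symm y))
      (by simpa [he] using hy.2)).comp y ((hπ (c.symm y)).comp y h1)
    exact h2.contDiffAt.contDiffWithinAt
  have hPs : Function.Surjective (fderiv ℝ P (c q)) := by
    have hp : c.symm (c q) ∈ c.source := c.map_target hqt
    have h1 := (hcs.contMDiffAt (hct.mem_nhds hqt)).mdifferentiableAt (by simp)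
    have h2 := (hπ (c.symm (c q))).mdifferentiableAt (by simp)
    have hpe : π (c.symm (c q)) ∈ e.source := by rw [hqs]; exact mem_extChartAt_source (π q)
    have h3 := mdifferentiableAt_extChartAt (I := 𝓡 n) (x := π q) (y := π (c.symm (c q)))
      (by simpa [he] using hpe)
    obtain ⟨T, hT⟩ := isInvertible_mfderiv_extChartAt (I := 𝓡 n) hpe
    have h4 : Function.Surjective (mfderiv (𝓡 n) 𝓘(ℝ, EuclideanSpace ℝ (Fin n)) e
        (π (c.symm (c q)))) := by
      rw [← hT]
      exact T.surjective
    have h5 : Function.Surjective (chartInvDeriv q (c q)) := (chartInvEquiv q (c q) hqt).surjective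
    have h6 := mfderiv_comp (c q) (h3.comp (c.symm (c q)) h2) h1
    have h7 := mfderiv_comp (c.symm (c q)) h3 h2
    rw [h7] at h6
    rw [← mfderiv_eq_fderiv]
    have h8 := h4.comp ((hsub (c.symm (c q))).comp h5)
    intro w
    obtain ⟨u, hu⟩ := h8 w
    exact ⟨u, (DFunLike.congr_fun h6 u).trans hu⟩
  obtain ⟨U, s, hUo, haU, hs⟩ := exists_smooth_rightInverse hOo hPd hqO hPs
  rw [hPa] at haU
  refine ⟨U ∩ e.target, fun w => c.symm (s w), hUo.inter (isOpen_extChartAt_target _),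
    ⟨haU, mem_extChartAt_target (π q)⟩, Set.inter_subset_right, fun w hw => ?_⟩
  obtain ⟨h1, h2, h3⟩ := hs w hw.1
  refine ⟨(hcs.contMDiffAt (hct.mem_nhds h2.1)).comp w h1.contMDiffAt, ?_⟩
  rw [← h3]
  exact (e.left_inv h2.2).symm ▸ congrArg π (by rw [h3])

end LocalSections

/-! ### The Levi-Civita connection in a chart -/

section LeviCivita

variable {n : ℕ}

/-- The Gram matrix of a bilinear form in the standard basis. -/
def gramMatrix (g : EuclideanSpace ℝ (Fin n) →L[ℝ] EuclideanSpace ℝ (Fin n) →L[ℝ] ℝ) :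
    Matrix (Fin n) (Fin n) ℝ :=
  Matrix.of fun i j => g (EuclideanSpace.single i 1) (EuclideanSpace.single j 1)

variable {g : EuclideanSpace ℝ (Fin n) →L[ℝ] EuclideanSpace ℝ (Fin n) →L[ℝ] ℝ}

theorem sum_mul_gramMatrix (w : EuclideanSpace ℝ (Fin n)) (j : Fin n) :
    ∑ k, w k * gramMatrix g k j = g w (EuclideanSpace.single j 1) := by
  conv_rhs => rw [sum_single w]
  simp [gramMatrix]

theorem det_gramMatrix_ne_zero (hpos : ∀ a, a ≠ 0 → 0 < g a a) : (gramMatrix g).det ≠ 0 := by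
  intro h
  obtain ⟨v, hv0, hv⟩ := Matrix.exists_vecMul_eq_zero_iff.mpr h
  set w : EuclideanSpace ℝ (Fin n) := WithLp.toLp 2 v with hw
  have h1 : ∀ j, g w (EuclideanSpace.single j 1) = 0 := fun j => by
    rw [← sum_mul_gramMatrix]
    exact congrFun hv j
  have h2 : ∀ b, g w b = 0 := fun b => by
    rw [sum_single b]
    simp [h1]
  refine (hpos w fun h => hv0 ?_).ne' (h2 w)
  exact congrArg (fun x : EuclideanSpace ℝ (Fin n) => x.ofLp) h

/-- A vector is recovered from its inner products with the vectors of the standard basis. -/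
theorem apply_eq_sum_inv_gramMatrix (hsymm : ∀ a b, g a b = g b a)
    (hpos : ∀ a, a ≠ 0 → 0 < g a a) (w : EuclideanSpace ℝ (Fin n)) (i : Fin n) :
    w i = ∑ j, (gramMatrix g)⁻¹ i j * g w (EuclideanSpace.single j 1) := by
  have hsy : ∀ k j, gramMatrix g k j = gramMatrix g j k := fun k j => hsymm _ _
  have h1 : (gramMatrix g)⁻¹ * gramMatrix g = 1 :=
    Matrix.nonsing_inv_mul _ (det_gramMatrix_ne_zero hpos).isUnit
  have h2 : ((gramMatrix g)⁻¹).mulVec ((gramMatrix g).mulVec w.ofLp) = w.ofLp := by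
    rw [Matrix.mulVec_mulVec, h1, Matrix.one_mulVec]
  refine (congrFun h2 i).symm.trans ?_
  change ∑ j, (gramMatrix g)⁻¹ i j * ((gramMatrix g).mulVec w.ofLp) j = _
  refine Finset.sum_congr rfl fun j _ => ?_
  rw [← sum_mul_gramMatrix]
  congr 1
  change ∑ k, gramMatrix g j k * w k = _
  exact Finset.sum_congr rfl fun k _ => by rw [hsy, mul_comm]

theorem trilinear_ext {T S : EuclideanSpace ℝ (Fin n) →L[ℝ] EuclideanSpace ℝ (Fin n) →L[ℝ]
      EuclideanSpace ℝ (Fin n) →L[ℝ] ℝ}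
    (h : ∀ i j k, T (EuclideanSpace.single i 1) (EuclideanSpace.single j 1)
      (EuclideanSpace.single k 1) = S (EuclideanSpace.single i 1) (EuclideanSpace.single j 1)
        (EuclideanSpace.single k 1)) : T = S := by
  ext X Y Z
  rw [sum_single X, sum_single Y, sum_single Z]
  simp [h]

/-- The bilinear map `(X, Y) ↦ ∑ Cˡᵢⱼ Xⁱ Yʲ eₗ`. -/
def bilinOfCoeff (n : ℕ) : (Fin n → Fin n → Fin n → ℝ) →L[ℝ]
    (EuclideanSpace ℝ (Fin n) →L[ℝ] EuclideanSpace ℝ (Fin n) →L[ℝ] EuclideanSpace ℝ (Fin n)) :=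
  LinearMap.toContinuousLinearMap
    { toFun := fun C => ∑ l, ∑ i, ∑ j, C l i j •
        (EuclideanSpace.proj i : EuclideanSpace ℝ (Fin n) →L[ℝ] ℝ).smulRight
          ((EuclideanSpace.proj j : EuclideanSpace ℝ (Fin n) →L[ℝ] ℝ).smulRight
            (EuclideanSpace.single l (1 : ℝ)))
      map_add' := fun C D => by simp [add_smul, Finset.sum_add_distrib]
      map_smul' := fun c C => by simp [mul_smul, Finset.smul_sum] }

theorem bilinOfCoeff_apply (C : Fin n → Fin n → Fin n → ℝ) (X Y : EuclideanSpace ℝ (Fin n))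
    (l : Fin n) : bilinOfCoeff n C X Y l = ∑ i, ∑ j, C l i j * (X i * Y j) := by
  simp only [bilinOfCoeff, LinearMap.coe_toContinuousLinearMap', LinearMap.coe_mk, AddHom.coe_mk,
    sum_apply, smul_apply, ContinuousLinearMap.smulRight_apply, WithLp.ofLp_sum, WithLp.ofLp_smul,
    Finset.sum_apply, Pi.smul_apply, PiLp.proj_apply, smul_eq_mul]
  rw [Finset.sum_eq_single l]
  · simp
  · intro m _ hm
    simp [hm.symm]
  · simp

theorem bilinOfCoeff_single (C : Fin n → Fin n → Fin n → ℝ) (i j l : Fin n) :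
    bilinOfCoeff n C (EuclideanSpace.single i 1) (EuclideanSpace.single j 1) l = C l i j := by
  simp [bilinOfCoeff_apply, PiLp.single_apply]

theorem trace_flip_flip (R : EuclideanSpace ℝ (Fin n) →L[ℝ] EuclideanSpace ℝ (Fin n) →L[ℝ]
    EuclideanSpace ℝ (Fin n) →L[ℝ] EuclideanSpace ℝ (Fin n)) (u v : EuclideanSpace ℝ (Fin n)) :
    LinearMap.trace ℝ (EuclideanSpace ℝ (Fin n)) ((R.flip v).flip u) =
      ∑ l, ∑ i, ∑ j, R (EuclideanSpace.single l 1)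
        (EuclideanSpace.single j 1) (EuclideanSpace.single i 1) l * u i * v j := by
  rw [LinearMap.trace_eq_sum_inner _ (EuclideanSpace.basisFun (Fin n) ℝ)]
  refine Finset.sum_congr rfl fun l _ => ?_
  have h : ((R.flip v).flip u) (EuclideanSpace.basisFun (Fin n) ℝ l) =
      ∑ i, ∑ j, (u i * v j) • R (EuclideanSpace.single l 1)
        (EuclideanSpace.single j 1) (EuclideanSpace.single i 1) := by
    rw [EuclideanSpace.basisFun_apply]
    change R _ v u = _
    conv_lhs => rw [sum_single u, sum_single v]
    simp only [map_sum, map_smul, sum_apply, smul_apply, Finset.smul_sum, smul_smul]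
  change inner ℝ _ (((R.flip v).flip u) _) = _
  rw [h, EuclideanSpace.basisFun_apply, EuclideanSpace.inner_single_left]
  simp only [map_one, one_mul, WithLp.ofLp_sum, Finset.sum_apply, WithLp.ofLp_smul, Pi.smul_apply,
    smul_eq_mul]
  exact Finset.sum_congr rfl fun i _ => Finset.sum_congr rfl fun j _ => by ring

variable {M : Type*} [TopologicalSpace M] [ChartedSpace (EuclideanSpace ℝ (Fin n)) M]
  [IsManifold (𝓡 n) ∞ M] (h : SmoothMetric n M) (x₀ : M)

/-- The expression of a Riemannian metric in the preferred chart at `x₀`. -/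
def metricInChart (y : EuclideanSpace ℝ (Fin n)) :
    EuclideanSpace ℝ (Fin n) →L[ℝ] EuclideanSpace ℝ (Fin n) →L[ℝ] ℝ :=
  ContinuousLinearMap.bilinearComp (E := EuclideanSpace ℝ (Fin n)) (F := EuclideanSpace ℝ (Fin n))
    (h.inner ((extChartAt (𝓡 n) x₀).symm y)) (chartInvDeriv x₀ y) (chartInvDeriv x₀ y)

theorem metricInChart_apply (y a b : EuclideanSpace ℝ (Fin n)) :
    metricInChart h x₀ y a b = h.inner ((extChartAt (𝓡 n) x₀).symm y) (chartInvDeriv x₀ y a)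
      (chartInvDeriv x₀ y b) := rfl

theorem metricInChart_symm (y a b : EuclideanSpace ℝ (Fin n)) :
    metricInChart h x₀ y a b = metricInChart h x₀ y b a :=
  h.symm _ _ _

variable {x₀} {y : EuclideanSpace ℝ (Fin n)} (hy : y ∈ (extChartAt (𝓡 n) x₀).target)
include hy

theorem metricInChart_pos {a : EuclideanSpace ℝ (Fin n)} (ha : a ≠ 0) :
    0 < metricInChart h x₀ y a a := by
  refine h.pos _ _ fun h0 => ha ?_
  exact (chartInvEquiv x₀ y hy).map_eq_zero_iff.mp h0

omit hy in
theorem contMDiff_inner_apply {X X' : VField n M} {p : M} (hX : SmoothFieldAt X p)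
    (hX' : SmoothFieldAt X' p) :
    ContMDiffAt (𝓡 n) 𝓘(ℝ, ℝ) ∞ (fun q => h.inner q (X q) (X' q)) p := by
  have : ContMDiffWithinAt (𝓡 n) ((𝓡 n).prod 𝓘(ℝ, ℝ)) ∞
      (fun m => Bundle.TotalSpace.mk' ℝ (E := Bundle.Trivial M ℝ) m (h.inner m (X m) (X' m)))
        Set.univ p := by
    apply ContMDiffWithinAt.clm_bundle_apply₂ (F₁ := EuclideanSpace ℝ (Fin n))
      (F₂ := EuclideanSpace ℝ (Fin n))
    · exact h.contMDiff.contMDiffAt.contMDiffWithinAt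
    · exact hX.contMDiffWithinAt
    · exact hX'.contMDiffWithinAt
  simp only [Bundle.contMDiffWithinAt_totalSpace] at this
  exact contMDiffWithinAt_univ.mp this.2

omit hy in
theorem contDiffOn_metricInChart :
    ContDiffOn ℝ ∞ (metricInChart h x₀) (extChartAt (𝓡 n) x₀).target := by
  refine contDiffOn_clm_apply.mpr fun a => contDiffOn_clm_apply.mpr fun b => ?_
  rw [← contMDiffOn_iff_contDiffOn]
  intro y hy
  have h1 := contMDiff_inner_apply h (X := ofChart x₀ fun _ => a) (X' := ofChart x₀ fun _ => b)
    (smoothFieldAt_ofChart ((extChartAt (𝓡 n) x₀).map_target hy) contDiffAt_const)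
    (smoothFieldAt_ofChart ((extChartAt (𝓡 n) x₀).map_target hy) contDiffAt_const)
  have h2 := (contMDiffOn_extChartAt_symm (n := ∞) (I := 𝓡 n) x₀).contMDiffAt
    ((isOpen_extChartAt_target x₀).mem_nhds hy)
  refine ((h1.comp y h2).congr_of_eventuallyEq ?_).contMDiffWithinAt
  filter_upwards [(isOpen_extChartAt_target x₀).mem_nhds hy] with z hz
  simp only [Function.comp, ofChart_symm x₀ _ hz]
  rfl

theorem contDiffAt_metricInChart : ContDiffAt ℝ ∞ (metricInChart h x₀) y :=
  (contDiffOn_metricInChart h).contDiffAt ((isOpen_extChartAt_target x₀).mem_nhds hy)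

theorem contDiffAt_metricCoeff (i j : Fin n) : ContDiffAt ℝ ∞ (metricCoeff h x₀ i j) y :=
  ((contDiffAt_metricInChart h hy).clm_apply contDiffAt_const).clm_apply contDiffAt_const

theorem contDiffAt_invMetricCoeff (i j : Fin n) : ContDiffAt ℝ ∞ (invMetricCoeff h x₀ i j) y :=
  contDiffAt_matrix_inv (M := fun y => gramMatrix (metricInChart h x₀ y))
    (fun a b => contDiffAt_metricCoeff h hy a b)
    (det_gramMatrix_ne_zero fun _ ha => metricInChart_pos h hy ha) i j

omit hy in
theorem _root_.ContDiffAt.pderiv {f : EuclideanSpace ℝ (Fin n) → ℝ} (hf : ContDiffAt ℝ ∞ f y)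
    (i : Fin n) : ContDiffAt ℝ ∞ (pderiv i f) y :=
  (hf.fderiv_right (m := ∞) (by simp)).clm_apply contDiffAt_const

theorem contDiffAt_christoffel (l i j : Fin n) : ContDiffAt ℝ ∞ (christoffel h x₀ l i j) y :=
  contDiffAt_const.mul (ContDiffAt.sum fun m _ => (contDiffAt_invMetricCoeff h hy l m).mul
    ((((contDiffAt_metricCoeff h hy j m).pderiv i).add
      ((contDiffAt_metricCoeff h hy i m).pderiv j)).sub
        ((contDiffAt_metricCoeff h hy i j).pderiv m)))

omit hy in
theorem metricCoeff_symm (i j : Fin n) : metricCoeff h x₀ i j = metricCoeff h x₀ j i :=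
  funext fun y => metricInChart_symm h x₀ y _ _

omit hy in
theorem christoffel_symm (l i j : Fin n) : christoffel h x₀ l i j = christoffel h x₀ l j i := by
  funext y
  unfold christoffel
  rw [metricCoeff_symm h i j]
  simp only [add_comm]

variable (x₀) in
omit hy in
/-- The Christoffel map of the Levi-Civita connection in the preferred chart at `x₀`. -/
def christoffelMap (y : EuclideanSpace ℝ (Fin n)) : EuclideanSpace ℝ (Fin n) →L[ℝ]
    EuclideanSpace ℝ (Fin n) →L[ℝ] EuclideanSpace ℝ (Fin n) :=
  bilinOfCoeff n fun l i j => christoffel h x₀ l i j y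

theorem contDiffAt_christoffelMap : ContDiffAt ℝ ∞ (christoffelMap h x₀) y :=
  (bilinOfCoeff n).contDiff.contDiffAt.comp y (contDiffAt_pi.mpr fun l => contDiffAt_pi.mpr fun i =>
    contDiffAt_pi.mpr fun j => contDiffAt_christoffel h hy l i j)

omit hy in
theorem christoffelMap_symm (y X Y : EuclideanSpace ℝ (Fin n)) :
    christoffelMap h x₀ y X Y = christoffelMap h x₀ y Y X := by
  ext l
  simp only [christoffelMap, bilinOfCoeff_apply]
  rw [Finset.sum_comm]
  exact Finset.sum_congr rfl fun i _ => Finset.sum_congr rfl fun j _ => by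
    rw [christoffel_symm h l i j, mul_comm (X j)]

/-- The Koszul formula, on the coordinate fields of a chart. -/
theorem inner_christoffelMap_single (i j k : Fin n) :
    metricInChart h x₀ y (christoffelMap h x₀ y (EuclideanSpace.single i 1)
      (EuclideanSpace.single j 1)) (EuclideanSpace.single k 1) =
    1 / 2 * (pderiv i (metricCoeff h x₀ j k) y + pderiv j (metricCoeff h x₀ i k) y
      - pderiv k (metricCoeff h x₀ i j) y) := by
  set G := gramMatrix (metricInChart h x₀ y) with hG
  have h1 : G * G⁻¹ = 1 := Matrix.mul_nonsing_inv _
    (det_gramMatrix_ne_zero fun _ ha => metricInChart_pos h hy ha).isUnit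
  have h2 : ∀ v : Fin n → ℝ, G.mulVec (G⁻¹.mulVec v) = v := fun v => by
    rw [Matrix.mulVec_mulVec, h1, Matrix.one_mulVec]
  rw [← sum_mul_gramMatrix]
  simp only [christoffelMap, bilinOfCoeff_single]
  refine Eq.trans ?_ (congrFun (h2 fun k => 1 / 2 * (pderiv i (metricCoeff h x₀ j k) y
    + pderiv j (metricCoeff h x₀ i k) y - pderiv k (metricCoeff h x₀ i j) y)) k)
  refine Finset.sum_congr rfl fun l _ => ?_
  have h3 : gramMatrix (metricInChart h x₀ y) l k = G k l := metricInChart_symm h x₀ y _ _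
  rw [h3, mul_comm]
  congr 1
  rw [christoffel, Finset.mul_sum]
  refine Finset.sum_congr rfl fun m _ => ?_
  change 1 / 2 * (G⁻¹ l m * _) = G⁻¹ l m * _
  ring

/-- The connection with the Christoffel map `christoffelMap` preserves the metric. -/
theorem fderiv_metricInChart (X a b : EuclideanSpace ℝ (Fin n)) :
    fderiv ℝ (metricInChart h x₀) y X a b =
      metricInChart h x₀ y (christoffelMap h x₀ y X a) b
        + metricInChart h x₀ y a (christoffelMap h x₀ y X b) := by
  set g := metricInChart h x₀ y with hg
  set Γ := christoffelMap h x₀ y with hΓ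
  set K := (ContinuousLinearMap.compL ℝ _ _ _ g).comp Γ with hK
  have hKa : ∀ X a b, K X a b = g (Γ X a) b := fun X a b => rfl
  set K' := (ContinuousLinearMap.flipₗᵢ ℝ (EuclideanSpace ℝ (Fin n)) (EuclideanSpace ℝ (Fin n))
    ℝ).toContinuousLinearEquiv.toContinuousLinearMap.comp K with hK'
  have hKa' : ∀ X a b, K' X a b = g (Γ X b) a := fun X a b => rfl
  have h1 : fderiv ℝ (metricInChart h x₀) y = K + K' := by
    refine trilinear_ext fun k i j => ?_
    have hd := (contDiffAt_metricInChart h hy).differentiableAt (by simp)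
    have h2 := fderiv_apply₂ hd (differentiableAt_const (EuclideanSpace.single i (1 : ℝ)))
      (differentiableAt_const (EuclideanSpace.single j (1 : ℝ))) (EuclideanSpace.single k 1)
    simp only [fderiv_fun_const, Pi.zero_apply, zero_apply, map_zero, add_zero] at h2
    rw [← h2]
    simp only [add_apply, hKa, hKa', hg, hΓ, inner_christoffelMap_single h hy]
    rw [metricCoeff_symm h j i, metricCoeff_symm h k j, metricCoeff_symm h k i]
    change pderiv k (metricCoeff h x₀ i j) y = _
    ring
  rw [h1, add_apply, add_apply, add_apply, hKa, hKa', metricInChart_symm h x₀ y a]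

theorem curvatureMap_christoffelMap_single (l j i : Fin n) :
    curvatureMap (christoffelMap h x₀) y (EuclideanSpace.single l 1) (EuclideanSpace.single j 1)
      (EuclideanSpace.single i 1) l =
    pderiv l (christoffel h x₀ l i j) y - pderiv j (christoffel h x₀ l i l) y
      + ∑ m, (christoffel h x₀ l l m y * christoffel h x₀ m i j y
        - christoffel h x₀ l j m y * christoffel h x₀ m i l y) := by
  have hd := (contDiffAt_christoffelMap h hy).differentiableAt (by simp)
  have h1 : ∀ k i j l : Fin n, fderiv ℝ (christoffelMap h x₀) y (EuclideanSpace.single k 1)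
      (EuclideanSpace.single i 1) (EuclideanSpace.single j 1) l =
        pderiv k (christoffel h x₀ l i j) y := by
    intro k i j l
    have h2 := fderiv_apply₂ hd (differentiableAt_const (EuclideanSpace.single i (1 : ℝ)))
      (differentiableAt_const (EuclideanSpace.single j (1 : ℝ))) (EuclideanSpace.single k 1)
    simp only [fderiv_fun_const, Pi.zero_apply, zero_apply, map_zero, add_zero] at h2
    have h3 : DifferentiableAt ℝ (fun y => christoffelMap h x₀ y (EuclideanSpace.single i 1)
        (EuclideanSpace.single j 1)) y :=
      (hd.clm_apply (differentiableAt_const _)).clm_apply (differentiableAt_const _)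
    have h4 := ((EuclideanSpace.proj l : EuclideanSpace ℝ (Fin n) →L[ℝ] ℝ).hasFDerivAt.comp y
      h3.hasFDerivAt).fderiv
    have h5 : christoffel h x₀ l i j = (EuclideanSpace.proj l : EuclideanSpace ℝ (Fin n) →L[ℝ] ℝ) ∘
        (fun y => christoffelMap h x₀ y (EuclideanSpace.single i 1)
          (EuclideanSpace.single j 1)) := by
      funext z
      exact (bilinOfCoeff_single (fun l i j => christoffel h x₀ l i j z) i j l).symm
    rw [← h2, pderiv, h5, h4]
    rfl
  have h2 : ∀ (Z : EuclideanSpace ℝ (Fin n)) (j l : Fin n),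
      christoffelMap h x₀ y (EuclideanSpace.single j 1) Z l =
        ∑ m, christoffel h x₀ l j m y * Z m := by
    intro Z j l
    simp [christoffelMap, bilinOfCoeff_apply, PiLp.single_apply]
  rw [curvatureMap_apply]
  simp only [PiLp.sub_apply, PiLp.add_apply, h1]
  rw [h2, h2]
  simp only [christoffelMap, bilinOfCoeff_single]
  rw [Finset.sum_sub_distrib, christoffel_symm h l j i, christoffel_symm h l l i]
  simp only [christoffel_symm h _ j i, christoffel_symm h _ l i]
  ring

omit hy in
/-- `Ric(u, v)` is the trace of `X ↦ R(X, v) u`. -/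
theorem ricci_eq_trace (x : M) (u v : EuclideanSpace ℝ (Fin n)) :
    ricci h x u v = LinearMap.trace ℝ (EuclideanSpace ℝ (Fin n))
      (((curvatureMap (christoffelMap h x) (extChartAt (𝓡 n) x x)).flip v).flip u) := by
  set y := extChartAt (𝓡 n) x x with hy
  have hy' : y ∈ (extChartAt (𝓡 n) x).target := mem_extChartAt_target x
  set R := curvatureMap (christoffelMap h x) y with hR
  have h1 : ∀ w : EuclideanSpace ℝ (Fin n), chartDeriv (n := n) x w = w :=
    fun w => DFunLike.congr_fun (chartDeriv_eq_id x) w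
  have h2 : ∀ i j, ricciCoeff h x i j y = ∑ l, R (EuclideanSpace.single l 1)
      (EuclideanSpace.single j 1) (EuclideanSpace.single i 1) l := fun i j => by
    simp only [hR, curvatureMap_christoffelMap_single h hy', ricciCoeff, Finset.sum_add_distrib]
  unfold ricci
  simp only [h1]
  refine Eq.trans ?_ (trace_flip_flip R u v).symm
  have h3 : ∀ i j, ricciCoeff h x i j y * u i * v j = ∑ l, R (EuclideanSpace.single l 1)
      (EuclideanSpace.single j 1) (EuclideanSpace.single i 1) l * u i * v j := fun i j => by
    rw [h2, Finset.sum_mul, Finset.sum_mul]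
  refine (Finset.sum_congr rfl fun i _ => Finset.sum_congr rfl fun j _ => h3 i j).trans ?_
  refine (Finset.sum_congr rfl fun i (_ : i ∈ Finset.univ) => Finset.sum_comm).trans ?_
  exact Finset.sum_comm

end LeviCivita

/-! ### Exterior derivatives in low degrees -/

section ExtDeriv

variable {E : Type*} [NormedAddCommGroup E] [NormedSpace ℝ E] {z : E}

theorem extDeriv_apply_two {α : E → E [⋀^Fin 1]→L[ℝ] ℝ} (h : DifferentiableAt ℝ α z) (a b : E) :
    extDeriv α z ![a, b] =
      fderiv ℝ (fun y => α y ![b]) z a - fderiv ℝ (fun y => α y ![a]) z b := by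
  rw [extDeriv_apply h, Fin.sum_univ_two]
  have e0 : Fin.removeNth 0 ![a, b] = ![b] := by
    funext i; fin_cases i <;> rfl
  have e1 : Fin.removeNth 1 ![a, b] = ![a] := by
    funext i; fin_cases i <;> rfl
  rw [e0, e1]
  simp [sub_eq_add_neg]

theorem extDeriv_apply_three {α : E → E [⋀^Fin 2]→L[ℝ] ℝ} (h : DifferentiableAt ℝ α z)
    (a b c : E) : extDeriv α z ![a, b, c] = fderiv ℝ α z a ![b, c] - fderiv ℝ α z b ![a, c]
      + fderiv ℝ α z c ![a, b] := by
  rw [extDeriv_apply h, Fin.sum_univ_three]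
  have e0 : Fin.removeNth 0 ![a, b, c] = ![b, c] := by
    funext i; fin_cases i <;> rfl
  have e1 : Fin.removeNth 1 ![a, b, c] = ![a, c] := by
    funext i; fin_cases i <;> rfl
  have e2 : Fin.removeNth 2 ![a, b, c] = ![a, b] := by
    funext i; fin_cases i <;> rfl
  rw [e0, e1, e2]
  simp [sub_eq_add_neg, fderiv_continuousAlternatingMap_apply_const_apply h]

theorem extDeriv_apply_four {α : E → E [⋀^Fin 3]→L[ℝ] ℝ} (h : DifferentiableAt ℝ α z)
    (a b c d : E) : extDeriv α z ![a, b, c, d] = fderiv ℝ α z a ![b, c, d]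
      - fderiv ℝ α z b ![a, c, d] + fderiv ℝ α z c ![a, b, d] - fderiv ℝ α z d ![a, b, c] := by
  rw [extDeriv_apply h, Fin.sum_univ_four]
  have e0 : Fin.removeNth 0 ![a, b, c, d] = ![b, c, d] := by
    funext i; fin_cases i <;> rfl
  have e1 : Fin.removeNth 1 ![a, b, c, d] = ![a, c, d] := by
    funext i; fin_cases i <;> rfl
  have e2 : Fin.removeNth 2 ![a, b, c, d] = ![a, b, d] := by
    funext i; fin_cases i <;> rfl
  have e3 : Fin.removeNth 3 ![a, b, c, d] = ![a, b, c] := by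
    funext i; fin_cases i <;> rfl
  rw [e0, e1, e2, e3]
  simp [sub_eq_add_neg, fderiv_continuousAlternatingMap_apply_const_apply h]

end ExtDeriv

/-! ### The local geometry of the quotient -/

section Induced

variable {Y : Type*} [TopologicalSpace Y] [ChartedSpace (EuclideanSpace ℝ (Fin 7)) Y]
  [IsManifold (𝓡 7) ∞ Y]
  {N : Type*} [TopologicalSpace N] [ChartedSpace (EuclideanSpace ℝ (Fin 6)) N]
  [IsManifold (𝓡 6) ∞ N] {φ : DForm 7 Y 3} {hφ : IsAdmissible φ} {V : VField 7 Y} {π : Y → N}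
  {t : N → ℝ} {σ : DForm 6 N 2} {h : SmoothMetric 6 N} {J : EndField 6 N}

namespace IsInduced

variable (hind : IsInduced hφ V π t σ h J)
include hind

omit [IsManifold (𝓡 7) ∞ Y] in
theorem sigma_apply {p : Y} {x : N} (hx : π p = x) {u v : TangentSpace (𝓡 7) p}
    {a b : TangentSpace (𝓡 6) x}
    (ha : (mfderiv (𝓡 7) (𝓡 6) π p u : EuclideanSpace ℝ (Fin 6)) = a)
    (hb : (mfderiv (𝓡 7) (𝓡 6) π p v : EuclideanSpace ℝ (Fin 6)) = b) :
    h.inner x (J x a) b = φ p ![V p, u, v] := by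
  subst hx
  subst ha hb
  rw [hind.J_eq]
  exact hind.sigma_eq p u v

omit [IsManifold (𝓡 7) ∞ Y] in
theorem metric_apply {p : Y} {x : N} (hx : π p = x) {u v : TangentSpace (𝓡 7) p}
    {a b : TangentSpace (𝓡 6) x}
    (ha : (mfderiv (𝓡 7) (𝓡 6) π p u : EuclideanSpace ℝ (Fin 6)) = a)
    (hb : (mfderiv (𝓡 7) (𝓡 6) π p v : EuclideanSpace ℝ (Fin 6)) = b) :
    g2Metric hφ p u v = t x * h.inner x a b + (t x ^ 2)⁻¹ *
      (g2Metric hφ p u (t x ^ 2 • V p) * g2Metric hφ p v (t x ^ 2 • V p)) := by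
  subst hx
  subst ha hb
  exact hind.metric_eq p u v

end IsInduced

theorem g2Metric_self_pos (hV : IsNonvanishingSymmetry φ V) (p : Y) :
    0 < g2Metric hφ p (V p) (V p) :=
  real_inner_self_pos.mpr ((g2Frame hφ p).map_ne_zero_iff.mpr (hV.ne_zero p))

variable {x₀ : N} {f : EuclideanSpace ℝ (Fin 6) → Y} {z : EuclideanSpace ℝ (Fin 6)}
  {U : Set (EuclideanSpace ℝ (Fin 6))}

/-- `f` is a smooth local section of `π` over `U`, in the preferred chart at `x₀`. -/
structure IsSectionOn (π : Y → N) (x₀ : N) (f : EuclideanSpace ℝ (Fin 6) → Y)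
    (U : Set (EuclideanSpace ℝ (Fin 6))) : Prop where
  isOpen : IsOpen U
  subset : U ⊆ (extChartAt (𝓡 6) x₀).target
  smooth : ∀ z ∈ U, ContMDiffAt (𝓡 6) (𝓡 7) ∞ f z
  section_eq : ∀ z ∈ U, π (f z) = (extChartAt (𝓡 6) x₀).symm z

namespace IsSectionOn

variable (hf : IsSectionOn π x₀ f U) (hz : z ∈ U)
include hf hz

omit [IsManifold (𝓡 7) ∞ Y] [IsManifold (𝓡 6) ∞ N] in
theorem mfderiv_apply (hπ : ContMDiff (𝓡 7) (𝓡 6) ∞ π) (a : EuclideanSpace ℝ (Fin 6)) :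
    (mfderiv (𝓡 7) (𝓡 6) π (f z) (mfderiv (𝓡 6) (𝓡 7) f z a) : EuclideanSpace ℝ (Fin 6)) =
      chartInvDeriv x₀ z a := by
  have h1 := mfderiv_comp (I := 𝓡 6) (I' := 𝓡 7) (I'' := 𝓡 6) z
    ((hπ (f z)).mdifferentiableAt (by simp)) ((hf.smooth z hz).mdifferentiableAt (by simp))
  have h2 : π ∘ f =ᶠ[nhds z] (extChartAt (𝓡 6) x₀).symm := by
    filter_upwards [hf.isOpen.mem_nhds hz] with w hw
    exact hf.section_eq w hw
  have h3 : (mfderiv (𝓡 6) (𝓡 6) (π ∘ f) z :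
      EuclideanSpace ℝ (Fin 6) →L[ℝ] EuclideanSpace ℝ (Fin 6)) = chartInvDeriv x₀ z :=
    h2.mfderiv_eq
  exact (DFunLike.congr_fun h1 a).symm.trans (DFunLike.congr_fun h3 a)

omit [IsManifold (𝓡 7) ∞ Y] in
theorem t_eq (hind : IsInduced hφ V π t σ h J) : t ((extChartAt (𝓡 6) x₀).symm z) =
    (√(g2Metric hφ (f z) (V (f z)) (V (f z))))⁻¹ := by
  rw [← hf.section_eq z hz]
  exact hind.t_eq _

theorem sigma_apply (hπ : ContMDiff (𝓡 7) (𝓡 6) ∞ π) (hind : IsInduced hφ V π t σ h J)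
    (a b : EuclideanSpace ℝ (Fin 6)) : metricInChart h x₀ z (J.inChart x₀ z a) b =
      (DForm.interior φ V).pullback f z ![a, b] := by
  rw [metricInChart_apply, J.chartInvDeriv_inChart (hf.subset hz)]
  refine (hind.sigma_apply (hf.section_eq z hz) (hf.mfderiv_apply hz hπ a)
    (hf.mfderiv_apply hz hπ b)).trans ?_
  refine congrArg (φ (f z)) ?_
  funext i
  fin_cases i <;> rfl

theorem isSU3 (hπ : ContMDiff (𝓡 7) (𝓡 6) ∞ π) (hV : IsNonvanishingSymmetry φ V)
    (hind : IsInduced hφ V π t σ h J) :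
    IsSU3 (metricInChart h x₀ z) (J.inChart x₀ z)
      (trilinear _ ((DForm.interior (starPhi hφ) V).pullback f z))
      (t ((extChartAt (𝓡 6) x₀).symm z)) := by
  set p := f z with hp
  set τ := t ((extChartAt (𝓡 6) x₀).symm z) with hτ
  have hk : 0 < g2Metric hφ p (V p) (V p) := g2Metric_self_pos hV p
  have ht : τ = (√(g2Metric hφ p (V p) (V p)))⁻¹ := hf.t_eq hz hind
  have ht0 : 0 < τ := by rw [ht]; positivity
  set F : EuclideanSpace ℝ (Fin 7) ≃L[ℝ] EuclideanSpace ℝ (Fin 7) := g2Frame hφ p with hF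
  set D : EuclideanSpace ℝ (Fin 6) →L[ℝ] EuclideanSpace ℝ (Fin 7) :=
    mfderiv (𝓡 6) (𝓡 7) f z with hD
  refine isSU3_of_section (by simp) (F.toLinearEquiv.toLinearMap.comp D.toLinearMap)
    (v := F (V p)) ht0 ?_ (fun a ha => metricInChart_pos h (hf.subset hz) ha) ?_ ?_ ?_
  · change τ ^ 2 * g2Metric hφ p (V p) (V p) = 1
    rw [ht, inv_pow, Real.sq_sqrt hk.le, inv_mul_cancel₀ hk.ne']
  · intro a b
    have h1 := hind.metric_apply (hf.section_eq z hz) (hf.mfderiv_apply hz hπ a)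
      (hf.mfderiv_apply hz hπ b)
    have h2 : ∀ u : EuclideanSpace ℝ (Fin 7), g2Metric hφ p u (τ ^ 2 • V p) =
        τ ^ 2 * inner ℝ (F u) (F (V p)) := fun u => by
      refine Eq.trans ?_ (real_inner_smul_right (F u) (F (V p)) (τ ^ 2))
      exact congrArg (fun w : EuclideanSpace ℝ (Fin 7) => inner ℝ (F u) w) (map_smul F _ _)
    change inner ℝ (F (D a)) (F (D b)) = τ * _ + τ ^ 2 * (inner ℝ (F (D a)) _ * inner ℝ (F (D b)) _)
    refine Eq.trans h1 ?_
    rw [metricInChart_apply]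
    refine congrArg₂ (· + ·) rfl ?_
    refine (congrArg₂ (fun x y => (τ ^ 2)⁻¹ * (x * y)) (h2 (D a)) (h2 (D b))).trans ?_
    field_simp
  · intro a b
    rw [metricInChart_apply, J.chartInvDeriv_inChart (hf.subset hz)]
    refine (hind.sigma_apply (hf.section_eq z hz) (hf.mfderiv_apply hz hπ a)
      (hf.mfderiv_apply hz hπ b)).trans ?_
    rw [eq_phi0_comp_g2Frame hφ]
    refine congrArg phi0 ?_
    funext i
    fin_cases i <;> rfl
  · intro a b c
    rw [trilinear_apply]
    refine congrArg starPhi0 ?_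
    funext i
    fin_cases i <;> rfl

/-- `J` is smooth because it is determined by the smooth tensors `h` and `σ = h(J ·, ·)`. -/
theorem contDiffAt_J (hπ : ContMDiff (𝓡 7) (𝓡 6) ∞ π) (hs : φ.Smooth)
    (hV : IsNonvanishingSymmetry φ V) (hind : IsInduced hφ V π t σ h J) :
    ContDiffAt ℝ ∞ (J.inChart x₀) z := by
  have hO : ContDiffOn ℝ ∞ (J.inChart x₀) U := by
    refine contDiffOn_clm_apply.mpr fun a => contDiffOn_euclidean.mpr fun i => ?_
    refine ContDiffOn.congr (f := fun y => ∑ j, invMetricCoeff h x₀ i j y *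
      (DForm.interior φ V).pullback f y ![a, EuclideanSpace.single j 1]) (fun y hy => ?_)
      fun y hy => ?_
    · refine (ContDiffAt.sum fun j _ => (contDiffAt_invMetricCoeff h (hf.subset hy) i j).mul
        ?_).contDiffWithinAt
      exact (contDiff_form_apply _).contDiffAt.comp y
        ((hs.interior hV.smooth).contDiffAt_pullback (hf.smooth y hy))
    · refine (apply_eq_sum_inv_gramMatrix (metricInChart_symm h x₀ y)
        (fun _ ha => metricInChart_pos h (hf.subset hy) ha) _ i).trans ?_
      exact Finset.sum_congr rfl fun j _ =>
        congrArg (invMetricCoeff h x₀ i j y * ·) (hf.sigma_apply hy hπ hind _ _)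
  exact hO.contDiffAt (hf.isOpen.mem_nhds hz)

theorem contDiffAt_t (hs : φ.Smooth) (hV : IsNonvanishingSymmetry φ V)
    (hind : IsInduced hφ V π t σ h J) :
    ContDiffAt ℝ ∞ (fun y => t ((extChartAt (𝓡 6) x₀).symm y)) z := by
  have h1 := g2Metric_self_pos (hφ := hφ) hV (f z)
  refine ContDiffAt.congr_of_eventuallyEq (((contDiffAt_g2Metric hφ hs hV.smooth
    (hf.smooth z hz)).sqrt h1.ne').inv (Real.sqrt_pos.mpr h1).ne') ?_
  filter_upwards [hf.isOpen.mem_nhds hz] with y hy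
  exact hf.t_eq hy hind

omit hz in
/-- The almost-Kähler structure of the quotient, together with `ι_V *φ` restricted to a local
section, is an `SU(3)` structure with integrable complex structure. -/
theorem isKahlerSU3 (hπ : ContMDiff (𝓡 7) (𝓡 6) ∞ π) (hs : φ.Smooth) (ht : IsTorsionFree hφ)
    (hV : IsNonvanishingSymmetry φ V) (hind : IsInduced hφ V π t σ h J) (hJ : IsIntegrable J) :
    IsKahlerSU3 U (metricInChart h x₀) (J.inChart x₀)
      (fun y => trilinear _ ((DForm.interior (starPhi hφ) V).pullback f y))
      (fun y => t ((extChartAt (𝓡 6) x₀).symm y)) (christoffelMap h x₀) where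
  isOpen := hf.isOpen
  smooth_g := (contDiffOn_metricInChart h).mono hf.subset
  smooth_J z hz := (hf.contDiffAt_J hz hπ hs hV hind).contDiffWithinAt
  smooth_β z hz := ((trilinear (EuclideanSpace ℝ (Fin 6))).contDiff.contDiffAt.comp z
    (((starPhi_smooth hφ hs).interior hV.smooth).contDiffAt_pullback
      (hf.smooth z hz))).contDiffWithinAt
  smooth_t z hz := (hf.contDiffAt_t hz hs hV hind).contDiffWithinAt
  smooth_Γ z hz := (contDiffAt_christoffelMap h (hf.subset hz)).contDiffWithinAt
  isSU3 z hz := hf.isSU3 hz hπ hV hind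
  torsionFree z _ X Y := christoffelMap_symm h z X Y
  metric z hz X a b := fderiv_metricInChart h (hf.subset hz) X a b
  closed_σ z hz a b c := by
    set α := (DForm.interior φ V).pullback f with hα
    have hd : DifferentiableAt ℝ α z :=
      ((hs.interior hV.smooth).contDiffAt_pullback (hf.smooth z hz)).differentiableAt (by simp)
    have h1 : ∀ a b c, fderiv ℝ (fun y => metricInChart h x₀ y (J.inChart x₀ y b) c) z a =
        fderiv ℝ α z a ![b, c] := by
      intro a b c
      have h2 : (fun y => metricInChart h x₀ y (J.inChart x₀ y b) c) =ᶠ[nhds z]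
          fun y => α y ![b, c] := by
        filter_upwards [hf.isOpen.mem_nhds hz] with y hy
        exact hf.sigma_apply hy hπ hind b c
      rw [h2.fderiv_eq]
      exact fderiv_continuousAlternatingMap_apply_const_apply hd _ _
    have h3 := extDeriv_apply_three hd a b c
    rw [extDeriv_pullback_interior_phi hφ hs ht hV (hf.smooth z hz)] at h3
    have h4 : fderiv ℝ α z b ![c, a] = -fderiv ℝ α z b ![a, c] := by
      have := (fderiv ℝ α z b).toAlternatingMap.map_swap ![a, c] (i := 0) (j := 1) (by simp)
      refine Eq.trans (congrArg (fderiv ℝ α z b) ?_) this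
      funext i
      fin_cases i <;> rfl
    rw [h1, h1, h1, h4]
    have h5 : (0 : EuclideanSpace ℝ (Fin 6) [⋀^Fin 3]→L[ℝ] ℝ) ![a, b, c] = 0 := rfl
    linarith
  nijenhuis z hz a b := hJ.inChart (hf.subset hz) (hf.contDiffAt_J hz hπ hs hV hind) a b
  closed_β z hz a b c d := by
    set α := (DForm.interior (starPhi hφ) V).pullback f with hα
    have hd : DifferentiableAt ℝ α z :=
      (((starPhi_smooth hφ hs).interior hV.smooth).contDiffAt_pullback
        (hf.smooth z hz)).differentiableAt (by simp)
    have h1 : ∀ a b c d, fderiv ℝ (fun y => trilinear _ (α y)) z a b c d =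
        fderiv ℝ α z a ![b, c, d] := by
      intro a b c d
      have h2 := ((trilinear (EuclideanSpace ℝ (Fin 6))).hasFDerivAt.comp z hd.hasFDerivAt).fderiv
      refine Eq.trans ?_ (trilinear_apply (fderiv ℝ α z a) b c d)
      exact congrArg (fun A => A a b c d) h2
    rw [h1, h1, h1, h1, ← extDeriv_apply_four hd,
      extDeriv_pullback_interior_starPhi hφ hs ht hV (hf.smooth z hz)]
    rfl

end IsSectionOn

end Induced

/-! ### The Ricci form and `d dᶜ` at the centre of a chart -/

section AtBasePoint

variable {n : ℕ} {M : Type*} [TopologicalSpace M] [ChartedSpace (EuclideanSpace ℝ (Fin n)) M]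
  [IsManifold (𝓡 n) ∞ M]

theorem ofChart_self (x : M) (W : EuclideanSpace ℝ (Fin n) → EuclideanSpace ℝ (Fin n)) :
    ofChart x W x = W (extChartAt (𝓡 n) x x) := by
  have h : (chartDeriv x).inverse = ContinuousLinearMap.id ℝ (EuclideanSpace ℝ (Fin n)) :=
    (congrArg ContinuousLinearMap.inverse (chartDeriv_eq_id x)).trans
      ContinuousLinearMap.inverse_id
  exact DFunLike.congr_fun h _

theorem EndField.inChart_self (J : EndField n M) (x : M) (u : EuclideanSpace ℝ (Fin n)) :
    J.inChart x (extChartAt (𝓡 n) x x) u = J x u := by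
  have h := J.apply_ofChart (mem_extChartAt_source (I := 𝓡 n) x) fun _ => u
  rw [ofChart_self x fun y => J.inChart x y u] at h
  refine Eq.trans h.symm ?_
  exact congrArg (fun w : EuclideanSpace ℝ (Fin n) => (J x w : EuclideanSpace ℝ (Fin n)))
    (ofChart_self x fun _ => u)

theorem DForm.d_apply_two (α : DForm n M 1) (x : M) (u v : EuclideanSpace ℝ (Fin n)) :
    α.d x ![u, v] = extDeriv (α.inChart x) (extChartAt (𝓡 n) x x) ![u, v] := by
  rw [DForm.d, chartDeriv_eq_id]
  refine congrArg (extDeriv (α.inChart x) (extChartAt (𝓡 n) x x)) ?_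
  funext i
  fin_cases i <;> rfl

theorem dc_inChart_apply (J : EndField n M) (F : M → ℝ) {q : M} {y : EuclideanSpace ℝ (Fin n)}
    (hy : y ∈ (extChartAt (𝓡 n) q).target)
    (hF : DifferentiableAt ℝ (fun w => F ((extChartAt (𝓡 n) q).symm w)) y)
    (v : Fin 1 → EuclideanSpace ℝ (Fin n)) : (dc J F).inChart q y v =
      -fderiv ℝ (fun w => F ((extChartAt (𝓡 n) q).symm w)) y (J.inChart q y (v 0)) := by
  set c := extChartAt (𝓡 n) q with hc
  have hp : c.symm y ∈ c.source := c.map_target hy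
  have hF1 : MDifferentiableAt 𝓘(ℝ, EuclideanSpace ℝ (Fin n)) 𝓘(ℝ, ℝ)
      (fun w => F (c.symm w)) (c (c.symm y)) := by
    rw [c.right_inv hy]
    exact hF.mdifferentiableAt
  have hF2 : MDifferentiableAt (𝓡 n) 𝓘(ℝ, ℝ) F (c.symm y) := by
    refine (hF1.comp (c.symm y) (mdifferentiableAt_extChartAt (I := 𝓡 n) (x := q)
      (by simpa [hc] using hp))).congr_of_eventuallyEq ?_
    filter_upwards [(isOpen_extChartAt_source (I := 𝓡 n) q).mem_nhds hp] with p hp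
    exact congrArg F (c.left_inv hp).symm
  have hs := ((contMDiffOn_extChartAt_symm (n := ∞) (I := 𝓡 n) q).contMDiffAt
    ((isOpen_extChartAt_target q).mem_nhds hy)).mdifferentiableAt (by simp)
  have h1 := mfderiv_comp (I := 𝓡 n) (I' := 𝓡 n) (I'' := 𝓘(ℝ, ℝ)) y hF2 hs
  have h2 : (fderiv ℝ (fun w => F (c.symm w)) y : EuclideanSpace ℝ (Fin n) →L[ℝ] ℝ) =
      mfderiv (𝓡 n) 𝓘(ℝ, ℝ) (F ∘ c.symm) y := mfderiv_eq_fderiv.symm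
  refine congrArg Neg.neg (Eq.trans ?_ (DFunLike.congr_fun (h2.trans h1) _).symm)
  exact congrArg (mfderiv (𝓡 n) 𝓘(ℝ, ℝ) F (c.symm y)) (J.chartInvDeriv_inChart hy (v 0)).symm

theorem ricciForm_eq_trace (h : SmoothMetric n M) (J : EndField n M) (x : M)
    (u v : EuclideanSpace ℝ (Fin n)) :
    ricciForm h J x u v = LinearMap.trace ℝ (EuclideanSpace ℝ (Fin n))
      (((curvatureMap (christoffelMap h x) (extChartAt (𝓡 n) x x)).flip v).flip
        (J.inChart x (extChartAt (𝓡 n) x x) u)) :=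
  (congrArg (fun w : EuclideanSpace ℝ (Fin n) => ricci h x w v) (J.inChart_self x u).symm).trans
    (ricci_eq_trace h x _ v)

end AtBasePoint

end G2Quotient

end

theorem corollary2
    {Y : Type*} [TopologicalSpace Y] [ChartedSpace (EuclideanSpace ℝ (Fin 7)) Y] [IsManifold (𝓡 7) ∞ Y]
    {N : Type*} [TopologicalSpace N] [ChartedSpace (EuclideanSpace ℝ (Fin 6)) N] [IsManifold (𝓡 6) ∞ N]
    (φ : G2Quotient.DForm 7 Y 3) (hφ_smooth : φ.Smooth) (hφ : G2Quotient.IsAdmissible φ)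
    (hφ_torsion : G2Quotient.IsTorsionFree hφ)
    (V : G2Quotient.VField 7 Y) (hV : G2Quotient.IsNonvanishingSymmetry φ V)
    (π : Y → N) (hπ : G2Quotient.IsQuotientMap V π)
    (t : N → ℝ) (σ : G2Quotient.DForm 6 N 2) (h : G2Quotient.SmoothMetric 6 N)
    (J : G2Quotient.EndField 6 N)
    (hind : G2Quotient.IsInduced hφ V π t σ h J)
    (hJ : G2Quotient.IsIntegrable J) :
    ∀ (x : N) (u v : TangentSpace (𝓡 6) x),
      G2Quotient.ricciForm h J x u v =
        (1 / 2) * (G2Quotient.dc J (fun y => Real.log (t y))).d x ![u, v] := by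
  intro x u v
  obtain ⟨U, f, hUo, hxU, hUt, hUf⟩ :=
    G2Quotient.exists_local_section hπ.smooth hπ.surjective hπ.submersion x
  have hf : G2Quotient.IsSectionOn π x f U :=
    ⟨hUo, hUt, fun z hz => (hUf z hz).1, fun z hz => (hUf z hz).2⟩
  have H := hf.isKahlerSU3 hπ.smooth hφ_smooth hφ_torsion hV hind hJ
  set c := extChartAt (𝓡 6) x with hc
  set L : EuclideanSpace ℝ (Fin 6) → ℝ := fun w => Real.log (t (c.symm w)) with hL
  have hLs : ∀ y ∈ U, ContDiffAt ℝ ∞ L y := fun y hy =>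
    (H.contDiffAt_t hy).log (H.isSU3 y hy).norm_pos.ne'
  have h1 : ∀ w : Fin 1 → EuclideanSpace ℝ (Fin 6),
      (fun y => (G2Quotient.dc J (fun y => Real.log (t y))).inChart x y w) =ᶠ[nhds (c x)]
        fun y => -fderiv ℝ L y (J.inChart x y (w 0)) := by
    intro w
    filter_upwards [hUo.mem_nhds hxU] with y hy
    exact G2Quotient.dc_inChart_apply J _ (hUt hy) ((hLs y hy).differentiableAt (by simp)) w
  have h2 : DifferentiableAt ℝ ((G2Quotient.dc J (fun y => Real.log (t y))).inChart x) (c x) := by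
    refine (G2Quotient.contDiffAt_form fun I => ?_).differentiableAt (n := ∞) (by simp)
    refine ContDiffAt.congr_of_eventuallyEq ?_ (h1 _)
    exact (((hLs _ hxU).fderiv_right (m := ∞) (by simp)).clm_apply
      ((H.contDiffAt_J hxU).clm_apply contDiffAt_const)).neg
  have h3 := (G2Quotient.DForm.d_apply_two _ x u v).trans (G2Quotient.extDeriv_apply_two h2 u v)
  rw [(h1 _).fderiv_eq, (h1 _).fderiv_eq] at h3
  refine Eq.trans ?_ ((H.trace_curvatureMap hxU (by simp) u v).trans
    (congrArg (1 / 2 * ·) h3.symm))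
  -- the two traces over `ℝ⁶` agree up to the instances of its vector space structure
  convert G2Quotient.ricciForm_eq_trace h J x u v using 2
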